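/- Use coordinates $(t,x)\in\mathbb R\times\mathbb R^3$, with spatial indices referring to the Cartesian coordinates $x^1,x^2,x^3$ and $r=|x|$. Let $\alpha,\psi>0$ and $\beta^i$ be $C^2$ functions, $\chi=\alpha\psi$, $\gamma_{ij}=\psi^4\delta_{ij}$, $\sqrt\gamma=\psi^6$, and $$g=-\alpha^2dt^2+\gamma_{ij}(dx^i+\beta^idt)(dx^j+\beta^jdt),\qquad \hat K_i{}^j=\frac1{2\alpha}\Bigl(\partial_i\beta^j+\partial_j\beta^i-\tfrac23\delta_i^j\,\partial_k\beta^k\Bigr).$$ Let $T_{\mu\nu}=(\varepsilon+P)u_\mu u_\nu+Pg_{\mu\nu}$ be a perfect fluid, with $\varepsilon,P,u^\mu$ continuous and $u$ a future-directed unit timelike field, such that on each slice $t=\mathrm{const}$ the fluid vanishes ($\varepsilon=P=0$) outside a bounded set. With $n^\mu$ the future unit normal of the slices and $\gamma^\mu{}_\nu=\delta^\mu_\nu+n^\mu n_\nu$, put $\rho_H=T_{\mu\nu}n^\mu n^\nu$, $j_i=-T_{\mu\nu}\gamma^\mu{}_in^\nu$, $S_{ij}=T_{\mu\nu}\gamma^\mu{}_i\gamma^\nu{}_j$,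 $S_k{}^k=\gamma^{ij}S_{ij}$, $v^k=u^k/u^t$. Assume the Isenberg–Wilson–Mathews (IWM) equations (with $\Delta$ the flat Laplacian) $$\Delta\psi=-2\pi\psi^5\rho_H-\tfrac18\psi^5\hat K_i{}^j\hat K_j{}^i,\qquad \partial_j(\sqrt\gamma\hat K_i{}^j)=8\pi j_i\sqrt\gamma,$$ $$\Delta\chi=2\pi\chi\psi^4(\rho_H+2S_k{}^k)+\tfrac78\chi\psi^4\hat K_i{}^j\hat K_j{}^i ,$$ and, on each slice, $\psi=1+O(r^{-1})$, $\chi=1+O(r^{-1})$, $\beta^i=O(r^{-2})$, $\hat K_i{}^j=O(r^{-3})$ as $r\to\infty$, and vanishing momentum $\frac1{8\pi}\oint_\infty\hat K_i{}^j\sqrt\gamma\,d\sigma_j=0$. Here $d\sigma_j=(\partial_jr)\,r^2d\Omega$ and $\oint_\infty$ is the limit as $r\to\infty$ of the integral over the coordinate sphere of radius $r$. Then, on every slice, the limits $$M_\chi=\frac1{2\pi}\oint_\infty\psi\,\partial_j\chi\,d\sigma_j,\qquad M_{\rm ADM}=\frac1{16\pi}\oint_\infty(\partial_k\gamma_{jk}-\partial_j\gamma_{kk})\,d\sigma_j=-\frac1{2\pi}\oint_\infty\chi\,\partial_j\psi\,d\sigma_j,\qquad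 M_K=\frac1{4\pi}\oint_\infty\partial_j\alpha\,d\sigma_j$$ exist (and the two expressions for $M_{\rm ADM}$ agree), $M_\chi=-M_{\rm ADM}+2M_K$, the integrand of $$V=\int_{\mathbb R^3}\Bigl(j_kv^k\sqrt\gamma+3\alpha\sqrt\gamma P+\frac1{2\pi}\delta^{ij}\partial_i\chi\,\partial_j\psi-\frac12\sqrt\gamma\,j_k\beta^k\Bigr)d^3x$$ is integrable, and $M_\chi-M_{\rm ADM}=2V$. Hence the virial relation $V=0$ is equivalent to $M_\chi=M_{\rm ADM}$, and thus to $M_K=M_{\rm ADM}$ (Komar mass equals ADM mass). If, moreover, for some real $\Omega,b$ the vector field $k=\partial_t+\Omega\phi$, $\phi=(-x^2,x^1-b,0)$, is a helical Killing vector generating a symmetry of the fluid (its flow preserves $g,\varepsilon,P,u$), and the fluid satisfies the relativistic Euler equation $\gamma^\nu{}_k\nabla_\mu T^\mu{}_\nu=0$ in the sense of distributions, i.e. $\int\frac12T^{\mu\nu}(\mathcal L_\xi g)_{\mu\nu}\sqrt{-g}\,d^4x=0$ for all smooth compactly supported vector fields $\xi$ with $\xi^t=0$, then the virial relation $V=0$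 holds on every slice, so that $M_\chi=M_{\rm ADM}=M_K$. -/

import Mathlib

open MeasureTheory Filter Topology Asymptotics
open scoped ContDiff

noncomputable section

namespace IWM

/-- Euclidean three-space; its coordinates `x 0, x 1, x 2` are the Cartesian coordinates of the
flat metric. -/
abbrev E3 : Type := EuclideanSpace ℝ (Fin 3)

/-- The chart `(t, x)` of spacetime. -/
abbrev Spacetime : Type := ℝ × E3

/-- The coordinates of an event: index `0` is `t`, index `i.succ` is the Cartesian `x i`. -/
def coord (p : Spacetime) : Fin 4 → ℝ := Fin.cons p.1 (fun i => p.2 i)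

/-- The coordinate vectors of the chart. -/
def coordVec : Fin 4 → Spacetime :=
  Fin.cons ((1 : ℝ), (0 : E3)) (fun i => ((0 : ℝ), EuclideanSpace.single i (1 : ℝ)))

/-- The coordinate derivative `∂_μ f`. The spatial derivative `∂_i` is `pd i.succ`. -/
def pd (μ : Fin 4) (f : Spacetime → ℝ) (p : Spacetime) : ℝ := fderiv ℝ f p (coordVec μ)

/-- The flat Laplacian in the spatial coordinates. -/
def flatLaplacian (f : Spacetime → ℝ) (p : Spacetime) : ℝ :=
  ∑ i : Fin 3, pd i.succ (pd i.succ f) p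

/-- The fields of a spatially conformally flat spacetime filled with a perfect fluid. -/
structure Fields where
  /-- the lapse `α` -/
  lapse : Spacetime → ℝ
  /-- the conformal factor `ψ` -/
  psi : Spacetime → ℝ
  /-- the Cartesian components `β^i` of the shift, `t^μ = α n^μ + β^μ` with `t = ∂_t` -/
  shift : Spacetime → Fin 3 → ℝ
  /-- the energy density `ε` in the frame of the fluid -/
  energy : Spacetime → ℝ
  /-- the pressure `P` -/
  pressure : Spacetime → ℝ
  /-- the components `u^μ` of the four-velocity -/
  vel : Spacetime → Fin 4 → ℝ

namespace Fields

variable (c : Fields)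

/-! ### Geometry -/

/-- `χ = α ψ`. -/
def chi (p : Spacetime) : ℝ := c.lapse p * c.psi p

/-- The spatial metric `γ_ij = ψ⁴ δ_ij`. -/
def spatialMetric (p : Spacetime) : Matrix (Fin 3) (Fin 3) ℝ :=
  fun i j => c.psi p ^ 4 * (if i = j then 1 else 0)

/-- `√γ = ψ⁶`, the square root of `det γ_ij`. -/
def sqrtGamma (p : Spacetime) : ℝ := c.psi p ^ 6

/-- The one-forms `dx^i + β^i dt`. -/
def coframe (p : Spacetime) (i : Fin 3) : Fin 4 → ℝ :=
  Fin.cons (c.shift p i) (fun j => if j = i then 1 else 0)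

/-- The spacetime metric `-α² dt² + γ_ij (dx^i + β^i dt) (dx^j + β^j dt)`. -/
def metric (p : Spacetime) : Matrix (Fin 4) (Fin 4) ℝ :=
  fun μ ν => -(c.lapse p) ^ 2 * ((if μ = 0 then 1 else 0) * (if ν = 0 then 1 else 0))
    + ∑ i, ∑ j, c.spatialMetric p i j * c.coframe p i μ * c.coframe p j ν

/-- `√(-g)`. -/
def sqrtNegDet (p : Spacetime) : ℝ := Real.sqrt (-(c.metric p).det)

/-- The future unit normal `n^μ = (1, -β^i) / α` of the slices of constant `t`. -/
def normal (p : Spacetime) : Fin 4 → ℝ :=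
  Fin.cons (1 / c.lapse p) (fun i => -c.shift p i / c.lapse p)

/-- Lowering an index with the spacetime metric. -/
def lower (p : Spacetime) (w : Fin 4 → ℝ) (μ : Fin 4) : ℝ := ∑ ν, c.metric p μ ν * w ν

/-- The projection `γ^μ_ν = δ^μ_ν + n^μ n_ν` orthogonal to the normal. -/
def proj (p : Spacetime) (μ ν : Fin 4) : ℝ :=
  (if μ = ν then 1 else 0) + c.normal p μ * c.lower p (c.normal p) ν

/-- The components `K̂_i^j` of the tracefree extrinsic curvature. -/
def Khat (p : Spacetime) (i j : Fin 3) : ℝ :=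
  1 / (2 * c.lapse p) *
    (pd i.succ (fun q => c.shift q j) p + pd j.succ (fun q => c.shift q i) p
      - 2 / 3 * (if i = j then 1 else 0) * ∑ k : Fin 3, pd k.succ (fun q => c.shift q k) p)

/-- `K̂_i^j K̂_j^i`. -/
def KhatSq (p : Spacetime) : ℝ := ∑ i, ∑ j, c.Khat p i j * c.Khat p j i

/-! ### Matter -/

/-- The perfect-fluid tensor `T_μν = (ε + P) u_μ u_ν + P g_μν`. -/
def stress (p : Spacetime) (μ ν : Fin 4) : ℝ :=
  (c.energy p + c.pressure p) * c.lower p (c.vel p) μ * c.lower p (c.vel p) ν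
    + c.pressure p * c.metric p μ ν

/-- The perfect-fluid tensor with upper indices, `T^μν = (ε + P) u^μ u^ν + P g^μν`. -/
def stressUp (p : Spacetime) (μ ν : Fin 4) : ℝ :=
  (c.energy p + c.pressure p) * c.vel p μ * c.vel p ν + c.pressure p * (c.metric p)⁻¹ μ ν

/-- `ρ_H = T_μν n^μ n^ν`. -/
def rhoH (p : Spacetime) : ℝ :=
  ∑ μ, ∑ ν, c.stress p μ ν * c.normal p μ * c.normal p ν

/-- `j_i = -T_μν γ^μ_i n^ν`. -/
def mom (p : Spacetime) (i : Fin 3) : ℝ :=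
  -∑ μ, ∑ ν, c.stress p μ ν * c.proj p μ i.succ * c.normal p ν

/-- `S_ij = T_μν γ^μ_i γ^ν_j`. -/
def spatialStress (p : Spacetime) (i j : Fin 3) : ℝ :=
  ∑ μ, ∑ ν, c.stress p μ ν * c.proj p μ i.succ * c.proj p ν j.succ

/-- `S_k^k = γ^ij S_ij`, where `γ^ij = ψ⁻⁴ δ^ij`. -/
def stressTrace (p : Spacetime) : ℝ := (∑ k, c.spatialStress p k k) / c.psi p ^ 4

/-- `v^k = u^k / u^t`. -/
def coordVel (p : Spacetime) (k : Fin 3) : ℝ := c.vel p k.succ / c.vel p 0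

/-! ### Hypotheses on the fields -/

/-- Regularity and signs: the potentials are twice continuously differentiable, the lapse and the
conformal factor are positive, the matter variables are continuous, and `u` is a future-directed
unit timelike vector field. (Where `ε = P = 0` the values of `u` play no role.) -/
structure IsAdmissible : Prop where
  lapse_smooth : ContDiff ℝ 2 c.lapse
  psi_smooth : ContDiff ℝ 2 c.psi
  shift_smooth : ContDiff ℝ 2 c.shift
  lapse_pos : ∀ p, 0 < c.lapse p
  psi_pos : ∀ p, 0 < c.psi p
  energy_cont : Continuous c.energy
  pressure_cont : Continuous c.pressure
  vel_cont : Continuous c.vel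
  vel_unit : ∀ p, ∑ μ, ∑ ν, c.metric p μ ν * c.vel p μ * c.vel p ν = -1
  vel_future : ∀ p, 0 < c.vel p 0

/-- On each slice the matter occupies a bounded region. -/
def HasBoundedMatter : Prop :=
  ∀ t : ℝ, ∃ R : ℝ, ∀ x : E3, R < ‖x‖ → c.energy (t, x) = 0 ∧ c.pressure (t, x) = 0

/-- The Hamiltonian constraint, the momentum constraint, and the equation for the slicing
condition. -/
structure SolvesFieldEquations : Prop where
  hamiltonian : ∀ p, flatLaplacian c.psi p =
    -2 * Real.pi * c.psi p ^ 5 * c.rhoH p - c.psi p ^ 5 / 8 * c.KhatSq p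
  momentum : ∀ p i, ∑ j : Fin 3, pd j.succ (fun q => c.sqrtGamma q * c.Khat q i j) p =
    8 * Real.pi * c.mom p i * c.sqrtGamma p
  slicing : ∀ p, flatLaplacian c.chi p =
    2 * Real.pi * c.chi p * c.psi p ^ 4 * (c.rhoH p + 2 * c.stressTrace p)
      + 7 / 8 * c.chi p * c.psi p ^ 4 * c.KhatSq p

/-- Asymptotic falloff on each slice: `ψ = 1 + O(r⁻¹)`, `χ = 1 + O(r⁻¹)`, `β^i = O(r⁻²)`,
`K̂_i^j = O(r⁻³)`. -/
structure HasFalloff : Prop where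
  psi : ∀ t : ℝ, (fun x : E3 => c.psi (t, x) - 1) =O[Bornology.cobounded E3] fun x => ‖x‖⁻¹
  chi : ∀ t : ℝ, (fun x : E3 => c.chi (t, x) - 1) =O[Bornology.cobounded E3] fun x => ‖x‖⁻¹
  shift : ∀ (t : ℝ) (i : Fin 3),
    (fun x : E3 => c.shift (t, x) i) =O[Bornology.cobounded E3] fun x => ‖x‖⁻¹ ^ 2
  Khat : ∀ (t : ℝ) (i j : Fin 3),
    (fun x : E3 => c.Khat (t, x) i j) =O[Bornology.cobounded E3] fun x => ‖x‖⁻¹ ^ 3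

end Fields

/-! ### Surface integrals at infinity -/

/-- The flux `∮ V_j dσ_j`, `dσ_j = (∂_j r) r² dΩ`, through the coordinate sphere of radius `r`. -/
def flux (V : E3 → Fin 3 → ℝ) (r : ℝ) : ℝ :=
  ∫ w : Metric.sphere (0 : E3) 1,
    (∑ j : Fin 3, V (r • (w : E3)) j * (w : E3) j) * r ^ 2 ∂((volume : Measure E3).toSphere)

namespace Fields

variable (c : Fields)

/-- The total momentum `P_i = (1/8π) ∮_∞ K̂_i^j √γ dσ_j` of each slice vanishes. -/
def HasZeroMomentum : Prop :=
  ∀ (t : ℝ) (i : Fin 3), Tendsto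
    (fun r => 1 / (8 * Real.pi) * flux (fun x j => c.Khat (t, x) i j * c.sqrtGamma (t, x)) r)
    atTop (𝓝 0)

/-- `M = M_χ = (1/2π) ∮_∞ ψ ∂_j χ dσ_j` on the slice of constant `t`. -/
def IsChiMass (t M : ℝ) : Prop :=
  Tendsto (fun r => 1 / (2 * Real.pi) *
    flux (fun x j => c.psi (t, x) * pd j.succ c.chi (t, x)) r) atTop (𝓝 M)

/-- `M = M_ADM = (1/16π) ∮_∞ (∂_k γ_jk - ∂_j γ_kk) dσ_j`. -/
def IsADMMass (t M : ℝ) : Prop :=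
  Tendsto (fun r => 1 / (16 * Real.pi) *
    flux (fun x j => ∑ k : Fin 3, (pd k.succ (fun q => c.spatialMetric q j k) (t, x)
      - pd j.succ (fun q => c.spatialMetric q k k) (t, x))) r) atTop (𝓝 M)

/-- `M = -(1/2π) ∮_∞ χ ∂_j ψ dσ_j`, the ADM mass as read off from the conformal factor. -/
def IsConformalADMMass (t M : ℝ) : Prop :=
  Tendsto (fun r => -(1 / (2 * Real.pi)) *
    flux (fun x j => c.chi (t, x) * pd j.succ c.psi (t, x)) r) atTop (𝓝 M)

/-- `M = M_K = (1/4π) ∮_∞ ∂_j α dσ_j`, the Komar mass. -/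
def IsKomarMass (t M : ℝ) : Prop :=
  Tendsto (fun r => 1 / (4 * Real.pi) *
    flux (fun x j => pd j.succ c.lapse (t, x)) r) atTop (𝓝 M)

/-- The integrand of the virial relation,
`j_k v^k √γ + 3 α √γ P + (1/2π) δ^ij ∂_i χ ∂_j ψ - ½ √γ j_k β^k`. -/
def virialDensity (p : Spacetime) : ℝ :=
  (∑ k, c.mom p k * c.coordVel p k) * c.sqrtGamma p
    + 3 * c.lapse p * c.sqrtGamma p * c.pressure p
    + 1 / (2 * Real.pi) * ∑ i : Fin 3, pd i.succ c.chi p * pd i.succ c.psi p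
    - 1 / 2 * c.sqrtGamma p * ∑ k, c.mom p k * c.shift p k

/-- The virial integral over the slice of constant `t`. -/
def virialIntegral (t : ℝ) : ℝ := ∫ x : E3, c.virialDensity (t, x)

/-! ### The Euler equation -/

/-- `(£_ξ g)_μν`. -/
def lieMetric (ξ : Spacetime → Fin 4 → ℝ) (p : Spacetime) (μ ν : Fin 4) : ℝ :=
  ∑ l, (ξ p l * pd l (fun q => c.metric q μ ν) p
    + c.metric p l ν * pd μ (fun q => ξ q l) p + c.metric p μ l * pd ν (fun q => ξ q l) p)

/-- The relativistic Euler equation `γ^ν_k ∇_μ T^μ_ν = 0` in the sense of distributions, as befits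
matter with a surface: `∫ T^μν ∇_μ ξ_ν √(-g) d⁴x = ½ ∫ T^μν (£_ξ g)_μν √(-g) d⁴x = 0` for all test
vector fields `ξ` tangent to the slices. For continuously differentiable matter this is the
pointwise equation, by an integration by parts. -/
def SolvesEuler : Prop :=
  ∀ ξ : Spacetime → Fin 4 → ℝ, ContDiff ℝ ∞ ξ → HasCompactSupport ξ → (∀ p, ξ p 0 = 0) →
    ∫ p : Spacetime,
      1 / 2 * (∑ μ, ∑ ν, c.stressUp p μ ν * c.lieMetric ξ p μ ν) * c.sqrtNegDet p = 0

end Fields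

/-! ### Helical symmetry -/

/-- The vector field `k = ∂_t + Ω φ`, where `φ = (-x², x¹ - b, 0)` generates the rotations of the
flat metric about an axis parallel to the third one. -/
def helicalVector (Ω b : ℝ) (p : Spacetime) : Spacetime :=
  (1, !₂[-(Ω * p.2 1), Ω * (p.2 0 - b), 0])

/-- The flow of `helicalVector Ω b` for the time `s`. -/
def helicalFlow (Ω b s : ℝ) (p : Spacetime) : Spacetime :=
  (p.1 + s,
    !₂[b + Real.cos (Ω * s) * (p.2 0 - b) - Real.sin (Ω * s) * p.2 1,
      Real.sin (Ω * s) * (p.2 0 - b) + Real.cos (Ω * s) * p.2 1,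
      p.2 2])

theorem helicalFlow_zero (Ω b : ℝ) (p : Spacetime) : helicalFlow Ω b 0 p = p := by
  refine Prod.ext (by simp [helicalFlow]) ?_
  ext i
  fin_cases i <;> simp [helicalFlow]

theorem hasDerivAt_helicalFlow (Ω b s : ℝ) (p : Spacetime) :
    HasDerivAt (fun s => helicalFlow Ω b s p) (helicalVector Ω b (helicalFlow Ω b s p)) s := by
  have hl : HasDerivAt (fun s : ℝ => Ω * s) Ω s := by
    simpa using (hasDerivAt_id s).const_mul Ω
  have hc := hl.cos
  have hs := hl.sin
  refine HasDerivAt.prodMk ((hasDerivAt_id s).const_add p.1) ?_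
  refine ((PiLp.continuousLinearEquiv 2 ℝ (fun _ : Fin 3 => ℝ)).symm.hasFDerivAt.comp_hasDerivAt s
    (f' := ![_, _, _]) (hasDerivAt_pi.2 fun i => ?_))
  fin_cases i
  · refine (((hc.mul_const (p.2 0 - b)).const_add b).sub (hs.mul_const (p.2 1))).congr_deriv ?_
    simp [helicalFlow]
    ring
  · refine ((hs.mul_const (p.2 0 - b)).add (hc.mul_const (p.2 1))).congr_deriv ?_
    simp [helicalFlow]
    ring
  · exact hasDerivAt_const s (p.2 2)

/-- The Jacobian matrix `∂_ν Φ^μ` of the helical flow. -/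
def flowJacobian (Ω b s : ℝ) (p : Spacetime) (μ ν : Fin 4) : ℝ :=
  pd ν (fun q => coord (helicalFlow Ω b s q) μ) p

/-- `k = ∂_t + Ω φ` is a Killing vector and generates a symmetry of the fluid: its flow preserves
the spacetime metric, the energy density, the pressure and the four-velocity. -/
structure Fields.IsHelicallySymmetric (c : Fields) (Ω b : ℝ) : Prop where
  metric : ∀ s p μ ν, ∑ κ, ∑ l, c.metric (helicalFlow Ω b s p) κ l *
    flowJacobian Ω b s p κ μ * flowJacobian Ω b s p l ν = c.metric p μ ν
  energy : ∀ s p, c.energy (helicalFlow Ω b s p) = c.energy p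
  pressure : ∀ s p, c.pressure (helicalFlow Ω b s p) = c.pressure p
  vel : ∀ s p μ, c.vel (helicalFlow Ω b s p) μ = ∑ ν, flowJacobian Ω b s p μ ν * c.vel p ν

end IWM

end

noncomputable section

namespace IWM

/-! Everything reduces to integrals over one slice. The falloff assumptions say nothing about
derivatives of ψ and χ, so pointwise control of gradients is replaced by L² control. The field
equations make Δψ and Δχ integrable: the matter is compactly supported and K̂² = O(r⁻⁶). Since ψ - 1
and χ - 1 are O(r⁻¹), a Caccioppoli estimate (`integrable_energy`, `sqGrad_of_laplacian`) then gives
square integrable gradients. A cutoff argument (`integral_divE_eq_zero`) shows that ∫ div V = 0 as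
soon as div V and V/(1+r) are integrable. Together with the divergence theorem on balls
(`flux_eq_integral_divE`) this yields `tendsto_flux_mul_grad`: if m = 1 + O(r⁻¹) has an L² gradient,
the flux of m∇f tends to ∫ Δf.

With A = ∫ Δχ and B = ∫ Δψ the masses are M_χ = A/2π, M_ADM = -B/2π and M_K = (A - B)/4π, which
gives the linear relation among them. Moreover div(ψ∇χ + χ∇ψ) is 4π times the virial density plus ¾
of the divergence of √γ K̂_k^i β^k. The latter integrates to zero, so A + B = 4πV
(`integral_lap_add_lap`), that is M_χ - M_ADM = 2V.

For the helical case, the dilation x - b about a point of the rotation axis is used in two ways.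
Geometrically, a Pohozaev identity for ψ, χ and β (`dilWork_eq`, `integral_dilWork`) shows that V
equals the total work W of the matter under the dilation. Dynamically, the weak Euler equation
tested with θ(t)(x - b), cut off outside the matter, reads ∫ θW dt + ∫ θ'J dt = 0, where J = ∫ √γ
j_k (x - b)^k d³x. The helical flow carries slices to slices by Euclidean isometries fixing the
axis, so J is constant and the second term vanishes. Hence W = 0 for almost every t, and by
continuity for every t (`integral_dilWork_eq_zero`).

The gradient of β enters the dilation current, and K̂ = O(r⁻³) controls only its tracefree symmetric
part. A Korn inequality (`sqGrad_shift`) puts the whole gradient in L². -/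

/-- The partial derivative `∂_i f` of a function on Euclidean three-space. -/
def sd (i : Fin 3) (f : E3 → ℝ) (x : E3) : ℝ := fderiv ℝ f x (EuclideanSpace.single i 1)

/-- The divergence `∂_i V_i` of a vector field on Euclidean three-space. -/
def divE (V : E3 → Fin 3 → ℝ) (x : E3) : ℝ := ∑ i, sd i (fun y => V y i) x

/-- The flat Laplacian on Euclidean three-space. -/
def lap (f : E3 → ℝ) (x : E3) : ℝ := ∑ i, sd i (sd i f) x

/-! ### Derivatives and integration by parts on Euclidean three-space -/

theorem continuous_sd {f : E3 → ℝ} (hf : ContDiff ℝ 1 f) (i : Fin 3) : Continuous (sd i f) :=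
  (hf.continuous_fderiv one_ne_zero).clm_apply continuous_const

theorem contDiff_sd {f : E3 → ℝ} (hf : ContDiff ℝ 2 f) (i : Fin 3) : ContDiff ℝ 1 (sd i f) :=
  (hf.fderiv_right (m := 1) le_rfl).clm_apply contDiff_const

theorem continuous_divE {V : E3 → Fin 3 → ℝ} (hV : ContDiff ℝ 1 V) : Continuous (divE V) :=
  continuous_finsetSum _ fun i _ => continuous_sd (contDiff_pi.1 hV i) i

theorem integral_mul_divE {η : E3 → ℝ} {V : E3 → Fin 3 → ℝ} (hη : ContDiff ℝ 1 η)
    (hs : HasCompactSupport η) (hV : ContDiff ℝ 1 V) :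
    ∫ x, η x * divE V x = -∫ x, ∑ i, sd i η x * V x i := by
  have hVi := contDiff_pi.1 hV
  have h1 : ∀ i, Integrable fun x => η x * sd i (fun y => V y i) x := fun i =>
    (hη.continuous.mul (continuous_sd (hVi i) i)).integrable_of_hasCompactSupport hs.mul_right
  have h2 : ∀ i, Integrable fun x => sd i η x * V x i := fun i => by
    refine ((continuous_sd hη i).mul (hVi i).continuous).integrable_of_hasCompactSupport ?_
    exact HasCompactSupport.mul_right (f := sd i η) (hs.fderiv_apply ℝ _)
  simp only [divE, Finset.mul_sum]
  rw [integral_finsetSum _ fun i _ => h1 i, integral_finsetSum _ fun i _ => h2 i,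
    ← Finset.sum_neg_distrib]
  refine Finset.sum_congr rfl fun i _ => ?_
  exact integral_mul_fderiv_eq_neg_fderiv_mul_of_integrable (h2 i) (h1 i)
    ((hη.continuous.mul (hVi i).continuous).integrable_of_hasCompactSupport hs.mul_right)
    (fun x _ => hη.differentiable one_ne_zero x) (fun x _ => (hVi i).differentiable one_ne_zero x)

/-! ### Polar coordinates -/

/-- Removing the origin, a null set, identifies space with the product of the unit sphere and the
half-line carrying the measure r² dr; the claim is Fubini for this product. -/
theorem polar_integral {F : E3 → ℝ} (hF : Integrable F) :
    IntegrableOn (fun r : ℝ => r ^ 2 * ∫ w : Metric.sphere (0 : E3) 1, F (r • (w : E3))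
      ∂((volume : Measure E3).toSphere)) (Set.Ioi 0) ∧
    ∫ x, F x = ∫ r in Set.Ioi (0 : ℝ), r ^ 2 * ∫ w : Metric.sphere (0 : E3) 1, F (r • (w : E3))
      ∂((volume : Measure E3).toSphere) := by
  have hdim : Module.finrank ℝ E3 - 1 = 2 := by simp
  have hmp := (volume : Measure E3).measurePreserving_homeomorphUnitSphereProd
  rw [hdim] at hmp
  set S := (volume : Measure E3).toSphere
  have hsub : Integrable (fun x : ({(0 : E3)}ᶜ : Set E3) => F x) (Measure.comap Subtype.val volume) := by
    rw [← Function.comp_def F, ← integrableOn_iff_comap_subtypeVal (by measurability)]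
    exact hF.integrableOn
  set H : Metric.sphere (0 : E3) 1 × Set.Ioi (0 : ℝ) → ℝ := fun z => F ((z.2 : ℝ) • (z.1 : E3))
  have hHF : (fun x : ({(0 : E3)}ᶜ : Set E3) => F x) = H ∘ homeomorphUnitSphereProd E3 := by
    funext x
    have hx : ‖(x : E3)‖ ≠ 0 := norm_ne_zero_iff.2 x.2
    simp [H, homeomorphUnitSphereProd_apply_snd_coe, homeomorphUnitSphereProd_apply_fst_coe,
      smul_smul, mul_inv_cancel₀ hx]
  have hH : Integrable H (S.prod (.volumeIoiPow 2)) := by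
    rw [← hmp.integrable_comp_emb (Homeomorph.measurableEmbedding _), ← hHF]
    exact hsub
  have hint : ∫ x, F x = ∫ z, H z ∂(S.prod (.volumeIoiPow 2)) := by
    rw [← hmp.integral_comp (Homeomorph.measurableEmbedding _)]
    have : ∫ x, F x = ∫ x : ({(0 : E3)}ᶜ : Set E3), F x ∂(Measure.comap Subtype.val volume) := by
      rw [integral_subtype_comap (measurableSet_singleton _).compl F, restrict_compl_singleton]
    rw [this]
    exact integral_congr_ae (Eventually.of_forall fun x => congrFun hHF x)
  have hm : Measurable fun r : Set.Ioi (0 : ℝ) => Real.toNNReal ((r : ℝ) ^ 2) :=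
    (measurable_subtype_coe.pow_const _).real_toNNReal
  constructor
  · have h1 := hH.integral_prod_right
    rw [Measure.volumeIoiPow] at h1
    have h2 := (integrable_withDensity_iff_integrable_smul (μ := Measure.comap Subtype.val volume)
      hm).1 h1
    rw [integrableOn_iff_comap_subtypeVal measurableSet_Ioi]
    refine h2.congr (Eventually.of_forall fun r => ?_)
    simp [H, NNReal.smul_def, Real.coe_toNNReal _ (sq_nonneg (r : ℝ))]
  · rw [hint, integral_prod_symm _ hH]
    simp only [Measure.volumeIoiPow, ENNReal.ofReal]
    rw [integral_withDensity_eq_integral_smul hm,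
      ← integral_subtype_comap measurableSet_Ioi]
    refine integral_congr_ae (Eventually.of_forall fun r => ?_)
    simp [H, NNReal.smul_def, Real.coe_toNNReal _ (sq_nonneg (r : ℝ))]

/-! ### Fluxes through spheres and the divergence theorem on balls -/

/-- The flux integrand `∮ F r² dΩ` of a scalar function. -/
def sphereInt (F : E3 → ℝ) (r : ℝ) : ℝ :=
  r ^ 2 * ∫ w : Metric.sphere (0 : E3) 1, F (r • (w : E3)) ∂((volume : Measure E3).toSphere)

theorem continuous_sphereInt {F : E3 → ℝ} (hF : Continuous F) : Continuous (sphereInt F) := by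
  refine (continuous_pow 2).mul ?_
  have := continuous_parametric_integral_of_continuous
    (μ := (volume : Measure E3).toSphere) (s := Set.univ)
    (f := fun (r : ℝ) (w : Metric.sphere (0 : E3) 1) => F (r • (w : E3)))
    (by unfold Function.uncurry; fun_prop) isCompact_univ
  simpa using this

theorem continuous_flux {V : E3 → Fin 3 → ℝ} (hV : Continuous V) : Continuous (flux V) := by
  have := continuous_parametric_integral_of_continuous
    (μ := (volume : Measure E3).toSphere) (s := Set.univ)
    (f := fun (r : ℝ) (w : Metric.sphere (0 : E3) 1) =>
      (∑ j : Fin 3, V (r • (w : E3)) j * (w : E3) j) * r ^ 2)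
    (by unfold Function.uncurry; fun_prop) isCompact_univ
  simp only [Measure.restrict_univ] at this
  exact this

theorem integrable_flux_integrand {V : E3 → Fin 3 → ℝ} (hV : Continuous V) (r : ℝ) : Integrable
    (fun w : Metric.sphere (0 : E3) 1 => (∑ j : Fin 3, V (r • (w : E3)) j * (w : E3) j) * r ^ 2)
    ((volume : Measure E3).toSphere) :=
  Continuous.integrable_of_hasCompactSupport (by fun_prop) (HasCompactSupport.of_compactSpace _)

theorem flux_const_mul (a : ℝ) (V : E3 → Fin 3 → ℝ) (r : ℝ) :
    flux (fun x j => a * V x j) r = a * flux V r := by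
  simp only [flux, mul_assoc, ← Finset.mul_sum, integral_const_mul]

theorem flux_add {V W : E3 → Fin 3 → ℝ} (hV : Continuous V) (hW : Continuous W) (r : ℝ) :
    flux (fun x j => V x j + W x j) r = flux V r + flux W r := by
  simp only [flux]
  rw [← integral_add (integrable_flux_integrand hV r) (integrable_flux_integrand hW r)]
  simp only [add_mul, Finset.sum_add_distrib]

theorem flux_sub {V W : E3 → Fin 3 → ℝ} (hV : Continuous V) (hW : Continuous W) (r : ℝ) :
    flux (fun x j => V x j - W x j) r = flux V r - flux W r := by
  simp only [flux]
  rw [← integral_sub (integrable_flux_integrand hV r) (integrable_flux_integrand hW r)]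
  simp only [sub_mul, Finset.sum_sub_distrib]

theorem integral_eq_integral_sphereInt {F : E3 → ℝ} (hF : Integrable F) :
    ∫ x, F x = ∫ r in Set.Ioi (0 : ℝ), sphereInt F r := (polar_integral hF).2

theorem sd_comp_norm_sq {G θ : ℝ → ℝ} (hG : ∀ s, HasDerivAt G (θ s) s) (i : Fin 3) (x : E3) :
    sd i (fun y => G (‖y‖ ^ 2)) x = θ (‖x‖ ^ 2) * (2 * x i) := by
  have h1 : HasFDerivAt (fun y : E3 => ‖y‖ ^ 2) (2 • (innerSL ℝ) x) x :=
    (hasStrictFDerivAt_norm_sq x).hasFDerivAt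
  have h2 := (hG (‖x‖ ^ 2)).comp_hasFDerivAt x h1
  have h3 : fderiv ℝ (fun y : E3 => G (‖y‖ ^ 2)) x = θ (‖x‖ ^ 2) • (2 • (innerSL ℝ) x) := h2.fderiv
  rw [sd, h3]
  simp [EuclideanSpace.inner_single_right]

/-- The divergence theorem on balls, averaged over the radius. Testing div V against G(|x|²) with G'
= θ produces θ(r²)·2r times the flux on one side and G(r²) times the spherical integral of div V on
the other; an integration by parts in r moves the derivative onto G. The square of the norm keeps
the test function differentiable at the origin. -/
theorem radial_weak_divergence {V : E3 → Fin 3 → ℝ} (hV : ContDiff ℝ 1 V) {θ : ℝ → ℝ}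
    (hθ : Continuous θ) {B : ℝ} (hB : ∀ s, B ≤ s → θ s = 0) (hB0 : 0 ≤ B) :
    ∫ r in Set.Ioi (0 : ℝ), θ (r ^ 2) * (2 * r) * (flux V r - ∫ s in 0..r, sphereInt (divE V) s)
      = 0 := by
  set G : ℝ → ℝ := fun s => (∫ u in (0 : ℝ)..s, θ u) - ∫ u in (0 : ℝ)..B, θ u with hGdef
  have hG : ∀ s, HasDerivAt G (θ s) s := fun s =>
    (intervalIntegral.integral_hasDerivAt_right (hθ.intervalIntegrable _ _)
      (hθ.stronglyMeasurableAtFilter _ _) hθ.continuousAt).sub_const _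
  have hG0 : ∀ s, B ≤ s → G s = 0 := by
    intro s hs
    have : ∫ u in B..s, θ u = 0 := by
      rw [intervalIntegral.integral_congr (g := fun _ => 0)]
      · simp
      · intro u hu
        rw [Set.uIcc_of_le hs] at hu
        exact hB u hu.1
    simp only [hGdef]
    rw [← intervalIntegral.integral_add_adjacent_intervals
      (hθ.intervalIntegrable 0 B) (hθ.intervalIntegrable B s), this]
    simp
  have hGd : ContDiff ℝ 1 G := by
    rw [contDiff_one_iff_deriv]
    refine ⟨fun s => (hG s).differentiableAt, ?_⟩
    rwa [show deriv G = θ from funext fun s => (hG s).deriv]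
  -- With B ≥ 0, a radius r ≥ B + 1 satisfies r² ≥ B, so everything vanishes beyond b.
  set b := B + 1
  have hb0 : 0 < b := by positivity
  have hbB : ∀ r, b ≤ r → B ≤ r ^ 2 := by
    intro r hr
    have h1 : b ≤ r := hr
    have : B + 1 ≤ r := h1
    nlinarith
  have hsupp : ∀ f : E3 → ℝ, (∀ x, b ≤ ‖x‖ → f x = 0) → HasCompactSupport f := fun f hf =>
    HasCompactSupport.of_support_subset_isCompact (isCompact_closedBall (0 : E3) b)
      (fun x hx => by
        by_contra h
        simp only [Metric.mem_closedBall, dist_zero_right, not_le] at h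
        exact hx (hf x h.le))
  have hη : ContDiff ℝ 1 fun x : E3 => G (‖x‖ ^ 2) := hGd.comp (contDiff_norm_sq ℝ)
  have hVc := hV.continuous
  have hdc := continuous_divE hV
  have hparts := integral_mul_divE hη (hsupp _ fun x hx => hG0 _ (hbB _ hx)) hV
  simp only [sd_comp_norm_sq hG] at hparts
  rw [integral_eq_integral_sphereInt, integral_eq_integral_sphereInt] at hparts
  rotate_left
  · refine Continuous.integrable_of_hasCompactSupport (by fun_prop)
      (hsupp _ fun x hx => ?_)
    simp [hB _ (hbB _ hx)]
  · refine Continuous.integrable_of_hasCompactSupport (hη.continuous.mul hdc)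
      (hsupp _ fun x hx => ?_)
    simp [hG0 _ (hbB _ hx)]
  have hnorm : ∀ r : ℝ, 0 < r → ∀ w : Metric.sphere (0 : E3) 1, ‖r • (w : E3)‖ = r := by
    intro r hr w
    rw [norm_smul, norm_eq_of_mem_sphere w, mul_one, Real.norm_of_nonneg hr.le]
  have hL : ∀ r ∈ Set.Ioi (0 : ℝ), sphereInt (fun x => G (‖x‖ ^ 2) * divE V x) r
      = G (r ^ 2) * sphereInt (divE V) r := by
    intro r hr
    simp only [sphereInt, hnorm r hr, integral_const_mul]
    ring
  have hR : ∀ r ∈ Set.Ioi (0 : ℝ), sphereInt (fun x => ∑ i, θ (‖x‖ ^ 2) * (2 * x i) * V x i) r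
      = θ (r ^ 2) * (2 * r) * flux V r := by
    intro r hr
    simp only [sphereInt, flux, hnorm r hr]
    rw [← integral_const_mul, ← integral_const_mul]
    refine integral_congr_ae (Eventually.of_forall fun w => ?_)
    simp only [Fin.sum_univ_three, PiLp.smul_apply, smul_eq_mul]
    ring
  rw [setIntegral_congr_fun measurableSet_Ioi hL, setIntegral_congr_fun measurableSet_Ioi hR]
    at hparts
  have hDc := continuous_sphereInt hdc
  have hfc := continuous_flux hVc
  set D := sphereInt (divE V)
  have hP : ∀ r, HasDerivAt (fun r => ∫ s in (0 : ℝ)..r, D s) (D r) r := fun r =>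
    intervalIntegral.integral_hasDerivAt_right (hDc.intervalIntegrable _ _)
      (hDc.stronglyMeasurableAtFilter _ _) hDc.continuousAt
  have hPc : Continuous fun r => ∫ s in (0 : ℝ)..r, D s :=
    continuous_iff_continuousAt.2 fun r => (hP r).continuousAt
  have hu : ∀ r, HasDerivAt (fun r => G (r ^ 2)) (θ (r ^ 2) * (2 * r)) r := by
    intro r
    have := (hG (r ^ 2)).comp r (hasDerivAt_pow 2 r)
    simp only [Nat.cast_ofNat, Nat.add_one_sub_one, pow_one] at this
    exact this
  have hcut : ∀ f : ℝ → ℝ, (∀ r, b ≤ r → f r = 0) →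
      ∫ r in Set.Ioi (0 : ℝ), f r = ∫ r in (0 : ℝ)..b, f r := by
    intro f hf
    rw [intervalIntegral.integral_of_le hb0.le]
    refine setIntegral_eq_of_subset_of_forall_sdiff_eq_zero measurableSet_Ioi
      Set.Ioc_subset_Ioi_self fun r hr => hf r ?_
    by_contra hlt
    exact hr.2 ⟨hr.1, (not_le.1 hlt).le⟩
  have hGc : Continuous G := hGd.continuous
  rw [hcut _ fun r hr => by simp [hG0 _ (hbB _ hr)], hcut _ fun r hr => by simp [hB _ (hbB _ hr)],
    intervalIntegral.integral_mul_deriv_eq_deriv_mul (fun r _ => hu r) (fun r _ => hP r)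
      (Continuous.intervalIntegrable (by fun_prop) _ _)
      (Continuous.intervalIntegrable (by fun_prop) _ _)] at hparts
  rw [hcut _ fun r hr => by simp [hB _ (hbB _ hr)]]
  simp only [mul_sub]
  rw [intervalIntegral.integral_sub (Continuous.intervalIntegrable (by fun_prop) _ _)
    (Continuous.intervalIntegrable (by fun_prop) _ _)]
  rw [hG0 _ (hbB b le_rfl)] at hparts
  simp only [intervalIntegral.integral_same, mul_zero, zero_mul] at hparts
  linarith

/-- The averaged identity holds for every test function θ of s = r², so the fundamental lemma of the
calculus of variations gives equality for almost every radius, and continuity in r for every radius.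
-/
theorem flux_eq_integral_divE {V : E3 → Fin 3 → ℝ} (hV : ContDiff ℝ 1 V) {r : ℝ} (hr : 0 < r) :
    flux V r = ∫ s in 0..r, sphereInt (divE V) s := by
  have hDc := continuous_sphereInt (continuous_divE hV)
  have hfc := continuous_flux hV.continuous
  have hPc : Continuous fun r => ∫ s in (0 : ℝ)..r, sphereInt (divE V) s :=
    intervalIntegral.continuous_primitive (fun a b => hDc.intervalIntegrable a b) 0
  set h : ℝ → ℝ := fun r => flux V r - ∫ s in (0 : ℝ)..r, sphereInt (divE V) s
  have hc : Continuous fun s => h (√s) := (hfc.sub hPc).comp Real.continuous_sqrt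
  have hae : ∀ᵐ s : ℝ, s ∈ Set.Ioi (0 : ℝ) → h (√s) = 0 := by
    refine isOpen_Ioi.ae_eq_zero_of_integral_contDiff_smul_eq_zero
      (hc.locallyIntegrable.locallyIntegrableOn _) fun θ hθ hθc hθs => ?_
    obtain ⟨B, hB⟩ := hθc.isCompact.isBounded.subset_closedBall (0 : ℝ)
    have hB' : ∀ s, |B| + 1 ≤ s → θ s = 0 := by
      intro s hs
      by_contra hne
      have := hB (subset_tsupport _ hne)
      rw [Metric.mem_closedBall, dist_zero_right, Real.norm_eq_abs] at this
      linarith [le_abs_self s, le_abs_self B]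
    have h1 := radial_weak_divergence hV hθ.continuous hB' (by positivity)
    -- The substitution s = r² absorbs the factor 2r.
    have h2 := integral_comp_rpow_Ioi_of_pos (g := fun s => θ s * h (√s)) (p := 2) (by norm_num)
    have h3 : ∫ s in Set.Ioi (0 : ℝ), θ s * h (√s) = 0 := by
      rw [← h2]
      refine Eq.trans ?_ h1
      refine setIntegral_congr_fun measurableSet_Ioi fun s hs => ?_
      have hs' : (0 : ℝ) ≤ s := le_of_lt hs
      have e1 : s ^ ((2 : ℝ) - 1) = s := by norm_num
      simp only [Real.rpow_two, e1, Real.sqrt_sq hs', smul_eq_mul, h]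
      ring
    rw [← h3]
    simp only [smul_eq_mul]
    refine (setIntegral_eq_integral_of_forall_compl_eq_zero fun s hs => ?_).symm
    have : θ s = 0 := by
      by_contra hne
      exact hs (hθs (subset_tsupport _ hne))
    simp [this]
  have heq := Measure.eqOn_open_of_ae_eq (μ := (volume : Measure ℝ)) (U := Set.Ioi (0 : ℝ))
    (f := fun s => h (√s)) (g := fun _ => 0) ((ae_restrict_iff' measurableSet_Ioi).2 hae)
    isOpen_Ioi hc.continuousOn continuousOn_const
  have := heq (show r ^ 2 ∈ Set.Ioi (0 : ℝ) from by simpa using pow_pos hr 2)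
  simp only [Real.sqrt_sq hr.le, h] at this
  linarith

/-- The divergence theorem on the whole space: fluxes converge to the integrated divergence. -/
theorem tendsto_flux {V : E3 → Fin 3 → ℝ} (hV : ContDiff ℝ 1 V) (hd : Integrable (divE V)) :
    Tendsto (flux V) atTop (𝓝 (∫ x, divE V x)) := by
  obtain ⟨h1, h2⟩ := polar_integral hd
  rw [h2]
  refine (intervalIntegral_tendsto_integral_Ioi 0 h1 tendsto_id).congr' ?_
  filter_upwards [eventually_gt_atTop 0] with r hr
  exact (flux_eq_integral_divE hV hr).symm

/-! ### Decay, cutoffs and energy estimates -/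

/-- The weight `(1 + r)⁻¹`. -/
def wt (x : E3) : ℝ := (1 + ‖x‖)⁻¹

theorem wt_pos (x : E3) : 0 < wt x := inv_pos.2 (by positivity)

theorem wt_nonneg (x : E3) : 0 ≤ wt x := (wt_pos x).le

theorem wt_le_one (x : E3) : wt x ≤ 1 := inv_le_one_of_one_le₀ (by simp)

theorem norm_mul_wt_le (x : E3) : ‖x‖ * wt x ≤ 1 := by
  rw [wt, ← div_eq_mul_inv, div_le_one (by positivity)]
  linarith

theorem continuous_wt : Continuous wt :=
  (continuous_const.add continuous_norm).inv₀ fun x => (add_pos_of_pos_of_nonneg one_pos (norm_nonneg x)).ne'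

/-- The exponent 4 exceeds the dimension 3. -/
theorem integrable_wt_pow_four : Integrable fun x => wt x ^ 4 := by
  have h := integrable_one_add_norm (E := E3) (μ := volume) (r := 4) (by simp; norm_num)
  refine h.congr (Eventually.of_forall fun x => ?_)
  simp only [wt]
  rw [Real.rpow_neg (by positivity), inv_pow]
  norm_cast

theorem wt_pow_le {m n : ℕ} (h : m ≤ n) (x : E3) : wt x ^ n ≤ wt x ^ m :=
  pow_le_pow_of_le_one (wt_nonneg x) (wt_le_one x) h

theorem integrable_of_wt {f : E3 → ℝ} (hf : Continuous f) {C : ℝ} {n : ℕ} (hn : 4 ≤ n)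
    (h : ∀ x, |f x| ≤ C * wt x ^ n) : Integrable f := by
  have hC : 0 ≤ C := by
    by_contra hC
    have := (abs_nonneg _).trans (h 0)
    have := pow_pos (wt_pos 0) n
    nlinarith
  refine (integrable_wt_pow_four.const_mul C).mono' hf.aestronglyMeasurable
    (Eventually.of_forall fun x => (h x).trans ?_)
  exact mul_le_mul_of_nonneg_left (wt_pow_le hn x) hC

/-- Turns falloff at infinity into a bound on all of space, which later estimates use without
splitting into a near and a far region. -/
theorem exists_le_wt_pow {f : E3 → ℝ} (hf : Continuous f) {n : ℕ}
    (h : f =O[Bornology.cobounded E3] fun x => ‖x‖⁻¹ ^ n) :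
    ∃ C, 0 ≤ C ∧ ∀ x, |f x| ≤ C * wt x ^ n := by
  obtain ⟨C, hC⟩ := h.bound
  rw [← comap_norm_atTop, eventually_comap] at hC
  obtain ⟨R, hR⟩ := eventually_atTop.1 hC
  obtain ⟨K, hK⟩ := (isCompact_closedBall (0 : E3) (max R 1)).exists_bound_of_continuousOn
    hf.continuousOn
  -- The first summand covers ‖x‖ ≥ max R 1, where ‖x‖⁻¹ ≤ 2 (1 + ‖x‖)⁻¹; the second covers the
  -- remaining ball by compactness.
  refine ⟨|C| * 2 ^ n + |K| * (1 + max R 1) ^ n, by positivity, fun x => ?_⟩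
  rcases le_total ‖x‖ (max R 1) with hx | hx
  · have h1 : |f x| ≤ |K| := (hK x (by simpa using hx)).trans (le_abs_self K)
    have h2 : 1 ≤ (1 + max R 1) ^ n * wt x ^ n := by
      rw [← mul_pow]
      refine one_le_pow₀ ?_
      rw [wt, ← div_eq_mul_inv, one_le_div (by positivity)]
      linarith
    have h3 : |K| ≤ |K| * ((1 + max R 1) ^ n * wt x ^ n) := le_mul_of_one_le_right (abs_nonneg K) h2
    have h4 : 0 ≤ |C| * 2 ^ n * wt x ^ n :=
      mul_nonneg (by positivity) (pow_nonneg (wt_nonneg x) n)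
    linarith
  · have h1 := hR ‖x‖ ((le_max_left R 1).trans hx) x rfl
    have hx1 : 1 ≤ ‖x‖ := (le_max_right R 1).trans hx
    rw [Real.norm_eq_abs, norm_pow, norm_inv, norm_norm] at h1
    have h2 : ‖x‖⁻¹ ≤ 2 * wt x := by
      rw [wt, inv_le_iff_one_le_mul₀ (by positivity), mul_right_comm, ← div_eq_mul_inv,
        one_le_div (by positivity)]
      linarith
    calc |f x| ≤ C * ‖x‖⁻¹ ^ n := h1
      _ ≤ |C| * (2 * wt x) ^ n := by gcongr; exact le_abs_self C
      _ = |C| * 2 ^ n * wt x ^ n := by ring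
      _ ≤ _ := by
        have h4 : 0 ≤ |K| * (1 + max R 1) ^ n * wt x ^ n :=
          mul_nonneg (by positivity) (pow_nonneg (wt_nonneg x) n)
        linarith

theorem integrable_of_eq_zero_outside {f : E3 → ℝ} (hf : Continuous f) {R : ℝ}
    (h : ∀ x, R < ‖x‖ → f x = 0) : Integrable f := by
  refine hf.integrable_of_hasCompactSupport
    (HasCompactSupport.of_support_subset_isCompact (isCompact_closedBall (0 : E3) R) fun x hx => ?_)
  by_contra hn
  simp only [Metric.mem_closedBall, dist_zero_right, not_le] at hn
  exact hx (h x hn)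

theorem integrable_mul_of_sq {f g : E3 → ℝ} (hf : Continuous f) (hg : Continuous g)
    (hf2 : Integrable fun x => f x ^ 2) (hg2 : Integrable fun x => g x ^ 2) :
    Integrable fun x => f x * g x := by
  refine (hf2.add hg2).mono' (hf.mul hg).aestronglyMeasurable (Eventually.of_forall fun x => ?_)
  rw [Real.norm_eq_abs, abs_mul, Pi.add_apply, ← sq_abs (f x), ← sq_abs (g x)]
  nlinarith [sq_nonneg (|f x| - |g x|), sq_nonneg (|f x| + |g x|)]

theorem sd_comp_smul {f : E3 → ℝ} (hf : Differentiable ℝ f) (a : ℝ) (i : Fin 3) (x : E3) :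
    sd i (fun y => f (a • y)) x = a * sd i f (a • x) := by
  have h1 : HasFDerivAt (fun y : E3 => a • y) (a • ContinuousLinearMap.id ℝ E3) x :=
    (hasFDerivAt_id x).const_smul a
  have h2 := (hf (a • x)).hasFDerivAt.comp x h1
  have h3 : fderiv ℝ (fun y : E3 => f (a • y)) x
    = (fderiv ℝ f (a • x)).comp (a • ContinuousLinearMap.id ℝ E3) := h2.fderiv
  simp [sd, h3]

/-- Rescalings of a single bump function. The two gradient bounds play different roles: the one by
the weight gives a dominating function independent of n, the one by 1/(n+1) gives pointwise
convergence to zero. -/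
theorem exists_cutoffs : ∃ (η : ℕ → E3 → ℝ) (C : ℝ), 0 ≤ C ∧ (∀ n, ContDiff ℝ ∞ (η n)) ∧
    (∀ n, HasCompactSupport (η n)) ∧ (∀ n x, 0 ≤ η n x ∧ η n x ≤ 1) ∧
    (∀ (n : ℕ) x, ‖x‖ ≤ (n : ℝ) + 1 → η n x = 1) ∧
    (∀ n i x, |sd i (η n) x| ≤ C * wt x) ∧
    ∀ (n : ℕ) i x, |sd i (η n) x| ≤ C * ((n : ℝ) + 1)⁻¹ := by
  obtain ⟨φ, hin, hout⟩ : ∃ φ : ContDiffBump (0 : E3), φ.rIn = 1 ∧ φ.rOut = 2 :=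
    ⟨⟨1, 2, one_pos, one_lt_two⟩, rfl, rfl⟩
  have hφ : ContDiff ℝ ∞ φ := φ.contDiff
  have hφc : HasCompactSupport φ := φ.hasCompactSupport
  have hb : ∃ M, 0 ≤ M ∧ ∀ i x, |sd i φ x| ≤ M := by
    have : ∀ i, ∃ M, ∀ x, |sd i φ x| ≤ M := fun i => by
      obtain ⟨M, hM⟩ := (hφc.fderiv_apply ℝ (EuclideanSpace.single i (1 : ℝ))).exists_bound_of_continuous
        (continuous_sd (hφ.of_le (by simp)) i)
      exact ⟨M, hM⟩
    choose M hM using this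
    refine ⟨∑ i, |M i|, by positivity, fun i x => (hM i x).trans ?_⟩
    exact (le_abs_self _).trans
      (Finset.single_le_sum (f := fun i => |M i|) (fun i _ => abs_nonneg (M i)) (Finset.mem_univ i))
  obtain ⟨M, hM0, hM⟩ := hb
  have hsd : ∀ (n : ℕ) i x, sd i (fun y => φ (((n : ℝ) + 1)⁻¹ • y)) x
      = ((n : ℝ) + 1)⁻¹ * sd i φ (((n : ℝ) + 1)⁻¹ • x) := fun n i x =>
    sd_comp_smul (hφ.differentiable (by simp)) _ i x
  have hle : ∀ (n : ℕ) i x, |sd i (fun y => φ (((n : ℝ) + 1)⁻¹ • y)) x| ≤ M * ((n : ℝ) + 1)⁻¹ := by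
    intro n i x
    rw [hsd, abs_mul, abs_of_pos (by positivity), mul_comm]
    exact mul_le_mul_of_nonneg_right (hM _ _) (by positivity)
  have hnorm : ∀ (n : ℕ) (x : E3), ‖((n : ℝ) + 1)⁻¹ • x‖ = ((n : ℝ) + 1)⁻¹ * ‖x‖ := fun n x => by
    rw [norm_smul, Real.norm_of_nonneg (by positivity)]
  refine ⟨fun n x => φ (((n : ℝ) + 1)⁻¹ • x), 3 * M, by positivity,
    fun n => hφ.comp (contDiff_const_smul _), fun n => ?_, fun n x => ⟨φ.nonneg, φ.le_one⟩,
    fun n x hx => ?_, fun n i x => ?_, fun n i x => (hle n i x).trans ?_⟩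
  · have hne : ((n : ℝ) + 1)⁻¹ ≠ 0 := by positivity
    exact hφc.comp_homeomorph (Homeomorph.smulOfNeZero ((n : ℝ) + 1)⁻¹ hne)
  · refine φ.one_of_mem_closedBall ?_
    rw [mem_closedBall_zero_iff, hnorm, inv_mul_le_iff₀ (by positivity)]
    simpa [hin] using hx
  · rcases le_or_gt ‖x‖ (2 * ((n : ℝ) + 1)) with hx | hx
    · refine (hle n i x).trans ?_
      -- On the support of the gradient ‖x‖ ≤ 2(n+1), hence 1 + ‖x‖ ≤ 3(n+1); this is the factor 3.
      rw [mul_comm 3 M, mul_assoc]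
      refine mul_le_mul_of_nonneg_left ?_ hM0
      rw [wt, inv_le_iff_one_le_mul₀ (by positivity), mul_right_comm, ← div_eq_mul_inv,
        one_le_div (by positivity)]
      have : (0 : ℝ) ≤ n := n.cast_nonneg
      linarith
    · have h0 : sd i φ (((n : ℝ) + 1)⁻¹ • x) = 0 := by
        have : fderiv ℝ φ (((n : ℝ) + 1)⁻¹ • x) = 0 := by
          by_contra hne
          have h1 : ((n : ℝ) + 1)⁻¹ • x ∈ tsupport φ := support_fderiv_subset ℝ hne
          rw [φ.tsupport_eq, mem_closedBall_zero_iff, hnorm, inv_mul_le_iff₀ (by positivity)] at h1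
          rw [hout] at h1
          linarith
        simp [sd, this]
      rw [hsd, h0, mul_zero, abs_zero]
      exact mul_nonneg (by positivity) (wt_nonneg x)
  · have : 0 ≤ M * ((n : ℝ) + 1)⁻¹ := by positivity
    linarith

/-- Integrating against the cutoffs leaves -∫ ∇η_n · V, whose integrand is dominated by a multiple
of the sum of the |V_i|/(1+r) and tends to zero pointwise. No boundary term or pointwise decay of V
is needed. -/
theorem integral_divE_eq_zero {V : E3 → Fin 3 → ℝ} (hV : ContDiff ℝ 1 V)
    (hd : Integrable (divE V)) (hw : ∀ i, Integrable fun x => V x i * wt x) :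
    ∫ x, divE V x = 0 := by
  obtain ⟨η, C, hC, hη, hs, h01, h1, hwt, hn⟩ := exists_cutoffs
  have hη1 : ∀ n, ContDiff ℝ 1 (η n) := fun n => (hη n).of_le (by simp)
  have hVi := contDiff_pi.1 hV
  have hdc := continuous_divE hV
  have hlim1 : Tendsto (fun n => ∫ x, η n x * divE V x) atTop (𝓝 (∫ x, divE V x)) := by
    refine tendsto_integral_of_dominated_convergence (fun x => |divE V x|)
      (fun n => ((hη n).continuous.mul hdc).aestronglyMeasurable) hd.abs
      (fun n => Eventually.of_forall fun x => ?_) (Eventually.of_forall fun x => ?_)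
    · rw [Real.norm_eq_abs, abs_mul, abs_of_nonneg (h01 n x).1]
      exact mul_le_of_le_one_left (abs_nonneg _) (h01 n x).2
    · refine tendsto_const_nhds.congr' ?_
      filter_upwards [eventually_ge_atTop ⌈‖x‖⌉₊] with n hn
      rw [h1 n x ((Nat.ceil_le.1 hn).trans (by simp)), one_mul]
  have hlim2 : Tendsto (fun n => ∫ x, ∑ i, sd i (η n) x * V x i) atTop (𝓝 (∫ _ : E3, (0 : ℝ))) := by
    refine tendsto_integral_of_dominated_convergence (fun x => ∑ i, C * |V x i * wt x|)
      (fun n => ?_) ?_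
      (fun n => Eventually.of_forall fun x => ?_) (Eventually.of_forall fun x => ?_)
    · exact (continuous_finsetSum _ fun i _ =>
        (continuous_sd (hη1 n) i).mul (hVi i).continuous).aestronglyMeasurable
    · exact integrable_finsetSum _ fun i _ => (hw i).abs.const_mul C
    · refine (Finset.abs_sum_le_sum_abs _ _).trans (Finset.sum_le_sum fun i _ => ?_)
      rw [abs_mul, abs_mul, abs_of_pos (wt_pos x)]
      calc _ ≤ C * wt x * |V x i| := mul_le_mul_of_nonneg_right (hwt n i x) (abs_nonneg _)
        _ = _ := by ring
    · have h0 : Tendsto (fun n : ℕ => ((n : ℝ) + 1)⁻¹) atTop (𝓝 0) := by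
        simpa using tendsto_one_div_add_atTop_nhds_zero_nat (𝕜 := ℝ)
      rw [show (0 : ℝ) = ∑ i : Fin 3, 0 * V x i by simp]
      refine tendsto_finsetSum _ fun i _ => Tendsto.mul_const _ ?_
      refine squeeze_zero_norm (fun n => hn n i x) ?_
      simpa using h0.const_mul C
  have heq : ∀ n, ∫ x, η n x * divE V x = -∫ x, ∑ i, sd i (η n) x * V x i := fun n =>
    integral_mul_divE (hη1 n) (hs n) hV
  simp only [heq] at hlim1
  have := tendsto_nhds_unique hlim1 hlim2.neg
  simpa using this

/-- Young's inequality, with weights chosen so that only half of η²G has to be absorbed. -/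
theorem absorb {η a G K : ℝ} (hK : 0 ≤ K) (hG : 0 ≤ G) (h : a ^ 2 ≤ K * G) :
    -(2 * η * a) ≤ 1 / 2 * (η ^ 2 * G) + 2 * K := by
  refine (neg_le_abs _).trans (abs_le_of_sq_le_sq ?_ (by positivity))
  have h1 : (2 * η * a) ^ 2 ≤ 4 * η ^ 2 * (K * G) := by
    nlinarith [mul_le_mul_of_nonneg_left h (sq_nonneg η)]
  nlinarith [sq_nonneg (1 / 2 * (η ^ 2 * G) - 2 * K)]

/-- A Caccioppoli estimate. Multiplying G ≤ h + div Y by η² and integrating by parts leaves -2η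
∇η·Y, which |Y|² ≤ qG and |∇η| ≲ 1/(1+r) bound by half of η²G plus a multiple of q/(1+r)². The bound
does not depend on the cutoff. -/
theorem integrable_energy {Y : E3 → Fin 3 → ℝ} {G h q : E3 → ℝ} (hY : ContDiff ℝ 1 Y)
    (hG : Continuous G) (hG0 : ∀ x, 0 ≤ G x) (hle : ∀ x, G x ≤ h x + divE Y x)
    (hYq : ∀ x, ∑ i, Y x i ^ 2 ≤ q x * G x) (hh : Integrable h) (hq0 : ∀ x, 0 ≤ q x)
    (hq : Integrable fun x => q x * wt x ^ 2) : Integrable G := by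
  obtain ⟨η, C, hC, hη, hs, h01, h1, hwt, -⟩ := exists_cutoffs
  have hη1 : ∀ n, ContDiff ℝ 1 (η n) := fun n => (hη n).of_le (by simp)
  have hYi := contDiff_pi.1 hY
  have hdc := continuous_divE hY
  have hsq : ∀ n, HasCompactSupport fun x => η n x ^ 2 := fun n => by
    simp only [pow_two]
    exact (hs n).mul_right
  have hηG : ∀ n, Integrable fun x => η n x ^ 2 * G x := fun n =>
    (((hη n).continuous.pow 2).mul hG).integrable_of_hasCompactSupport (hsq n).mul_right
  have hηd : ∀ n, Integrable fun x => η n x ^ 2 * divE Y x := fun n =>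
    (((hη n).continuous.pow 2).mul hdc).integrable_of_hasCompactSupport (hsq n).mul_right
  have hsd : ∀ n i x, sd i (fun y => η n y ^ 2) x = 2 * η n x * sd i (η n) x := fun n i x => by
    have := ((hη1 n).differentiable one_ne_zero x).hasFDerivAt.pow 2
    rw [sd, this.fderiv]
    simp [sd]
  have hbound : ∀ n, ∫ x, η n x ^ 2 * G x
      ≤ 2 * ((∫ x, |h x|) + ∫ x, 6 * C ^ 2 * (q x * wt x ^ 2)) := by
    intro n
    have hparts := integral_mul_divE ((hη1 n).pow 2) (hsq n) hY
    have hib : Integrable fun x => ∑ i, sd i (fun y => η n y ^ 2) x * Y x i :=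
      integrable_finsetSum _ fun i _ => by
        refine ((continuous_sd ((hη1 n).pow 2) i).mul
          (hYi i).continuous).integrable_of_hasCompactSupport ?_
        exact HasCompactSupport.mul_right (f := sd i fun y => η n y ^ 2)
          ((hsq n).fderiv_apply ℝ _)
    have hp1 : ∫ x, η n x ^ 2 * G x ≤ ∫ x, (|h x| + η n x ^ 2 * divE Y x) := by
      refine integral_mono (hηG n) (hh.abs.add (hηd n)) fun x => ?_
      have hη2 : η n x ^ 2 ≤ 1 := pow_le_one₀ (h01 n x).1 (h01 n x).2
      have e1 := mul_le_mul_of_nonneg_left (hle x) (sq_nonneg (η n x))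
      have e2 : η n x ^ 2 * h x ≤ |h x| :=
        (mul_le_mul_of_nonneg_left (le_abs_self _) (sq_nonneg _)).trans
          (mul_le_of_le_one_left (abs_nonneg _) hη2)
      linarith
    have hp2 : ∫ x, -∑ i, sd i (fun y => η n y ^ 2) x * Y x i
        ≤ ∫ x, (1 / 2 * (η n x ^ 2 * G x) + 6 * C ^ 2 * (q x * wt x ^ 2)) := by
      refine integral_mono hib.neg (((hηG n).const_mul _).add (hq.const_mul _)) fun x => ?_
      have e1 : ∑ i, sd i (fun y => η n y ^ 2) x * Y x i
          = 2 * η n x * ∑ i, sd i (η n) x * Y x i := by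
        simp only [hsd, Finset.mul_sum, mul_assoc]
      -- Cauchy–Schwarz over three components gives K = 3C²q wt² in `absorb`, hence the constant 6C²
      -- = 2·3C².
      have e2 : (∑ i, sd i (η n) x * Y x i) ^ 2 ≤ (3 * C ^ 2 * (q x * wt x ^ 2)) * G x := by
        have c1 := Finset.sum_mul_sq_le_sq_mul_sq Finset.univ (fun i => sd i (η n) x) (Y x)
        have c2 : ∑ i, sd i (η n) x ^ 2 ≤ 3 * C ^ 2 * wt x ^ 2 := by
          have c3 : ∀ i, sd i (η n) x ^ 2 ≤ C ^ 2 * wt x ^ 2 := fun i => by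
            rw [← mul_pow, ← sq_abs]
            exact pow_le_pow_left₀ (abs_nonneg _) (hwt n i x) 2
          calc _ ≤ ∑ _i : Fin 3, C ^ 2 * wt x ^ 2 := Finset.sum_le_sum fun i _ => c3 i
            _ = _ := by simp; ring
        calc _ ≤ _ := c1
          _ ≤ 3 * C ^ 2 * wt x ^ 2 * (q x * G x) :=
            mul_le_mul c2 (hYq x) (Finset.sum_nonneg fun i _ => sq_nonneg _) (by positivity)
          _ = _ := by ring
      have e3 := absorb (η := η n x)
        (mul_nonneg (by positivity) (mul_nonneg (hq0 x) (sq_nonneg (wt x)))) (hG0 x) e2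
      simp only [e1]
      linarith
    rw [integral_add hh.abs (hηd n), hparts, ← integral_neg] at hp1
    rw [integral_add ((hηG n).const_mul _) (hq.const_mul _), integral_const_mul] at hp2
    linarith
  -- Since G ≥ 0 and each cutoff is 1 on its ball, the integrals of G over an exhaustion by balls
  -- are uniformly bounded.
  refine (aecover_closedBall (μ := (volume : Measure E3)) (x := (0 : E3))
    (tendsto_natCast_atTop_atTop (R := ℝ))).integrable_of_integral_norm_bounded
    (2 * ((∫ x, |h x|) + ∫ x, 6 * C ^ 2 * (q x * wt x ^ 2)))
    (fun n => hG.continuousOn.integrableOn_compact (isCompact_closedBall _ _))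
    (Eventually.of_forall fun n => le_trans ?_ (hbound n))
  calc ∫ x in Metric.closedBall (0 : E3) n, ‖G x‖
      = ∫ x in Metric.closedBall (0 : E3) n, η n x ^ 2 * G x := by
        refine setIntegral_congr_fun measurableSet_closedBall fun x hx => ?_
        rw [mem_closedBall_zero_iff] at hx
        simp only [Real.norm_of_nonneg (hG0 x), h1 n x (by linarith), one_pow, one_mul]
    _ ≤ _ := setIntegral_le_integral (hηG n)
        (Eventually.of_forall fun x => mul_nonneg (sq_nonneg _) (hG0 x))

/-! ### Matter variables in components -/

namespace Fields

variable (c : Fields)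

/-- The spatial components `u_i = ψ⁴ (β^i u^t + u^i)` of the four-velocity. -/
def velLow (p : Spacetime) (i : Fin 3) : ℝ :=
  c.psi p ^ 4 * (c.shift p i * c.vel p 0 + c.vel p i.succ)

theorem metric_zero_zero (p : Spacetime) :
    c.metric p 0 0 = -c.lapse p ^ 2 + c.psi p ^ 4 * ∑ i, c.shift p i ^ 2 := by
  simp [metric, spatialMetric, coframe, Fin.sum_univ_three]
  ring

theorem metric_zero_succ (p : Spacetime) (i : Fin 3) :
    c.metric p 0 i.succ = c.psi p ^ 4 * c.shift p i := by
  simp [metric, spatialMetric, coframe]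

theorem metric_succ_zero (p : Spacetime) (i : Fin 3) :
    c.metric p i.succ 0 = c.psi p ^ 4 * c.shift p i := by
  simp [metric, spatialMetric, coframe]

theorem metric_succ_succ (p : Spacetime) (i j : Fin 3) :
    c.metric p i.succ j.succ = c.psi p ^ 4 * (if i = j then 1 else 0) := by
  simp [metric, spatialMetric, coframe, eq_comm]

theorem lower_zero (p : Spacetime) (w : Fin 4 → ℝ) :
    c.lower p w 0 = (-c.lapse p ^ 2 + c.psi p ^ 4 * ∑ i, c.shift p i ^ 2) * w 0
      + c.psi p ^ 4 * ∑ i, c.shift p i * w i.succ := by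
  rw [lower, Fin.sum_univ_succ, metric_zero_zero]
  simp only [metric_zero_succ, Finset.mul_sum, mul_assoc]

theorem lower_succ (p : Spacetime) (w : Fin 4 → ℝ) (i : Fin 3) :
    c.lower p w i.succ = c.psi p ^ 4 * (c.shift p i * w 0 + w i.succ) := by
  rw [lower, Fin.sum_univ_succ, metric_succ_zero]
  simp only [metric_succ_succ]
  simp
  ring

variable {c}

theorem lower_normal_succ {p : Spacetime} (i : Fin 3) :
    c.lower p (c.normal p) i.succ = 0 := by
  rw [lower_succ]
  simp only [normal, Fin.cons_zero, Fin.cons_succ]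
  ring

theorem proj_succ {p : Spacetime} (μ : Fin 4) (i : Fin 3) :
    c.proj p μ i.succ = if μ = i.succ then 1 else 0 := by
  rw [proj, lower_normal_succ, mul_zero, add_zero]

/-- The lowered normal is -α dt, so contraction with the normal sees only the time component. -/
theorem sum_lower_mul_normal {p : Spacetime} (h : 0 < c.lapse p) (w : Fin 4 → ℝ) :
    ∑ ν, c.lower p w ν * c.normal p ν = -(c.lapse p * w 0) := by
  rw [Fin.sum_univ_succ, lower_zero]
  simp only [lower_succ]
  simp only [normal, Fin.cons_zero, Fin.cons_succ, Fin.sum_univ_three]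
  field_simp
  ring

theorem sum_stress_mul_normal {p : Spacetime} (h : 0 < c.lapse p) (μ : Fin 4) :
    ∑ ν, c.stress p μ ν * c.normal p ν
      = -((c.energy p + c.pressure p) * (c.lapse p * c.vel p 0)) * c.lower p (c.vel p) μ
        + c.pressure p * c.lower p (c.normal p) μ := by
  have h1 := sum_lower_mul_normal h (c.vel p)
  have h2 : c.lower p (c.normal p) μ = ∑ ν, c.metric p μ ν * c.normal p ν := rfl
  simp only [stress, add_mul, Finset.sum_add_distrib, mul_assoc]
  rw [← Finset.mul_sum, ← Finset.mul_sum, ← Finset.mul_sum, ← Finset.mul_sum, ← Finset.mul_sum,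
    h1, h2]
  ring

theorem rhoH_eq {p : Spacetime} (h : 0 < c.lapse p) :
    c.rhoH p = (c.energy p + c.pressure p) * (c.lapse p * c.vel p 0) ^ 2 - c.pressure p := by
  have h1 : c.rhoH p = ∑ μ, (∑ ν, c.stress p μ ν * c.normal p ν) * c.normal p μ := by
    simp only [rhoH, Finset.sum_mul]
    refine Finset.sum_congr rfl fun μ _ => Finset.sum_congr rfl fun ν _ => by ring
  have h2 : c.lapse p * c.normal p 0 = 1 := by
    simp only [normal, Fin.cons_zero]
    field_simp
  rw [h1]
  simp only [sum_stress_mul_normal h, add_mul, Finset.sum_add_distrib, mul_assoc]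
  simp only [← Finset.mul_sum, sum_lower_mul_normal h, h2]
  ring

theorem mom_eq {p : Spacetime} (h : 0 < c.lapse p) (i : Fin 3) :
    c.mom p i = (c.energy p + c.pressure p) * (c.lapse p * c.vel p 0) * c.velLow p i := by
  have h1 : c.mom p i = -∑ ν, c.stress p i.succ ν * c.normal p ν := by
    simp only [mom, proj_succ]
    congr 1
    rw [Finset.sum_eq_single i.succ]
    · simp
    · intro μ _ hμ
      simp [hμ]
    · simp
  rw [h1, sum_stress_mul_normal h, lower_normal_succ, lower_succ, velLow]
  ring

theorem spatialStress_eq (p : Spacetime) (i j : Fin 3) :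
    c.spatialStress p i j = (c.energy p + c.pressure p) * c.velLow p i * c.velLow p j
      + c.pressure p * (c.psi p ^ 4 * if i = j then 1 else 0) := by
  have h1 : c.spatialStress p i j = c.stress p i.succ j.succ := by
    simp [spatialStress, proj_succ]
  rw [h1, stress, lower_succ, lower_succ, metric_succ_succ]
  rfl

theorem stressTrace_eq {p : Spacetime} (hψ : 0 < c.psi p) :
    c.stressTrace p = (c.energy p + c.pressure p) * (∑ i, c.velLow p i ^ 2) / c.psi p ^ 4
      + 3 * c.pressure p := by
  simp only [stressTrace, spatialStress_eq, Fin.sum_univ_three, if_true]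
  field_simp
  ring

/-- `α S_k^k = j_k v^k + j_k β^k + 3 α P`. -/
theorem lapse_mul_stressTrace {p : Spacetime} (h : 0 < c.lapse p) (hψ : 0 < c.psi p)
    (hu : 0 < c.vel p 0) :
    c.lapse p * c.stressTrace p = (∑ k, c.mom p k * c.coordVel p k)
      + (∑ k, c.mom p k * c.shift p k) + 3 * c.lapse p * c.pressure p := by
  rw [stressTrace_eq hψ]
  simp only [mom_eq h, coordVel, Fin.sum_univ_three, velLow]
  field_simp
  ring

end Fields

/-! ### Calculus of partial derivatives -/

section Calculus

variable {f g : E3 → ℝ} {x : E3} (i : Fin 3)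

theorem sd_add (hf : DifferentiableAt ℝ f x) (hg : DifferentiableAt ℝ g x) :
    sd i (fun y => f y + g y) x = sd i f x + sd i g x := by
  rw [sd, fderiv_fun_add hf hg]
  rfl

theorem sd_sub (hf : DifferentiableAt ℝ f x) (hg : DifferentiableAt ℝ g x) :
    sd i (fun y => f y - g y) x = sd i f x - sd i g x := by
  rw [sd, fderiv_fun_sub hf hg]
  rfl

theorem sd_mul (hf : DifferentiableAt ℝ f x) (hg : DifferentiableAt ℝ g x) :
    sd i (fun y => f y * g y) x = f x * sd i g x + sd i f x * g x := by
  rw [sd, fderiv_fun_mul hf hg]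
  simp [sd, mul_comm]

theorem sd_const_mul (a : ℝ) (hf : DifferentiableAt ℝ f x) :
    sd i (fun y => a * f y) x = a * sd i f x := by
  rw [sd, fderiv_const_mul hf]
  rfl

theorem sd_pow (n : ℕ) (hf : DifferentiableAt ℝ f x) :
    sd i (fun y => f y ^ n) x = n * f x ^ (n - 1) * sd i f x := by
  rw [sd, fderiv_fun_pow n hf]
  simp [sd]

theorem sd_inv (hf : DifferentiableAt ℝ f x) (h0 : f x ≠ 0) :
    sd i (fun y => (f y)⁻¹) x = -sd i f x / f x ^ 2 := by
  have := (hasDerivAt_inv h0).comp_hasFDerivAt x hf.hasFDerivAt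
  have h3 : fderiv ℝ (fun y : E3 => (f y)⁻¹) x = _ := this.fderiv
  rw [sd, h3]
  simp [sd]
  ring

theorem sd_sub_const (a : ℝ) : sd i (fun y => f y - a) x = sd i f x := by
  rw [sd, fderiv_sub_const]
  rfl

theorem sd_sum {F : Fin 3 → E3 → ℝ} (hF : ∀ k, DifferentiableAt ℝ (F k) x) :
    sd i (fun y => ∑ k, F k y) x = ∑ k, sd i (F k) x := by
  rw [sd, fderiv_fun_sum fun k _ => hF k]
  simp [sd]

theorem sd_coord (k : Fin 3) : sd i (fun y : E3 => y k) x = if k = i then 1 else 0 := by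
  have : fderiv ℝ (fun y : E3 => y k) x = (EuclideanSpace.proj k : E3 →L[ℝ] ℝ) :=
    (EuclideanSpace.proj k : E3 →L[ℝ] ℝ).hasFDerivAt.fderiv
  rw [sd, this]
  simp

theorem sd_comm (hf : ContDiff ℝ 2 f) (i j : Fin 3) (x : E3) :
    sd i (sd j f) x = sd j (sd i f) x := by
  have hd : DifferentiableAt ℝ (fderiv ℝ f) x :=
    (hf.fderiv_right (m := 1) le_rfl).differentiable one_ne_zero x
  have h : ∀ i j, sd i (sd j f) x
      = fderiv ℝ (fderiv ℝ f) x (EuclideanSpace.single i 1) (EuclideanSpace.single j 1) := by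
    intro i j
    have : fderiv ℝ (sd j f) x = _ := fderiv_clm_apply hd (differentiableAt_const _)
    rw [sd, this]
    simp
  rw [h, h]
  exact (hf.contDiffAt (x := x)).isSymmSndFDerivAt (by simp) _ _

end Calculus

theorem C1.diff {f : E3 → ℝ} (hf : ContDiff ℝ 1 f) (x : E3) : DifferentiableAt ℝ f x :=
  hf.differentiable one_ne_zero x

/-! ### Functions with square integrable gradient -/

/-- The gradient of `f` is square integrable. -/
def SqGrad (f : E3 → ℝ) : Prop := ∀ i, Integrable fun x => sd i f x ^ 2

/-- The energy estimate for div(u∇u) = |∇u|² + uΔu, with q = u²; the decay of u makes q/(1+r)² =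
O(r⁻⁴) integrable. -/
theorem sqGrad_of_laplacian {u : E3 → ℝ} (hu : ContDiff ℝ 2 u) {C : ℝ} (hC : ∀ x, |u x| ≤ C * wt x)
    (hint : Integrable fun x => u x * ∑ i, sd i (sd i u) x) : SqGrad u := by
  have hu1 : ContDiff ℝ 1 u := hu.of_le one_le_two
  have hsd := fun i => contDiff_sd hu i
  have hcs := fun i => continuous_sd hu1 i
  have hG : Integrable fun x => ∑ i, sd i u x ^ 2 := by
    refine integrable_energy (Y := fun x i => u x * sd i u x)
      (h := fun x => -(u x * ∑ i, sd i (sd i u) x)) (q := fun x => u x ^ 2)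
      (contDiff_pi.2 fun i => hu1.mul (hsd i)) (continuous_finsetSum _ fun i _ => (hcs i).pow 2)
      (fun x => Finset.sum_nonneg fun i _ => sq_nonneg _) (fun x => le_of_eq ?_)
      (fun x => le_of_eq ?_) hint.neg (fun x => sq_nonneg _) ?_
    · simp only [divE, sd_mul _ (C1.diff hu1 x) (C1.diff (hsd _) x), Fin.sum_univ_three]
      ring
    · simp only [Fin.sum_univ_three]
      ring
    · refine integrable_of_wt (C := C ^ 2) ((hu.continuous.pow 2).mul (continuous_wt.pow 2)) le_rfl
        fun x => ?_
      rw [abs_of_nonneg (by positivity)]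
      calc u x ^ 2 * wt x ^ 2 ≤ (C * wt x) ^ 2 * wt x ^ 2 := by
            rw [← sq_abs (u x)]
            have := pow_le_pow_left₀ (abs_nonneg _) (hC x) 2
            exact mul_le_mul_of_nonneg_right this (sq_nonneg _)
        _ = _ := by ring
  intro i
  refine hG.mono' ((hcs i).pow 2).aestronglyMeasurable (Eventually.of_forall fun x => ?_)
  rw [Real.norm_of_nonneg (sq_nonneg _)]
  exact Finset.single_le_sum (f := fun i => sd i u x ^ 2) (fun i _ => sq_nonneg _)
    (Finset.mem_univ i)

theorem sq_integrable_bdd_mul {f g : E3 → ℝ} (hf : Continuous f) (hg : Continuous g) {C : ℝ}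
    (hC : ∀ x, |f x| ≤ C) (hi : Integrable fun x => g x ^ 2) :
    Integrable fun x => (f x * g x) ^ 2 := by
  refine (hi.const_mul (C ^ 2)).mono' ((hf.mul hg).pow 2).aestronglyMeasurable
    (Eventually.of_forall fun x => ?_)
  rw [Real.norm_of_nonneg (sq_nonneg _), mul_pow, ← sq_abs (f x)]
  exact mul_le_mul_of_nonneg_right (pow_le_pow_left₀ (abs_nonneg _) (hC x) 2) (sq_nonneg _)

theorem sq_integrable_add {f g : E3 → ℝ} (hf : Continuous f) (hg : Continuous g)
    (hif : Integrable fun x => f x ^ 2) (hig : Integrable fun x => g x ^ 2) :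
    Integrable fun x => (f x + g x) ^ 2 := by
  refine ((hif.add hig).const_mul 2).mono' ((hf.add hg).pow 2).aestronglyMeasurable
    (Eventually.of_forall fun x => ?_)
  rw [Real.norm_of_nonneg (sq_nonneg _), Pi.add_apply]
  nlinarith [sq_nonneg (f x - g x)]

/-! ### The class of functions tending to one with L² gradient -/

/-- Continuously differentiable functions which are `1 + O(r⁻¹)` and have a square integrable
gradient. -/
structure AsympOne (m : E3 → ℝ) : Prop where
  smooth : ContDiff ℝ 1 m
  bound : ∃ C, ∀ x, |m x - 1| ≤ C * wt x
  grad : SqGrad m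

theorem bounded_of_falloff {m : E3 → ℝ} (hm : ∃ C, ∀ x, |m x - 1| ≤ C * wt x) :
    ∃ C, 0 ≤ C ∧ ∀ x, |m x| ≤ C := by
  obtain ⟨C, hC⟩ := hm
  refine ⟨|C| + 1, by positivity, fun x => ?_⟩
  have h1 : |m x| ≤ |m x - 1| + 1 := by
    calc |m x| = |(m x - 1) + 1| := by ring_nf
      _ ≤ _ := by simpa using abs_add_le (m x - 1) 1
  have h2 : C * wt x ≤ |C| :=
    (mul_le_mul_of_nonneg_right (le_abs_self C) (wt_nonneg x)).trans
      (mul_le_of_le_one_right (abs_nonneg C) (wt_le_one x))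
  linarith [hC x]

namespace AsympOne

variable {m n : E3 → ℝ}

theorem bdd (hm : AsympOne m) : ∃ C, 0 ≤ C ∧ ∀ x, |m x| ≤ C := bounded_of_falloff hm.bound

theorem mul (hm : AsympOne m) (hn : AsympOne n) : AsympOne fun x => m x * n x := by
  obtain ⟨C, hC⟩ := hm.bound
  obtain ⟨C', hC'⟩ := hn.bound
  obtain ⟨M, hM0, hM⟩ := hm.bdd
  obtain ⟨N, hN0, hN⟩ := hn.bdd
  refine ⟨hm.smooth.mul hn.smooth, ⟨M * C' + C, fun x => ?_⟩, fun i => ?_⟩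
  · calc |m x * n x - 1| = |m x * (n x - 1) + (m x - 1)| := by ring_nf
      _ ≤ |m x| * |n x - 1| + |m x - 1| := (abs_add_le _ _).trans_eq (by rw [abs_mul])
      _ ≤ M * (C' * wt x) + C * wt x :=
        add_le_add (mul_le_mul (hM x) (hC' x) (abs_nonneg _) hM0) (hC x)
      _ = _ := by ring
  · have h1 := fun x => sd_mul i (C1.diff hm.smooth x) (C1.diff hn.smooth x)
    simp only [h1, mul_comm (sd i m _)]
    have c1 := hm.smooth.continuous
    have c2 := hn.smooth.continuous
    have c3 := continuous_sd hm.smooth i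
    have c4 := continuous_sd hn.smooth i
    exact sq_integrable_add (c1.mul c4) (c2.mul c3) (sq_integrable_bdd_mul c1 c4 hM (hn.grad i))
      (sq_integrable_bdd_mul c2 c3 hN (hm.grad i))

/-- The bound on m - 1 forces m ≥ 1/2 outside a ball of radius 2|C|, and inside a minimum is
attained. This uniform lower bound is what allows inverses. -/
theorem exists_pos_le (hm : AsympOne m) (h0 : ∀ x, 0 < m x) : ∃ c, 0 < c ∧ ∀ x, c ≤ m x := by
  obtain ⟨C, hC⟩ := hm.bound
  obtain ⟨x₀, -, hx₀⟩ := (isCompact_closedBall (0 : E3) (2 * |C|)).exists_isMinOn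
    (Metric.nonempty_closedBall.2 (by positivity)) hm.smooth.continuous.continuousOn
  refine ⟨min (m x₀) (1 / 2), lt_min (h0 _) (by norm_num), fun x => ?_⟩
  rcases le_total ‖x‖ (2 * |C|) with hx | hx
  · exact (min_le_left _ _).trans (hx₀ (by simpa using hx))
  · refine (min_le_right _ _).trans ?_
    have h1 : C * wt x ≤ 1 / 2 := by
      refine (mul_le_mul_of_nonneg_right (le_abs_self C) (wt_nonneg x)).trans ?_
      rw [wt, ← div_eq_mul_inv, div_le_iff₀ (by positivity)]
      linarith
    have := (abs_le.1 (hC x)).1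
    linarith

theorem inv (hm : AsympOne m) (h0 : ∀ x, 0 < m x) : AsympOne fun x => (m x)⁻¹ := by
  obtain ⟨C, hC⟩ := hm.bound
  obtain ⟨c, hc, hcm⟩ := hm.exists_pos_le h0
  have hb : ∀ x, |(m x)⁻¹| ≤ c⁻¹ := fun x => by
    rw [abs_of_pos (inv_pos.2 (h0 x))]
    exact inv_anti₀ hc (hcm x)
  have hs : ContDiff ℝ 1 fun x => (m x)⁻¹ := hm.smooth.inv fun x => (h0 x).ne'
  refine ⟨hs, ⟨c⁻¹ * C, fun x => ?_⟩, fun i => ?_⟩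
  · have h1 : (m x)⁻¹ - 1 = -((m x)⁻¹ * (m x - 1)) := by
      have := (h0 x).ne'
      field_simp
      ring
    rw [h1, abs_neg, abs_mul, mul_assoc]
    exact mul_le_mul (hb x) (hC x) (abs_nonneg _) (inv_nonneg.2 hc.le)
  · have h1 : ∀ x, sd i (fun y => (m y)⁻¹) x = (-(m x)⁻¹ * (m x)⁻¹) * sd i m x := fun x => by
      have := (h0 x).ne'
      rw [sd_inv i (C1.diff hm.smooth x) this]
      field_simp
    simp only [h1]
    refine sq_integrable_bdd_mul (C := c⁻¹ * c⁻¹) (hs.continuous.neg.mul hs.continuous)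
      (continuous_sd hm.smooth i) (fun x => ?_) (hm.grad i)
    rw [abs_mul, abs_neg]
    exact mul_le_mul (hb x) (hb x) (abs_nonneg _) (inv_nonneg.2 hc.le)

theorem pow (hm : AsympOne m) (k : ℕ) : AsympOne fun x => m x ^ (k + 1) := by
  induction k with
  | zero => simpa using hm
  | succ k ih => simpa [pow_succ] using ih.mul hm

end AsympOne

/-! ### Weighted integrability and fluxes of gradients at infinity -/

theorem integrable_bdd_mul {f g : E3 → ℝ} (hf : Continuous f) {C : ℝ} (hC : ∀ x, |f x| ≤ C)
    (hg : Integrable g) : Integrable fun x => f x * g x :=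
  hg.bdd_mul (c := C) hf.aestronglyMeasurable (Eventually.of_forall hC)

/-- For n ≥ 2 the weight (1+r)⁻ⁿ is itself square integrable in dimension three. -/
theorem integrable_wt_pow_mul {g : E3 → ℝ} (hg : Continuous g) {n : ℕ} (hn : 2 ≤ n)
    (hi : Integrable fun x => g x ^ 2) : Integrable fun x => wt x ^ n * g x := by
  refine integrable_mul_of_sq (continuous_wt.pow n) hg ?_ hi
  refine integrable_of_wt (C := 1) (n := n * 2) ((continuous_wt.pow n).pow 2) (by omega)
    fun x => ?_
  rw [abs_of_nonneg (sq_nonneg _), one_mul, ← pow_mul]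

theorem integrable_of_le_wt_mul {f g : E3 → ℝ} (hf : Continuous f) (hg : Continuous g) {C : ℝ}
    {n : ℕ} (hn : 2 ≤ n) (hi : Integrable fun x => g x ^ 2)
    (h : ∀ x, |f x| ≤ C * wt x ^ n * |g x|) : Integrable f := by
  refine ((integrable_wt_pow_mul hg hn hi).abs.const_mul C).mono' hf.aestronglyMeasurable
    (Eventually.of_forall fun x => (h x).trans_eq ?_)
  rw [abs_mul, abs_of_nonneg (pow_nonneg (wt_nonneg x) n), mul_assoc]

/-- The prefactor m does not affect the limit: (m - 1)∇f divided by 1 + r is O(r⁻²) times an L²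
function, hence integrable, so the divergence of (m - 1)∇f integrates to zero. All the masses are
read off from this lemma with different choices of m. -/
theorem tendsto_flux_mul_grad {m f : E3 → ℝ} (hm : AsympOne m) (hf : ContDiff ℝ 2 f)
    (hgrad : SqGrad f) (hΔ : Integrable fun x => ∑ i, sd i (sd i f) x) :
    Tendsto (flux fun x i => m x * sd i f x) atTop (𝓝 (∫ x, ∑ i, sd i (sd i f) x)) := by
  obtain ⟨C, hC⟩ := hm.bound
  obtain ⟨M, hM0, hM⟩ := hm.bdd
  have hsd := fun i => contDiff_sd hf i
  have hf1 : ContDiff ℝ 1 f := hf.of_le one_le_two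
  have hcs := fun i => continuous_sd hf1 i
  have hcm := fun i => continuous_sd hm.smooth i
  have hdiv : ∀ x, divE (fun x i => m x * sd i f x) x
      = m x * (∑ i, sd i (sd i f) x) + ∑ i, sd i m x * sd i f x := fun x => by
    simp only [divE, sd_mul _ (C1.diff hm.smooth x) (C1.diff (hsd _) x), Finset.sum_add_distrib,
      Finset.mul_sum]
  have hV : ContDiff ℝ 1 fun x i => m x * sd i f x := contDiff_pi.2 fun i => hm.smooth.mul (hsd i)
  have hgg : Integrable fun x => ∑ i, sd i m x * sd i f x := integrable_finsetSum _ fun i _ =>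
    integrable_mul_of_sq (hcm i) (hcs i) (hm.grad i) (hgrad i)
  have hd : Integrable (divE fun x i => m x * sd i f x) := by
    refine ((integrable_bdd_mul hm.smooth.continuous hM hΔ).add hgg).congr
      (Eventually.of_forall fun x => ?_)
    rw [hdiv x]
    rfl
  have h := tendsto_flux hV hd
  have hW : ContDiff ℝ 1 fun x i => (m x - 1) * sd i f x := contDiff_pi.2 fun i =>
    (hm.smooth.sub contDiff_const).mul (hsd i)
  have hdivW : ∀ x, divE (fun x i => (m x - 1) * sd i f x) x
      = divE (fun x i => m x * sd i f x) x - ∑ i, sd i (sd i f) x := fun x => by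
    have := fun i => sd_mul i (f := fun y => m y - 1) (g := sd i f)
      ((C1.diff hm.smooth x).sub_const 1) (C1.diff (hsd i) x)
    simp only [divE, this, sd_sub_const, sd_mul _ (C1.diff hm.smooth x) (C1.diff (hsd _) x),
      ← Finset.sum_sub_distrib]
    exact Finset.sum_congr rfl fun i _ => by ring
  have h0 := integral_divE_eq_zero hW ((hd.sub hΔ).congr
    (Eventually.of_forall fun x => (hdivW x).symm)) fun i => by
      refine integrable_of_le_wt_mul (C := C) (n := 2) (by
        have := hm.smooth.continuous; have := hcs i; have := continuous_wt; fun_prop)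
        (hcs i) le_rfl (hgrad i) fun x => ?_
      rw [abs_mul, abs_mul, abs_of_pos (wt_pos x)]
      have := mul_le_mul_of_nonneg_right (hC x) (mul_nonneg (abs_nonneg (sd i f x)) (wt_nonneg x))
      calc _ = _ := mul_assoc _ _ _
        _ ≤ _ := this
        _ = _ := by ring
  simp only [hdivW] at h0
  rw [integral_sub hd hΔ, sub_eq_zero] at h0
  rwa [h0] at h

/-! ### The elliptic system on a slice -/

/-- Potentials and matter sources on a single slice. -/
structure SliceData where
  /-- the lapse -/
  lapse : E3 → ℝ
  /-- the conformal factor -/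
  psi : E3 → ℝ
  /-- the shift -/
  shift : E3 → Fin 3 → ℝ
  /-- the tracefree extrinsic curvature -/
  curv : E3 → Fin 3 → Fin 3 → ℝ
  /-- the energy density seen by normal observers -/
  rho : E3 → ℝ
  /-- the trace of the spatial stress -/
  trace : E3 → ℝ
  /-- the momentum density -/
  mom : E3 → Fin 3 → ℝ

namespace SliceData

variable (s : SliceData)

/-- `χ = α ψ` on the slice. -/
def chi (x : E3) : ℝ := s.lapse x * s.psi x

/-- `K̂_i^j K̂_j^i` on the slice. -/
def curvSq (x : E3) : ℝ := ∑ i, ∑ j, s.curv x i j * s.curv x j i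

/-- The field equations, regularity and falloff on a single slice. -/
structure IsSolution : Prop where
  lapse_smooth : ContDiff ℝ 2 s.lapse
  psi_smooth : ContDiff ℝ 2 s.psi
  shift_smooth : ∀ k, ContDiff ℝ 2 fun x => s.shift x k
  curv_smooth : ∀ i j, ContDiff ℝ 1 fun x => s.curv x i j
  lapse_pos : ∀ x, 0 < s.lapse x
  psi_pos : ∀ x, 0 < s.psi x
  curv_eq : ∀ x i j, 2 * s.lapse x * s.curv x i j =
    sd i (fun y => s.shift y j) x + sd j (fun y => s.shift y i) x
      - 2 / 3 * (if i = j then 1 else 0) * ∑ k, sd k (fun y => s.shift y k) x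
  rho_cont : Continuous s.rho
  trace_cont : Continuous s.trace
  mom_cont : ∀ k, Continuous fun x => s.mom x k
  matter_bdd : ∃ R, ∀ x, R < ‖x‖ → s.rho x = 0 ∧ s.trace x = 0 ∧ ∀ k, s.mom x k = 0
  hamiltonian : ∀ x, lap s.psi x =
    -2 * Real.pi * s.psi x ^ 5 * s.rho x - s.psi x ^ 5 / 8 * s.curvSq x
  momentum : ∀ x i, ∑ j, sd j (fun y => s.psi y ^ 6 * s.curv y i j) x =
    8 * Real.pi * s.mom x i * s.psi x ^ 6
  slicing : ∀ x, lap s.chi x =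
    2 * Real.pi * s.chi x * s.psi x ^ 4 * (s.rho x + 2 * s.trace x)
      + 7 / 8 * s.chi x * s.psi x ^ 4 * s.curvSq x
  psi_falloff : ∃ C, ∀ x, |s.psi x - 1| ≤ C * wt x
  chi_falloff : ∃ C, ∀ x, |s.chi x - 1| ≤ C * wt x
  shift_falloff : ∃ C, 0 ≤ C ∧ ∀ k x, |s.shift x k| ≤ C * wt x ^ 2
  curv_falloff : ∃ C, 0 ≤ C ∧ ∀ i j x, |s.curv x i j| ≤ C * wt x ^ 3

/-- The virial density expressed through `α S_k^k`. -/
def density (x : E3) : ℝ :=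
  s.psi x ^ 6 * (s.lapse x * s.trace x) - 3 / 2 * s.psi x ^ 6 * (∑ k, s.mom x k * s.shift x k)
    + 1 / (2 * Real.pi) * ∑ i, sd i s.chi x * sd i s.psi x

/-- The vector field `√γ K̂_k^i β^k`. -/
def shiftFlux (x : E3) (i : Fin 3) : ℝ := ∑ k, s.psi x ^ 6 * s.curv x k i * s.shift x k

variable {s}

namespace IsSolution

variable (h : s.IsSolution)
include h

theorem psi1 : ContDiff ℝ 1 s.psi := h.psi_smooth.of_le one_le_two

theorem lapse1 : ContDiff ℝ 1 s.lapse := h.lapse_smooth.of_le one_le_two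

theorem chi_smooth : ContDiff ℝ 2 s.chi := h.lapse_smooth.mul h.psi_smooth

theorem chi1 : ContDiff ℝ 1 s.chi := h.chi_smooth.of_le one_le_two

theorem shift1 (k : Fin 3) : ContDiff ℝ 1 fun x => s.shift x k := (h.shift_smooth k).of_le one_le_two

theorem curv_symm (x : E3) (i j : Fin 3) : s.curv x i j = s.curv x j i := by
  have h1 := h.curv_eq x i j
  have h2 := h.curv_eq x j i
  have h3 := (h.lapse_pos x).ne'
  have h4 : 2 * s.lapse x * s.curv x i j = 2 * s.lapse x * s.curv x j i := by
    rw [h1, h2]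
    simp only [eq_comm (a := j)]
    ring
  exact mul_left_cancel₀ (by positivity) h4

theorem curv_trace (x : E3) : ∑ i, s.curv x i i = 0 := by
  have h3 := (h.lapse_pos x).ne'
  have h4 : 2 * s.lapse x * ∑ i, s.curv x i i = 0 := by
    rw [Finset.mul_sum]
    simp only [h.curv_eq x, Fin.sum_univ_three, if_true]
    ring
  exact (mul_eq_zero.1 h4).resolve_left (by positivity)

/-- As K̂ is symmetric and tracefree, contraction with ∂β sees only the tracefree symmetric part of
∂β, which is αK̂. -/
theorem sum_curv_mul_sd_shift (x : E3) :
    ∑ k, ∑ i, s.curv x k i * sd i (fun y => s.shift y k) x = s.lapse x * s.curvSq x := by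
  have h1 : 2 * s.lapse x * s.curvSq x
      = ∑ i, ∑ j, s.curv x i j * (2 * s.lapse x * s.curv x j i) := by
    simp only [curvSq, Finset.mul_sum]
    exact Finset.sum_congr rfl fun i _ => Finset.sum_congr rfl fun j _ => by ring
  have h2 := h.curv_trace x
  simp only [h.curv_eq x] at h1
  simp only [Fin.sum_univ_three] at h1 h2 ⊢
  simp only [h.curv_symm x 1 0, h.curv_symm x 2 0, h.curv_symm x 2 1] at h1 ⊢
  simp at h1
  linear_combination (-1 / 2 : ℝ) * h1 + 1 / 3 * (sd 0 (fun y => s.shift y 0) x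
    + sd 1 (fun y => s.shift y 1) x + sd 2 (fun y => s.shift y 2) x) * h2

theorem densitized_smooth (i j : Fin 3) : ContDiff ℝ 1 fun x => s.psi x ^ 6 * s.curv x i j :=
  (h.psi1.pow 6).mul (h.curv_smooth i j)

theorem shiftFlux_smooth : ContDiff ℝ 1 s.shiftFlux :=
  contDiff_pi.2 fun i => ContDiff.sum fun k _ => (h.densitized_smooth k i).mul (h.shift1 k)

/-- By the momentum constraint this divergence exchanges the curvature term αψ⁶K̂² for the momentum
term j_k β^k in the virial density. -/
theorem divE_shiftFlux (x : E3) : divE s.shiftFlux x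
    = 8 * Real.pi * s.psi x ^ 6 * (∑ k, s.mom x k * s.shift x k)
      + s.lapse x * s.psi x ^ 6 * s.curvSq x := by
  have h1 : ∀ i, sd i (fun y => s.shiftFlux y i) x = ∑ k,
      (s.psi x ^ 6 * s.curv x k i * sd i (fun y => s.shift y k) x
        + sd i (fun y => s.psi y ^ 6 * s.curv y k i) x * s.shift x k) := fun i => by
    unfold shiftFlux
    rw [sd_sum i fun k => C1.diff ((h.densitized_smooth k i).mul (h.shift1 k)) x]
    exact Finset.sum_congr rfl fun k _ =>
      sd_mul i (C1.diff (h.densitized_smooth k i) x) (C1.diff (h.shift1 k) x)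
  have h2 := h.sum_curv_mul_sd_shift x
  simp only [divE, h1]
  rw [Finset.sum_comm]
  simp only [Finset.sum_add_distrib, ← Finset.sum_mul, h.momentum, mul_assoc (s.psi x ^ 6),
    ← Finset.mul_sum, h2]
  simp only [Fin.sum_univ_three]
  ring

theorem continuous_curvSq : Continuous s.curvSq :=
  continuous_finsetSum _ fun i _ => continuous_finsetSum _ fun j _ =>
    (h.curv_smooth i j).continuous.mul (h.curv_smooth j i).continuous

theorem curvSq_smooth : ContDiff ℝ 1 s.curvSq :=
  ContDiff.sum fun i _ => ContDiff.sum fun j _ => (h.curv_smooth i j).mul (h.curv_smooth j i)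

theorem curvSq_falloff : ∃ C, 0 ≤ C ∧ ∀ x, |s.curvSq x| ≤ C * wt x ^ 6 := by
  obtain ⟨C, hC0, hC⟩ := h.curv_falloff
  refine ⟨9 * C ^ 2, by positivity, fun x => ?_⟩
  have h1 : ∀ i j, |s.curv x i j * s.curv x j i| ≤ C ^ 2 * wt x ^ 6 := fun i j => by
    rw [abs_mul]
    calc _ ≤ (C * wt x ^ 3) * (C * wt x ^ 3) :=
          mul_le_mul (hC i j x) (hC j i x) (abs_nonneg _) ((abs_nonneg _).trans (hC i j x))
      _ = _ := by ring
  calc |s.curvSq x| ≤ ∑ i, ∑ j, |s.curv x i j * s.curv x j i| :=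
        (Finset.abs_sum_le_sum_abs _ _).trans
          (Finset.sum_le_sum fun i _ => Finset.abs_sum_le_sum_abs _ _)
    _ ≤ ∑ _i : Fin 3, ∑ _j : Fin 3, C ^ 2 * wt x ^ 6 :=
        Finset.sum_le_sum fun i _ => Finset.sum_le_sum fun j _ => h1 i j
    _ = _ := by simp; ring

theorem integrable_curvSq : Integrable s.curvSq := by
  obtain ⟨C, -, hC⟩ := h.curvSq_falloff
  exact integrable_of_wt h.continuous_curvSq (by norm_num) hC

theorem integrable_matter {f : E3 → ℝ} (hf : Continuous f)
    (h0 : ∀ x, s.rho x = 0 → s.trace x = 0 → (∀ k, s.mom x k = 0) → f x = 0) : Integrable f := by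
  obtain ⟨R, hR⟩ := h.matter_bdd
  exact integrable_of_eq_zero_outside hf fun x hx => h0 x (hR x hx).1 (hR x hx).2.1 (hR x hx).2.2

theorem integrable_lap_psi : Integrable (lap s.psi) := by
  obtain ⟨M, hM0, hM⟩ := bounded_of_falloff h.psi_falloff
  have c1 := h.psi_smooth.continuous
  have c2 := h.rho_cont
  have i1 : Integrable fun x => -2 * Real.pi * s.psi x ^ 5 * s.rho x :=
    h.integrable_matter (by fun_prop) fun x h1 _ _ => by rw [h1, mul_zero]
  have i2 : Integrable fun x => s.psi x ^ 5 / 8 * s.curvSq x := by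
    refine integrable_bdd_mul (C := M ^ 5 / 8) (by fun_prop) (fun x => ?_) h.integrable_curvSq
    rw [abs_div, abs_pow, abs_of_pos (by norm_num : (0 : ℝ) < 8)]
    exact div_le_div_of_nonneg_right (pow_le_pow_left₀ (abs_nonneg _) (hM x) 5) (by norm_num)
  exact (i1.sub i2).congr (Eventually.of_forall fun x => (h.hamiltonian x).symm)

theorem integrable_lap_chi : Integrable (lap s.chi) := by
  obtain ⟨M, hM0, hM⟩ := bounded_of_falloff h.psi_falloff
  obtain ⟨N, hN0, hN⟩ := bounded_of_falloff h.chi_falloff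
  have c1 := h.psi_smooth.continuous
  have c2 := h.rho_cont
  have c3 := h.trace_cont
  have c4 := h.chi_smooth.continuous
  have i1 : Integrable fun x => 2 * Real.pi * s.chi x * s.psi x ^ 4 * (s.rho x + 2 * s.trace x) :=
    h.integrable_matter (by fun_prop) fun x h1 h2 _ => by simp [h1, h2]
  have i2 : Integrable fun x => 7 / 8 * s.chi x * s.psi x ^ 4 * s.curvSq x := by
    refine integrable_bdd_mul (C := 7 / 8 * N * M ^ 4) (by fun_prop) (fun x => ?_)
      h.integrable_curvSq
    rw [abs_mul, abs_mul, abs_pow, abs_of_pos (by norm_num : (0 : ℝ) < 7 / 8)]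
    have := hN x
    have := pow_le_pow_left₀ (abs_nonneg _) (hM x) 4
    gcongr
  exact (i1.add i2).congr (Eventually.of_forall fun x => (h.slicing x).symm)

-- Applies the energy estimate to f - 1, which decays, whereas f itself does not.
omit h in
theorem asympOne_of_lap {f : E3 → ℝ} (hf : ContDiff ℝ 2 f) (hb : ∃ C, ∀ x, |f x - 1| ≤ C * wt x)
    (hi : Integrable (lap f)) : AsympOne f := by
  obtain ⟨C, hC⟩ := hb
  refine ⟨hf.of_le one_le_two, ⟨C, hC⟩, ?_⟩
  have h1 : ∀ i, sd i (fun x => f x - 1) = sd i f := fun i => funext fun x => sd_sub_const i 1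
  have h2 : SqGrad fun x => f x - 1 := by
    refine sqGrad_of_laplacian (hf.sub contDiff_const) hC ?_
    simp only [h1]
    refine integrable_bdd_mul (C := |C|) (hf.continuous.sub continuous_const) (fun x => ?_) hi
    refine (hC x).trans ((mul_le_mul_of_nonneg_right (le_abs_self C) (wt_nonneg x)).trans ?_)
    exact mul_le_of_le_one_right (abs_nonneg C) (wt_le_one x)
  intro i
  have := h2 i
  rwa [h1] at this

theorem asympOne_psi : AsympOne s.psi :=
  asympOne_of_lap h.psi_smooth h.psi_falloff h.integrable_lap_psi

theorem asympOne_chi : AsympOne s.chi :=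
  asympOne_of_lap h.chi_smooth h.chi_falloff h.integrable_lap_chi

/-- No falloff of the lapse is assumed; it is inherited from α = χ/ψ. -/
theorem asympOne_lapse : AsympOne s.lapse := by
  have h1 := h.asympOne_chi.mul (h.asympOne_psi.inv h.psi_pos)
  have h2 : (fun x => s.chi x * (s.psi x)⁻¹) = s.lapse := funext fun x => by
    rw [chi, mul_assoc, mul_inv_cancel₀ (h.psi_pos x).ne', mul_one]
  rwa [h2] at h1

theorem integrable_shiftFlux_wt (i : Fin 3) : Integrable fun x => s.shiftFlux x i * wt x := by
  obtain ⟨M, hM0, hM⟩ := bounded_of_falloff h.psi_falloff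
  obtain ⟨C, hC0, hC⟩ := h.curv_falloff
  obtain ⟨D, hD0, hD⟩ := h.shift_falloff
  refine integrable_of_wt (C := 3 * (M ^ 6 * C * D)) (n := 6)
    ((contDiff_pi.1 h.shiftFlux_smooth i).continuous.mul continuous_wt) (by norm_num) fun x => ?_
  have h1 : ∀ k, |s.psi x ^ 6 * s.curv x k i * s.shift x k| ≤ M ^ 6 * C * D * wt x ^ 5 := fun k => by
    rw [abs_mul, abs_mul, abs_pow]
    have e1 := pow_le_pow_left₀ (abs_nonneg _) (hM x) 6
    have w0 := wt_nonneg x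
    calc _ ≤ M ^ 6 * (C * wt x ^ 3) * (D * wt x ^ 2) := by
          gcongr
          · exact hC k i x
          · exact hD k x
      _ = _ := by ring
  have h2 : |s.shiftFlux x i| ≤ 3 * (M ^ 6 * C * D) * wt x ^ 5 := by
    calc |s.shiftFlux x i| ≤ ∑ k, |s.psi x ^ 6 * s.curv x k i * s.shift x k| :=
          Finset.abs_sum_le_sum_abs _ _
      _ ≤ ∑ _k : Fin 3, M ^ 6 * C * D * wt x ^ 5 := Finset.sum_le_sum fun k _ => h1 k
      _ = _ := by simp; ring
  rw [abs_mul, abs_of_pos (wt_pos x)]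
  calc _ ≤ 3 * (M ^ 6 * C * D) * wt x ^ 5 * wt x := mul_le_mul_of_nonneg_right h2 (wt_nonneg x)
    _ = _ := by ring

theorem continuous_sum_mom_shift : Continuous fun x => ∑ k, s.mom x k * s.shift x k :=
  continuous_finsetSum _ fun k _ => (h.mom_cont k).mul (h.shift1 k).continuous

theorem integrable_divE_shiftFlux : Integrable (divE s.shiftFlux) := by
  obtain ⟨M, hM0, hM⟩ := bounded_of_falloff h.psi_falloff
  obtain ⟨N, hN0, hN⟩ := h.asympOne_lapse.bdd
  have c1 := h.psi_smooth.continuous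
  have c2 := h.continuous_sum_mom_shift
  have c3 := h.lapse_smooth.continuous
  have i1 : Integrable fun x =>
      8 * Real.pi * s.psi x ^ 6 * (∑ k, s.mom x k * s.shift x k) :=
    h.integrable_matter (by fun_prop) fun x _ _ h3 => by simp [h3]
  have i2 : Integrable fun x => s.lapse x * s.psi x ^ 6 * s.curvSq x := by
    refine integrable_bdd_mul (C := N * M ^ 6) (by fun_prop) (fun x => ?_) h.integrable_curvSq
    rw [abs_mul, abs_pow]
    have := hN x
    have := pow_le_pow_left₀ (abs_nonneg _) (hM x) 6
    gcongr
  exact (i1.add i2).congr (Eventually.of_forall fun x => (h.divE_shiftFlux x).symm)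

theorem integral_divE_shiftFlux : ∫ x, divE s.shiftFlux x = 0 :=
  integral_divE_eq_zero h.shiftFlux_smooth h.integrable_divE_shiftFlux h.integrable_shiftFlux_wt

theorem integrable_grad_mul_grad : Integrable fun x => ∑ i, sd i s.chi x * sd i s.psi x :=
  integrable_finsetSum _ fun i _ => integrable_mul_of_sq (continuous_sd h.chi1 i)
    (continuous_sd h.psi1 i) (h.asympOne_chi.grad i) (h.asympOne_psi.grad i)

theorem integrable_density : Integrable s.density := by
  have c1 := h.psi_smooth.continuous
  have c2 := h.continuous_sum_mom_shift
  have c3 := h.lapse_smooth.continuous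
  have c4 := h.trace_cont
  have i1 : Integrable fun x => s.psi x ^ 6 * (s.lapse x * s.trace x)
      - 3 / 2 * s.psi x ^ 6 * (∑ k, s.mom x k * s.shift x k) :=
    h.integrable_matter (by fun_prop) fun x _ h2 h3 => by simp [h2, h3]
  exact i1.add (h.integrable_grad_mul_grad.const_mul _)

/-- The flux limits of the two potentials differ by the virial integral. -/
theorem integral_lap_add_lap :
    (∫ x, lap s.chi x) + (∫ x, lap s.psi x) = 4 * Real.pi * ∫ x, s.density x := by
  have hc2 := fun i => contDiff_sd h.chi_smooth i
  have hp2 := fun i => contDiff_sd h.psi_smooth i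
  have t1 := tendsto_flux_mul_grad h.asympOne_psi h.chi_smooth h.asympOne_chi.grad
    h.integrable_lap_chi
  have t2 := tendsto_flux_mul_grad h.asympOne_chi h.psi_smooth h.asympOne_psi.grad
    h.integrable_lap_psi
  have hV : ContDiff ℝ 1 fun x i => s.psi x * sd i s.chi x + s.chi x * sd i s.psi x :=
    contDiff_pi.2 fun i => (h.psi1.mul (hc2 i)).add (h.chi1.mul (hp2 i))
  -- In ψΔχ + χΔψ the terms in ρ_H cancel, the trace contributes 4παψ⁶S, and the K̂² terms combine
  -- to 7/8 - 1/8 = 3/4, which the shift flux trades for j_k β^k.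
  have hdiv : ∀ x, divE (fun x i => s.psi x * sd i s.chi x + s.chi x * sd i s.psi x) x
      = 4 * Real.pi * s.density x + 3 / 4 * divE s.shiftFlux x := fun x => by
    have e1 : divE (fun x i => s.psi x * sd i s.chi x + s.chi x * sd i s.psi x) x
        = s.psi x * lap s.chi x + s.chi x * lap s.psi x
          + 2 * ∑ i, sd i s.chi x * sd i s.psi x := by
      simp only [divE, lap]
      simp only [sd_add _ (C1.diff (h.psi1.mul (hc2 _)) x) (C1.diff (h.chi1.mul (hp2 _)) x),
        sd_mul _ (C1.diff h.psi1 x) (C1.diff (hc2 _) x),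
        sd_mul _ (C1.diff h.chi1 x) (C1.diff (hp2 _) x), Fin.sum_univ_three]
      ring
    rw [e1, h.divE_shiftFlux, h.hamiltonian, h.slicing, density]
    have := Real.pi_ne_zero
    simp only [chi]
    field_simp
    ring
  have hint : Integrable (divE fun x i => s.psi x * sd i s.chi x + s.chi x * sd i s.psi x) :=
    ((h.integrable_density.const_mul _).add (h.integrable_divE_shiftFlux.const_mul _)).congr
      (Eventually.of_forall fun x => (hdiv x).symm)
  have t3 := tendsto_flux hV hint
  have hsum : flux (fun x i => s.psi x * sd i s.chi x + s.chi x * sd i s.psi x)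
      = fun r => flux (fun x i => s.psi x * sd i s.chi x) r
        + flux (fun x i => s.chi x * sd i s.psi x) r := by
    funext r
    exact flux_add (contDiff_pi.2 fun i => h.psi1.mul (hc2 i)).continuous
      (contDiff_pi.2 fun i => h.chi1.mul (hp2 i)).continuous r
  rw [hsum] at t3
  have := tendsto_nhds_unique (t1.add t2) t3
  simp only [hdiv] at this
  rw [integral_add (h.integrable_density.const_mul _) (h.integrable_divE_shiftFlux.const_mul _),
    integral_const_mul, integral_const_mul, h.integral_divE_shiftFlux, mul_zero, add_zero] at this
  exact this

end IsSolution

end SliceData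

/-! ### Square integrability of the gradient of the shift -/

namespace SliceData.IsSolution

variable {s : SliceData} (h : s.IsSolution)
include h

/-- Korn's inequality for the shift. -/
theorem sqGrad_shift (k : Fin 3) : SqGrad fun x => s.shift x k := by
  obtain ⟨D, hD0, hD⟩ := h.shift_falloff
  obtain ⟨N, hN0, hN⟩ := h.asympOne_lapse.bdd
  have hb := h.shift1
  have hsd := fun i k => contDiff_sd (h.shift_smooth k) i
  have hcs := fun i k => continuous_sd (h.shift1 k) i
  have ca := h.lapse_smooth.continuous
  have hterm : ∀ i j, ContDiff ℝ 1 fun x => s.shift x i * sd j (fun y => s.shift y j) x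
      - s.shift x j * sd j (fun y => s.shift y i) x := fun i j =>
    ((hb i).mul (hsd j j)).sub ((hb j).mul (hsd j i))
  have hG : Integrable fun x => ∑ i, ∑ j, sd i (fun y => s.shift y j) x ^ 2 := by
    -- The current Y_i = β_i ∂_jβ_j - β_j ∂_jβ_i has divergence (div β)² - ∂_iβ_j ∂_jβ_i, free of
    -- second derivatives. Added to 2α²K̂² it cancels the mixed products.
    refine integrable_energy
      (Y := fun x i => ∑ j, (s.shift x i * sd j (fun y => s.shift y j) x
        - s.shift x j * sd j (fun y => s.shift y i) x))
      (h := fun x => (2 * s.lapse x ^ 2) * s.curvSq x)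
      (q := fun x => 108 * ∑ k, s.shift x k ^ 2)
      (contDiff_pi.2 fun i => ContDiff.sum fun j _ => hterm i j)
      (continuous_finsetSum _ fun i _ => continuous_finsetSum _ fun j _ => (hcs i j).pow 2)
      (fun x => Finset.sum_nonneg fun i _ => Finset.sum_nonneg fun j _ => sq_nonneg _)
      (fun x => ?_) (fun x => ?_) ?_ (fun x => by positivity) ?_
    · have e1 : ∀ i, sd i (fun y => ∑ j, (s.shift y i * sd j (fun z => s.shift z j) y
          - s.shift y j * sd j (fun z => s.shift z i) y)) x
          = ∑ j, ((s.shift x i * sd i (sd j (fun z => s.shift z j)) x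
            + sd i (fun z => s.shift z i) x * sd j (fun z => s.shift z j) x)
            - (s.shift x j * sd i (sd j (fun z => s.shift z i)) x
            + sd i (fun z => s.shift z j) x * sd j (fun z => s.shift z i) x)) := fun i => by
        rw [sd_sum i fun j => C1.diff (hterm i j) x]
        refine Finset.sum_congr rfl fun j _ => ?_
        rw [sd_sub i (C1.diff ((hb i).mul (hsd j j)) x) (C1.diff ((hb j).mul (hsd j i)) x),
          sd_mul i (C1.diff (hb i) x) (C1.diff (hsd j j) x),
          sd_mul i (C1.diff (hb j) x) (C1.diff (hsd j i) x)]
      have e2 : 4 * s.lapse x ^ 2 * s.curvSq x = ∑ i, ∑ j, (2 * s.lapse x * s.curv x i j) ^ 2 := by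
        simp only [curvSq, Finset.mul_sum]
        refine Finset.sum_congr rfl fun i _ => Finset.sum_congr rfl fun j _ => ?_
        rw [h.curv_symm x j i]
        ring
      simp only [h.curv_eq x] at e2
      simp only [divE, e1]
      simp only [Fin.sum_univ_three] at e2 ⊢
      simp at e2
      have hc := fun k => sd_comm (h.shift_smooth k)
      -- Once the mixed second derivatives are identified, 2α²K̂² + div Y exceeds the sum of the
      -- (∂_iβ_j)² by exactly (div β)²/3.
      rw [hc 1 0 1 x, hc 2 0 2 x, hc 2 1 2 x, hc 0 1 0 x, hc 0 2 0 x, hc 1 2 1 x]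
      nlinarith [sq_nonneg (sd 0 (fun y => s.shift y 0) x + sd 1 (fun y => s.shift y 1) x
        + sd 2 (fun y => s.shift y 2) x)]
    · set B := ∑ k, s.shift x k ^ 2
      set G := ∑ i, ∑ j, sd i (fun y => s.shift y j) x ^ 2
      have b1 : ∀ k, s.shift x k ^ 2 ≤ B := fun k =>
        Finset.single_le_sum (f := fun k => s.shift x k ^ 2) (fun k _ => sq_nonneg _)
          (Finset.mem_univ k)
      have b2 : ∀ i j, sd i (fun y => s.shift y j) x ^ 2 ≤ G := fun i j =>
        (Finset.single_le_sum (f := fun j => sd i (fun y => s.shift y j) x ^ 2)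
          (fun j _ => sq_nonneg _) (Finset.mem_univ j)).trans
        (Finset.single_le_sum (f := fun i => ∑ j, sd i (fun y => s.shift y j) x ^ 2)
          (fun i _ => Finset.sum_nonneg fun j _ => sq_nonneg _) (Finset.mem_univ i))
      have hB : 0 ≤ B := (sq_nonneg _).trans (b1 0)
      have b3 : ∀ k i j, (s.shift x k * sd i (fun y => s.shift y j) x) ^ 2 ≤ B * G := fun k i j => by
        rw [mul_pow]
        exact mul_le_mul (b1 k) (b2 i j) (sq_nonneg _) hB
      -- The constant 108 arises as 4 for each difference, 9 for the square of a sum of three such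
      -- terms, and 3 for the sum over i.
      have b4 : ∀ i j, (s.shift x i * sd j (fun y => s.shift y j) x
          - s.shift x j * sd j (fun y => s.shift y i) x) ^ 2 ≤ 4 * (B * G) := fun i j => by
        nlinarith [b3 i j j, b3 j j i, sq_nonneg (s.shift x i * sd j (fun y => s.shift y j) x
          + s.shift x j * sd j (fun y => s.shift y i) x)]
      have b5 : ∀ i, (∑ j, (s.shift x i * sd j (fun y => s.shift y j) x
          - s.shift x j * sd j (fun y => s.shift y i) x)) ^ 2 ≤ 36 * (B * G) := fun i => by
        refine sq_sum_le_card_mul_sum_sq.trans ?_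
        have := Finset.sum_le_sum fun j (_ : j ∈ Finset.univ) => b4 i j
        simp only [Finset.sum_const, Finset.card_univ, Fintype.card_fin, nsmul_eq_mul] at this ⊢
        push_cast at this ⊢
        linarith
      have := Finset.sum_le_sum fun i (_ : i ∈ Finset.univ) => b5 i
      simp only [Finset.sum_const, Finset.card_univ, Fintype.card_fin, nsmul_eq_mul] at this
      push_cast at this
      linarith
    · refine integrable_bdd_mul (C := 2 * N ^ 2) (by fun_prop) (fun x => ?_) h.integrable_curvSq
      rw [abs_mul, abs_pow, abs_of_pos (by norm_num : (0 : ℝ) < 2)]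
      have := pow_le_pow_left₀ (abs_nonneg _) (hN x) 2
      linarith
    · have cb := fun k => (hb k).continuous
      have cw := continuous_wt
      refine integrable_of_wt (C := 324 * D ^ 2) (n := 6) (by fun_prop) (by norm_num) fun x => ?_
      have b1 : ∀ k, s.shift x k ^ 2 ≤ D ^ 2 * wt x ^ 4 := fun k => by
        rw [← sq_abs]
        calc _ ≤ (D * wt x ^ 2) ^ 2 := pow_le_pow_left₀ (abs_nonneg _) (hD k x) 2
          _ = _ := by ring
      have b2 := Finset.sum_le_sum fun i (_ : i ∈ Finset.univ) => b1 i
      simp only [Finset.sum_const, Finset.card_univ, Fintype.card_fin, nsmul_eq_mul] at b2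
      push_cast at b2
      rw [abs_of_nonneg (by positivity)]
      have := mul_le_mul_of_nonneg_right b2 (sq_nonneg (wt x))
      calc _ = 108 * ((∑ k, s.shift x k ^ 2) * wt x ^ 2) := by ring
        _ ≤ 108 * (3 * (D ^ 2 * wt x ^ 4) * wt x ^ 2) := by linarith
        _ = _ := by ring
  intro i
  refine hG.mono' ((hcs i k).pow 2).aestronglyMeasurable (Eventually.of_forall fun x => ?_)
  rw [Real.norm_of_nonneg (sq_nonneg _)]
  exact (Finset.single_le_sum (f := fun j => sd i (fun y => s.shift y j) x ^ 2)
      (fun j _ => sq_nonneg _) (Finset.mem_univ k)).trans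
    (Finset.single_le_sum (f := fun i => ∑ j, sd i (fun y => s.shift y j) x ^ 2)
      (fun i _ => Finset.sum_nonneg fun j _ => sq_nonneg _) (Finset.mem_univ i))

end SliceData.IsSolution

/-! ### The dilation identity -/

/-- The derivative of `f` along the dilation field `x - b`. -/
def dil (b : Fin 3 → ℝ) (f : E3 → ℝ) (x : E3) : ℝ := ∑ k, (x k - b k) * sd k f x

theorem coordSub_smooth {n : WithTop ℕ∞} (a : ℝ) (k : Fin 3) :
    ContDiff ℝ n fun x : E3 => x k - a := by fun_prop

theorem dil_smooth {f : E3 → ℝ} (hf : ContDiff ℝ 2 f) (b : Fin 3 → ℝ) : ContDiff ℝ 1 (dil b f) :=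
  ContDiff.sum fun k _ => (coordSub_smooth _ k).mul (contDiff_sd hf k)

theorem continuous_dil {f : E3 → ℝ} (hf : ContDiff ℝ 1 f) (b : Fin 3 → ℝ) : Continuous (dil b f) :=
  continuous_finsetSum _ fun k _ =>
    (coordSub_smooth (n := 1) _ k).continuous.mul (continuous_sd hf k)

theorem sd_dil {f : E3 → ℝ} (hf : ContDiff ℝ 2 f) (b : Fin 3 → ℝ) (i : Fin 3) (x : E3) :
    sd i (dil b f) x = sd i f x + ∑ k, (x k - b k) * sd k (sd i f) x := by
  unfold dil
  rw [sd_sum i fun k => C1.diff ((coordSub_smooth _ k).mul (contDiff_sd hf k)) x]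
  have : ∀ k, sd i (fun y => (y k - b k) * sd k f y) x
      = (x k - b k) * sd k (sd i f) x + (if k = i then 1 else 0) * sd k f x := fun k => by
    rw [sd_mul i (C1.diff (coordSub_smooth _ k) x) (C1.diff (contDiff_sd hf k) x), sd_sub_const,
      sd_coord, sd_comm hf]
  simp [this, Finset.sum_add_distrib, add_comm]

/-- The Pohozaev current of two potentials. -/
def pohozaev (b : Fin 3 → ℝ) (f g : E3 → ℝ) (x : E3) (i : Fin 3) : ℝ :=
  sd i f x * dil b g x + sd i g x * dil b f x - (x i - b i) * ∑ k, sd k g x * sd k f x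

theorem contDiff_grad_mul_grad {f g : E3 → ℝ} (hf : ContDiff ℝ 2 f) (hg : ContDiff ℝ 2 g) :
    ContDiff ℝ 1 fun x => ∑ k, sd k g x * sd k f x :=
  ContDiff.sum fun k _ => (contDiff_sd hg k).mul (contDiff_sd hf k)

theorem pohozaev_smooth {f g : E3 → ℝ} (hf : ContDiff ℝ 2 f) (hg : ContDiff ℝ 2 g)
    (b : Fin 3 → ℝ) : ContDiff ℝ 1 (pohozaev b f g) :=
  contDiff_pi.2 fun i => (((contDiff_sd hf i).mul (dil_smooth hg b)).add
    ((contDiff_sd hg i).mul (dil_smooth hf b))).sub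
      ((coordSub_smooth _ i).mul (contDiff_grad_mul_grad hf hg))

/-- The terms with second derivatives contracted with x - b cancel except for the two Laplacians.
The coefficient of ∇f·∇g is 2 - 3 = -1: two from differentiating the dilations, three from div(x -
b). -/
theorem divE_pohozaev {f g : E3 → ℝ} (hf : ContDiff ℝ 2 f) (hg : ContDiff ℝ 2 g)
    (b : Fin 3 → ℝ) (x : E3) : divE (pohozaev b f g) x
      = lap f x * dil b g x + lap g x * dil b f x - ∑ k, sd k g x * sd k f x := by
  have hfs := contDiff_sd hf
  have hgs := contDiff_sd hg
  have e1 : ∀ i, sd i (fun y => pohozaev b f g y i) x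
      = (sd i f x * (sd i g x + ∑ k, (x k - b k) * sd k (sd i g) x)
          + sd i (sd i f) x * dil b g x)
        + (sd i g x * (sd i f x + ∑ k, (x k - b k) * sd k (sd i f) x)
          + sd i (sd i g) x * dil b f x)
        - ((x i - b i) * (∑ k, (sd k g x * sd i (sd k f) x + sd i (sd k g) x * sd k f x))
          + ∑ k, sd k g x * sd k f x) := fun i => by
    unfold pohozaev
    rw [sd_sub i (C1.diff (((hfs i).mul (dil_smooth hg b)).add ((hgs i).mul (dil_smooth hf b))) x)
        (C1.diff ((coordSub_smooth _ i).mul (contDiff_grad_mul_grad hf hg)) x),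
      sd_add i (C1.diff ((hfs i).mul (dil_smooth hg b)) x)
        (C1.diff ((hgs i).mul (dil_smooth hf b)) x),
      sd_mul i (C1.diff (hfs i) x) (C1.diff (dil_smooth hg b) x),
      sd_mul i (C1.diff (hgs i) x) (C1.diff (dil_smooth hf b) x),
      sd_mul i (C1.diff (coordSub_smooth _ i) x) (C1.diff (contDiff_grad_mul_grad hf hg) x),
      sd_dil hf, sd_dil hg, sd_sub_const, sd_coord,
      sd_sum i fun k => C1.diff ((hgs k).mul (hfs k)) x]
    simp only [sd_mul i (C1.diff (hgs _) x) (C1.diff (hfs _) x), if_true, one_mul]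
  simp only [divE, e1, lap]
  simp only [Fin.sum_univ_three]
  ring

theorem wt_mul_coordSub_bdd (b : Fin 3 → ℝ) :
    ∃ C, 0 ≤ C ∧ ∀ (k : Fin 3) (x : E3), |(x k - b k) * wt x| ≤ C := by
  refine ⟨1 + ∑ k, |b k|, by positivity, fun k x => ?_⟩
  have h1 : |x k| ≤ ‖x‖ := PiLp.norm_apply_le x k
  have h2 : |b k| ≤ ∑ k, |b k| :=
    Finset.single_le_sum (f := fun k => |b k|) (fun k _ => abs_nonneg _) (Finset.mem_univ k)
  have h3 : |b k| * wt x ≤ |b k| := mul_le_of_le_one_right (abs_nonneg _) (wt_le_one x)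
  have h4 := mul_le_mul_of_nonneg_right h1 (wt_nonneg x)
  have h5 := mul_le_mul_of_nonneg_right (abs_sub (x k) (b k)) (wt_nonneg x)
  rw [abs_mul, abs_of_pos (wt_pos x)]
  linarith [norm_mul_wt_le x]

/-- The factor x - b is compensated by the weight, leaving products of two L² gradients. -/
theorem integrable_pohozaev_wt {f g : E3 → ℝ} (hf : ContDiff ℝ 1 f) (hg : ContDiff ℝ 1 g)
    (hf2 : SqGrad f) (hg2 : SqGrad g) (b : Fin 3 → ℝ) (i : Fin 3) :
    Integrable fun x => pohozaev b f g x i * wt x := by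
  obtain ⟨C, -, hC⟩ := wt_mul_coordSub_bdd b
  have cd : ∀ k, Continuous fun x : E3 => (x k - b k) * wt x := fun k =>
    (coordSub_smooth (n := 1) _ k).continuous.mul continuous_wt
  have i1 : ∀ k l m, Integrable fun x => ((x k - b k) * wt x) * (sd l f x * sd m g x) :=
    fun k l m => integrable_bdd_mul (cd k) (hC k) (integrable_mul_of_sq (continuous_sd hf l)
      (continuous_sd hg m) (hf2 l) (hg2 m))
  have i2 : Integrable fun x => (∑ k, ((x k - b k) * wt x) * (sd i f x * sd k g x))
      + (∑ k, ((x k - b k) * wt x) * (sd k f x * sd i g x))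
      - ∑ k, ((x i - b i) * wt x) * (sd k f x * sd k g x) :=
    ((integrable_finsetSum _ fun k _ => i1 k i k).add
      (integrable_finsetSum _ fun k _ => i1 k k i)).sub (integrable_finsetSum _ fun k _ => i1 i k k)
  refine i2.congr (Eventually.of_forall fun x => ?_)
  simp only [pohozaev, dil, Fin.sum_univ_three]
  ring

namespace SliceData

variable (s : SliceData)

/-- The dilation current of the shift. -/
def shiftDilFlux (b : Fin 3 → ℝ) (x : E3) (i : Fin 3) : ℝ :=
  (∑ k, s.psi x ^ 6 * s.curv x k i * dil b (fun y => s.shift y k) x)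
    - (x i - b i) * (1 / 2 * (s.lapse x * s.psi x ^ 6 * s.curvSq x))

/-- The work done by the matter under the dilation `x - b`. -/
def dilWork (b : Fin 3 → ℝ) (x : E3) : ℝ :=
  s.psi x ^ 6 * (-(s.rho x * dil b s.lapse x)
    + (∑ k, s.mom x k * (dil b (fun y => s.shift y k) x - s.shift x k))
    + 2 * s.lapse x * s.trace x * dil b s.psi x / s.psi x + s.lapse x * s.trace x)

variable {s}

namespace IsSolution

variable (h : s.IsSolution)
include h

theorem lapse_curvSq_smooth : ContDiff ℝ 1 fun x => s.lapse x * s.psi x ^ 6 * s.curvSq x :=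
  (h.lapse1.mul (h.psi1.pow 6)).mul h.curvSq_smooth

theorem shiftDilFlux_smooth (b : Fin 3 → ℝ) : ContDiff ℝ 1 (s.shiftDilFlux b) :=
  contDiff_pi.2 fun i => (ContDiff.sum fun k _ => (h.densitized_smooth k i).mul
    (dil_smooth (h.shift_smooth k) b)).sub
      ((coordSub_smooth _ i).mul (contDiff_const.mul h.lapse_curvSq_smooth))

/-- Differentiates the relation for the product 2αK̂, which avoids derivatives of 1/α. -/
theorem sd_lapse_curv (l i j : Fin 3) (x : E3) :
    2 * (s.lapse x * sd l (fun y => s.curv y i j) x + sd l s.lapse x * s.curv x i j)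
      = sd l (sd i fun y => s.shift y j) x + sd l (sd j fun y => s.shift y i) x
        - 2 / 3 * (if i = j then 1 else 0) * ∑ k, sd l (sd k fun y => s.shift y k) x := by
  have hs := fun i j => C1.diff (contDiff_sd (h.shift_smooth j) i) x
  have hL : sd l (fun y => 2 * (s.lapse y * s.curv y i j)) x
      = 2 * (s.lapse x * sd l (fun y => s.curv y i j) x + sd l s.lapse x * s.curv x i j) := by
    rw [sd_const_mul l 2 (C1.diff (h.lapse1.mul (h.curv_smooth i j)) x),
      sd_mul l (C1.diff h.lapse1 x) (C1.diff (h.curv_smooth i j) x)]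
  rw [← hL]
  have hR : (fun y => 2 * (s.lapse y * s.curv y i j)) = fun y =>
      (sd i (fun z => s.shift z j) y + sd j (fun z => s.shift z i) y)
        - (2 / 3 * (if i = j then 1 else 0)) * ∑ k, sd k (fun z => s.shift z k) y := by
    funext y
    rw [← h.curv_eq, mul_assoc]
  rw [hR, sd_sub l ((hs i j).fun_add (hs j i))
    ((DifferentiableAt.fun_sum fun k _ => hs k k).const_mul _), sd_add l (hs i j) (hs j i),
    sd_const_mul l _ (DifferentiableAt.fun_sum fun k _ => hs k k), sd_sum l fun k => hs k k]

theorem sd_curvSq (l : Fin 3) (x : E3) : sd l s.curvSq x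
    = 2 * ∑ i, ∑ j, s.curv x i j * sd l (fun y => s.curv y i j) x := by
  have h1 : s.curvSq = fun y => ∑ i, ∑ j, s.curv y i j ^ 2 := by
    funext y
    simp only [curvSq, pow_two]
    exact Finset.sum_congr rfl fun i _ => Finset.sum_congr rfl fun j _ => by
      rw [h.curv_symm y j i]
  rw [h1, sd_sum l fun i => C1.diff (ContDiff.sum fun j _ => (h.curv_smooth i j).pow 2) x,
    Finset.mul_sum]
  refine Finset.sum_congr rfl fun i _ => ?_
  rw [sd_sum l fun j => C1.diff ((h.curv_smooth i j).pow 2) x, Finset.mul_sum]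
  refine Finset.sum_congr rfl fun j _ => ?_
  rw [sd_pow l 2 (C1.diff (h.curv_smooth i j) x)]
  norm_num
  ring

/-- The differentiated companion of `sum_curv_mul_sd_shift`: the trace again drops out, and
2K̂·∂_l(αK̂) = α ∂_l(K̂²) + 2 ∂_lα K̂². -/
theorem sum_curv_mul_sd_sd_shift (l : Fin 3) (x : E3) :
    2 * ∑ k, ∑ i, s.curv x k i * sd l (sd i fun y => s.shift y k) x
      = s.lapse x * sd l s.curvSq x + 2 * sd l s.lapse x * s.curvSq x := by
  have h1 : ∑ i, ∑ j, s.curv x i j * (2 * (s.lapse x * sd l (fun y => s.curv y i j) x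
      + sd l s.lapse x * s.curv x i j))
      = s.lapse x * sd l s.curvSq x + 2 * sd l s.lapse x * s.curvSq x := by
    rw [h.sd_curvSq]
    simp only [curvSq, Finset.mul_sum, ← Finset.sum_add_distrib]
    refine Finset.sum_congr rfl fun i _ => Finset.sum_congr rfl fun j _ => ?_
    rw [h.curv_symm x j i]
    ring
  have h2 := h.curv_trace x
  rw [← h1]
  simp only [h.sd_lapse_curv]
  simp only [Fin.sum_univ_three] at h2 ⊢
  simp only [h.curv_symm x 1 0, h.curv_symm x 2 0, h.curv_symm x 2 1]
  simp
  linear_combination 2 / 3 * (sd l (sd 0 fun y => s.shift y 0) x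
    + sd l (sd 1 fun y => s.shift y 1) x + sd l (sd 2 fun y => s.shift y 2) x) * h2

theorem sd_lapse_curvSq (l : Fin 3) (x : E3) :
    sd l (fun y => s.lapse y * s.psi y ^ 6 * s.curvSq y) x
      = s.lapse x * s.psi x ^ 6 * sd l s.curvSq x
        + (s.lapse x * (6 * s.psi x ^ 5 * sd l s.psi x) + sd l s.lapse x * s.psi x ^ 6)
          * s.curvSq x := by
  rw [sd_mul l (C1.diff (h.lapse1.mul (h.psi1.pow 6)) x) (C1.diff h.curvSq_smooth x),
    sd_mul l (C1.diff h.lapse1 x) (C1.diff (h.psi1.pow 6) x), sd_pow l 6 (C1.diff h.psi1 x)]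
  norm_num

/-- The Noether identity for dilations with Lagrangian ½αψ⁶K̂²: second derivatives of β cancel
against the derivative of K̂², leaving a matter term by the momentum constraint, a scaling term with
coefficient 1 - 3/2 = -1/2, and the explicit dependence on ψ and α. -/
theorem divE_shiftDilFlux (b : Fin 3 → ℝ) (x : E3) : divE (s.shiftDilFlux b) x
    = (∑ k, 8 * Real.pi * s.mom x k * s.psi x ^ 6 * dil b (fun y => s.shift y k) x)
      - 1 / 2 * (s.lapse x * s.psi x ^ 6 * s.curvSq x)
      - s.psi x ^ 5 * s.curvSq x
        * (3 * s.lapse x * dil b s.psi x - 1 / 2 * s.psi x * dil b s.lapse x) := by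
  have e1 : ∀ i, sd i (fun y => s.shiftDilFlux b y i) x
      = (∑ k, (s.psi x ^ 6 * s.curv x k i * (sd i (fun y => s.shift y k) x
            + ∑ l, (x l - b l) * sd l (sd i fun y => s.shift y k) x)
          + sd i (fun y => s.psi y ^ 6 * s.curv y k i) x * dil b (fun y => s.shift y k) x))
        - ((x i - b i) * (1 / 2 * sd i (fun y => s.lapse y * s.psi y ^ 6 * s.curvSq y) x)
          + 1 / 2 * (s.lapse x * s.psi x ^ 6 * s.curvSq x)) := fun i => by
    have hd := fun k => (h.densitized_smooth k i).mul (dil_smooth (h.shift_smooth k) b)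
    unfold shiftDilFlux
    rw [sd_sub i (C1.diff (ContDiff.sum fun k _ => hd k) x)
        (C1.diff ((coordSub_smooth _ i).mul (contDiff_const.mul h.lapse_curvSq_smooth)) x),
      sd_sum i fun k => C1.diff (hd k) x,
      sd_mul i (C1.diff (coordSub_smooth _ i) x)
        (C1.diff (contDiff_const.mul h.lapse_curvSq_smooth) x),
      sd_const_mul i _ (C1.diff h.lapse_curvSq_smooth x), sd_sub_const, sd_coord]
    congr 1
    · refine Finset.sum_congr rfl fun k _ => ?_
      rw [sd_mul i (C1.diff (h.densitized_smooth k i) x)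
        (C1.diff (dil_smooth (h.shift_smooth k) b) x), sd_dil (h.shift_smooth k)]
    · simp
  have e2 : ∑ i, ∑ k, sd i (fun y => s.psi y ^ 6 * s.curv y k i) x * dil b (fun y => s.shift y k) x
      = ∑ k, 8 * Real.pi * s.mom x k * s.psi x ^ 6 * dil b (fun y => s.shift y k) x := by
    rw [Finset.sum_comm]
    simp only [← Finset.sum_mul, h.momentum]
  have e3 : ∑ i, ∑ k, s.psi x ^ 6 * s.curv x k i * sd i (fun y => s.shift y k) x
      = s.psi x ^ 6 * (s.lapse x * s.curvSq x) := by
    rw [Finset.sum_comm, ← h.sum_curv_mul_sd_shift]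
    simp only [Finset.mul_sum, mul_assoc]
  have e4 : ∑ i, ∑ k, s.psi x ^ 6 * s.curv x k i
        * ∑ l, (x l - b l) * sd l (sd i fun y => s.shift y k) x
      = 1 / 2 * s.psi x ^ 6 * ∑ l, (x l - b l) *
        (s.lapse x * sd l s.curvSq x + 2 * sd l s.lapse x * s.curvSq x) := by
    simp only [← h.sum_curv_mul_sd_sd_shift]
    simp only [Fin.sum_univ_three]
    ring
  have e5 : ∑ i, ((x i - b i) * (1 / 2 * sd i (fun y => s.lapse y * s.psi y ^ 6 * s.curvSq y) x)
        + 1 / 2 * (s.lapse x * s.psi x ^ 6 * s.curvSq x))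
      = 1 / 2 * (∑ i, (x i - b i) * (s.lapse x * s.psi x ^ 6 * sd i s.curvSq x
        + (s.lapse x * (6 * s.psi x ^ 5 * sd i s.psi x) + sd i s.lapse x * s.psi x ^ 6)
          * s.curvSq x)) + 3 / 2 * (s.lapse x * s.psi x ^ 6 * s.curvSq x) := by
    simp only [h.sd_lapse_curvSq]
    simp only [Fin.sum_univ_three]
    ring
  simp only [divE, e1, Finset.sum_sub_distrib, Finset.sum_add_distrib, mul_add] at e2 e3 e4 e5 ⊢
  rw [e2, e3, e4, e5]
  simp only [dil, Fin.sum_univ_three]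
  ring

theorem dil_chi (b : Fin 3 → ℝ) (x : E3) :
    dil b s.chi x = s.lapse x * dil b s.psi x + dil b s.lapse x * s.psi x := by
  have : ∀ k, sd k s.chi x = s.lapse x * sd k s.psi x + sd k s.lapse x * s.psi x := fun k =>
    sd_mul k (C1.diff h.lapse1 x) (C1.diff h.psi1 x)
  simp only [dil, this, Fin.sum_univ_three]
  ring

/-- The total current whose divergence is the difference of work and virial densities. -/
theorem dilWork_eq (b : Fin 3 → ℝ) (x : E3) : s.dilWork b x = s.density x
    + (1 / (2 * Real.pi) * divE (pohozaev b s.psi s.chi) x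
      + 1 / (8 * Real.pi) * divE (s.shiftDilFlux b) x
      + 1 / (16 * Real.pi) * divE s.shiftFlux x) := by
  have hpi := Real.pi_ne_zero
  have hψ := (h.psi_pos x).ne'
  -- The weights make all curvature terms cancel: 1/8π matches those with dilated ψ and α, and 1/16π
  -- removes the scaling term -½αψ⁶K̂². The Pohozaev term -∇χ·∇ψ cancels the gradient term of the
  -- density.
  rw [divE_pohozaev h.psi_smooth h.chi_smooth, h.divE_shiftDilFlux, h.divE_shiftFlux,
    h.hamiltonian, h.slicing, h.dil_chi, density, dilWork, chi]
  simp only [Fin.sum_univ_three]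
  field_simp
  ring

theorem continuous_dilWork (b : Fin 3 → ℝ) : Continuous (s.dilWork b) := by
  have c1 := h.psi_smooth.continuous
  have c2 := h.rho_cont
  have c3 := h.trace_cont
  have c4 := h.lapse_smooth.continuous
  have c5 := continuous_dil h.lapse1 b
  have c6 := continuous_dil h.psi1 b
  have c7 : Continuous fun x =>
      ∑ k, s.mom x k * (dil b (fun y => s.shift y k) x - s.shift x k) :=
    continuous_finsetSum _ fun k _ => (h.mom_cont k).mul
      ((continuous_dil (h.shift1 k) b).sub (h.shift1 k).continuous)
  have c8 : Continuous fun x => 2 * s.lapse x * s.trace x * dil b s.psi x / s.psi x :=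
    (((continuous_const.mul c4).mul c3).mul c6).div c1 fun x => (h.psi_pos x).ne'
  exact (c1.pow 6).mul ((((c2.mul c5).neg.add c7).add c8).add (c4.mul c3))

theorem integrable_dilWork (b : Fin 3 → ℝ) : Integrable (s.dilWork b) :=
  h.integrable_matter (h.continuous_dilWork b) fun x h1 h2 h3 => by simp [dilWork, h1, h2, h3]

/-- After the weight absorbs x - b, the first part is O(r⁻³) times ∂β, known only to be L² by
`sqGrad_shift`; the second is a bounded multiple of K̂². -/
theorem integrable_shiftDilFlux_wt (b : Fin 3 → ℝ) (i : Fin 3) :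
    Integrable fun x => s.shiftDilFlux b x i * wt x := by
  obtain ⟨B, hB0, hB⟩ := wt_mul_coordSub_bdd b
  obtain ⟨M, hM0, hM⟩ := bounded_of_falloff h.psi_falloff
  obtain ⟨N, hN0, hN⟩ := h.asympOne_lapse.bdd
  obtain ⟨C, hC0, hC⟩ := h.curv_falloff
  have cd : ∀ k, Continuous fun x : E3 => (x k - b k) * wt x := fun k =>
    (coordSub_smooth (n := 1) _ k).continuous.mul continuous_wt
  have cs := fun l k => continuous_sd (h.shift1 k) l
  have c1 := h.psi_smooth.continuous
  have c2 := h.lapse_smooth.continuous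
  have ck := fun i j => (h.curv_smooth i j).continuous
  have i1 : ∀ k l, Integrable fun x => (s.psi x ^ 6 * s.curv x k i) *
      (((x l - b l) * wt x) * sd l (fun y => s.shift y k) x) := fun k l => by
    refine integrable_of_le_wt_mul (C := M ^ 6 * C * B) (n := 3)
      (((c1.pow 6).mul (ck k i)).mul ((cd l).mul (cs l k))) (cs l k) (by norm_num)
      (h.sqGrad_shift k l) fun x => ?_
    rw [abs_mul, abs_mul, abs_pow, abs_mul ((x l - b l) * wt x)]
    have e1 := pow_le_pow_left₀ (abs_nonneg _) (hM x) 6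
    have e2 := hC k i x
    have e3 := hB l x
    have w0 := wt_nonneg x
    calc _ ≤ (M ^ 6 * (C * wt x ^ 3)) * (B * |sd l (fun y => s.shift y k) x|) := by gcongr
      _ = _ := by ring
  have i2 : Integrable fun x => (1 / 2 * ((x i - b i) * wt x) * (s.lapse x * s.psi x ^ 6))
      * s.curvSq x := by
    refine integrable_bdd_mul (C := 1 / 2 * B * (N * M ^ 6))
      ((continuous_const.mul (cd i)).mul (c2.mul (c1.pow 6))) (fun x => ?_) h.integrable_curvSq
    rw [abs_mul, abs_mul, abs_mul (s.lapse x), abs_pow, abs_of_pos (by norm_num : (0 : ℝ) < 1 / 2)]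
    have e1 := pow_le_pow_left₀ (abs_nonneg _) (hM x) 6
    have e2 := hN x
    have e3 := hB i x
    gcongr
  have i3 := (integrable_finsetSum Finset.univ fun k _ =>
    integrable_finsetSum Finset.univ fun l _ => i1 k l).sub i2
  refine i3.congr (Eventually.of_forall fun x => ?_)
  simp only [Pi.sub_apply, shiftDilFlux, dil, Fin.sum_univ_three]
  ring

/-- The work of the matter under any dilation is the virial integral. -/
theorem integral_dilWork (b : Fin 3 → ℝ) : ∫ x, s.dilWork b x = ∫ x, s.density x := by
  have hP := pohozaev_smooth h.psi_smooth h.chi_smooth b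
  have hQ := h.shiftDilFlux_smooth b
  have hS := h.shiftFlux_smooth
  set W : E3 → Fin 3 → ℝ := fun x i => 1 / (2 * Real.pi) * pohozaev b s.psi s.chi x i
    + 1 / (8 * Real.pi) * s.shiftDilFlux b x i + 1 / (16 * Real.pi) * s.shiftFlux x i with hWdef
  have hPi := fun i => contDiff_const (c := 1 / (2 * Real.pi)).mul (contDiff_pi.1 hP i)
  have hQi := fun i => contDiff_const (c := 1 / (8 * Real.pi)).mul (contDiff_pi.1 hQ i)
  have hSi := fun i => contDiff_const (c := 1 / (16 * Real.pi)).mul (contDiff_pi.1 hS i)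
  have hW : ContDiff ℝ 1 W := contDiff_pi.2 fun i => ((hPi i).add (hQi i)).add (hSi i)
  have hdiv : ∀ x, divE W x = s.dilWork b x - s.density x := fun x => by
    rw [h.dilWork_eq]
    simp only [divE, hWdef]
    simp only [sd_add _ (C1.diff ((hPi _).add (hQi _)) x) (C1.diff (hSi _) x),
      sd_add _ (C1.diff (hPi _) x) (C1.diff (hQi _) x),
      sd_const_mul _ _ (C1.diff (contDiff_pi.1 hP _) x),
      sd_const_mul _ _ (C1.diff (contDiff_pi.1 hQ _) x),
      sd_const_mul _ _ (C1.diff (contDiff_pi.1 hS _) x), Finset.sum_add_distrib, ← Finset.mul_sum]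
    ring
  have hint := (h.integrable_dilWork b).sub h.integrable_density
  have h0 := integral_divE_eq_zero hW (hint.congr (Eventually.of_forall fun x => (hdiv x).symm))
    fun i => by
      refine ((((integrable_pohozaev_wt h.psi1 h.chi1 h.asympOne_psi.grad h.asympOne_chi.grad b
        i).const_mul (1 / (2 * Real.pi))).add
        ((h.integrable_shiftDilFlux_wt b i).const_mul (1 / (8 * Real.pi)))).add
        ((h.integrable_shiftFlux_wt i).const_mul (1 / (16 * Real.pi)))).congr
        (Eventually.of_forall fun x => ?_)
      simp only [Pi.add_apply, hWdef]
      ring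
  simp only [hdiv] at h0
  rwa [integral_sub (h.integrable_dilWork b) h.integrable_density, sub_eq_zero] at h0

end IsSolution

end SliceData

/-! ### Slices of a spacetime -/

theorem pd_succ {f : Spacetime → ℝ} {t : ℝ} {x : E3} (hf : DifferentiableAt ℝ f (t, x))
    (i : Fin 3) : pd i.succ f (t, x) = sd i (fun y => f (t, y)) x := by
  have h1 : HasFDerivAt (fun y : E3 => (t, y)) (ContinuousLinearMap.inr ℝ ℝ E3) x :=
    hasFDerivAt_prodMk_right t x
  have h3 : fderiv ℝ (fun y : E3 => f (t, y)) x = _ := (hf.hasFDerivAt.comp x h1).fderiv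
  rw [sd, h3]
  simp [pd, coordVec]

theorem contDiff_slice {n : WithTop ℕ∞} {f : Spacetime → ℝ} (hf : ContDiff ℝ n f) (t : ℝ) :
    ContDiff ℝ n fun y : E3 => f (t, y) := hf.comp (contDiff_const.prodMk contDiff_id)

theorem pd_smooth {f : Spacetime → ℝ} (hf : ContDiff ℝ 2 f) (μ : Fin 4) : ContDiff ℝ 1 (pd μ f) :=
  (hf.fderiv_right (m := 1) le_rfl).clm_apply contDiff_const

theorem flatLaplacian_eq {f : Spacetime → ℝ} (hf : ContDiff ℝ 2 f) (t : ℝ) (x : E3) :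
    flatLaplacian f (t, x) = lap (fun y => f (t, y)) x := by
  refine Finset.sum_congr rfl fun i _ => ?_
  rw [pd_succ ((pd_smooth hf _).differentiable one_ne_zero _)]
  congr 1
  exact funext fun y => pd_succ (hf.differentiable two_ne_zero _) i

namespace Fields

variable {c : Fields}

/-- The restriction of the fields to a slice of constant time. -/
def slice (c : Fields) (t : ℝ) : SliceData where
  lapse x := c.lapse (t, x)
  psi x := c.psi (t, x)
  shift x k := c.shift (t, x) k
  curv x i j := c.Khat (t, x) i j
  rho x := c.rhoH (t, x)
  trace x := c.stressTrace (t, x)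
  mom x k := c.mom (t, x) k

section Admissible

variable (hadm : c.IsAdmissible)
include hadm

theorem shift_comp_smooth (k : Fin 3) : ContDiff ℝ 2 fun p => c.shift p k :=
  contDiff_pi.1 hadm.shift_smooth k

theorem Khat_smooth (i j : Fin 3) : ContDiff ℝ 1 fun p => c.Khat p i j := by
  have h1 := fun i k => pd_smooth (shift_comp_smooth hadm k) i
  refine ContDiff.mul (contDiff_const.div
    (contDiff_const.mul (hadm.lapse_smooth.of_le one_le_two))
    fun p => mul_ne_zero two_ne_zero (hadm.lapse_pos p).ne') ?_
  exact ((h1 _ _).add (h1 _ _)).sub (contDiff_const.mul (ContDiff.sum fun k _ => h1 _ _))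

theorem continuous_vel (μ : Fin 4) : Continuous fun p => c.vel p μ :=
  (continuous_apply μ).comp hadm.vel_cont

theorem continuous_velLow (i : Fin 3) : Continuous fun p => c.velLow p i :=
  (hadm.psi_smooth.continuous.pow 4).mul (((shift_comp_smooth hadm i).continuous.mul
    (continuous_vel hadm 0)).add (continuous_vel hadm i.succ))

theorem continuous_mom (i : Fin 3) : Continuous fun p => c.mom p i := by
  simp only [fun p => mom_eq (hadm.lapse_pos p) i]
  exact ((hadm.energy_cont.add hadm.pressure_cont).mul
    (hadm.lapse_smooth.continuous.mul (continuous_vel hadm 0))).mul (continuous_velLow hadm i)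

theorem continuous_rhoH : Continuous c.rhoH := by
  rw [show c.rhoH = _ from funext fun p => rhoH_eq (hadm.lapse_pos p)]
  exact ((hadm.energy_cont.add hadm.pressure_cont).mul
    ((hadm.lapse_smooth.continuous.mul (continuous_vel hadm 0)).pow 2)).sub hadm.pressure_cont

theorem continuous_stressTrace : Continuous c.stressTrace := by
  rw [show c.stressTrace = _ from funext fun p => stressTrace_eq (hadm.psi_pos p)]
  refine Continuous.add (Continuous.div ?_ (hadm.psi_smooth.continuous.pow 4)
    fun p => (pow_pos (hadm.psi_pos p) 4).ne') (continuous_const.mul hadm.pressure_cont)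
  exact (hadm.energy_cont.add hadm.pressure_cont).mul
    (continuous_finsetSum _ fun i _ => (continuous_velLow hadm i).pow 2)

theorem matter_eq_zero {p : Spacetime} (h : c.energy p = 0 ∧ c.pressure p = 0) :
    c.rhoH p = 0 ∧ c.stressTrace p = 0 ∧ ∀ k, c.mom p k = 0 := by
  refine ⟨?_, ?_, fun k => ?_⟩
  · simp [rhoH_eq (hadm.lapse_pos p), h.1, h.2]
  · simp [stressTrace_eq (hadm.psi_pos p), h.1, h.2]
  · simp [mom_eq (hadm.lapse_pos p), h.1, h.2]

theorem slice_isSolution (hmatter : c.HasBoundedMatter) (hfield : c.SolvesFieldEquations)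
    (hfall : c.HasFalloff) (t : ℝ) : (c.slice t).IsSolution where
  lapse_smooth := contDiff_slice hadm.lapse_smooth t
  psi_smooth := contDiff_slice hadm.psi_smooth t
  shift_smooth k := contDiff_slice (shift_comp_smooth hadm k) t
  curv_smooth i j := contDiff_slice (Khat_smooth hadm i j) t
  lapse_pos x := hadm.lapse_pos _
  psi_pos x := hadm.psi_pos _
  curv_eq x i j := by
    have h1 : ∀ i k, sd i (fun y => (c.slice t).shift y k) x
        = pd i.succ (fun q => c.shift q k) (t, x) := fun i k =>
      (pd_succ ((shift_comp_smooth hadm k).differentiable two_ne_zero _) i).symm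
    have h2 := (hadm.lapse_pos (t, x)).ne'
    simp only [h1]
    simp only [slice, Khat]
    field_simp
  rho_cont := (continuous_rhoH hadm).comp (by fun_prop)
  trace_cont := (continuous_stressTrace hadm).comp (by fun_prop)
  mom_cont k := (continuous_mom hadm k).comp (by fun_prop)
  matter_bdd := by
    obtain ⟨R, hR⟩ := hmatter t
    exact ⟨R, fun x hx => matter_eq_zero hadm (hR x hx)⟩
  hamiltonian x := (flatLaplacian_eq hadm.psi_smooth t x).symm.trans (hfield.hamiltonian (t, x))
  momentum x i := by
    rw [show 8 * Real.pi * (c.slice t).mom x i * (c.slice t).psi x ^ 6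
      = 8 * Real.pi * c.mom (t, x) i * c.sqrtGamma (t, x) from rfl, ← hfield.momentum]
    refine Finset.sum_congr rfl fun j _ => Eq.symm (pd_succ ?_ j)
    exact (((hadm.psi_smooth.of_le one_le_two).pow 6).mul
      (Khat_smooth hadm i j)).differentiable one_ne_zero _
  slicing x := (flatLaplacian_eq (hadm.lapse_smooth.mul hadm.psi_smooth) t x).symm.trans
    (hfield.slicing (t, x))
  psi_falloff := by
    obtain ⟨C, -, hC⟩ := exists_le_wt_pow (n := 1) (f := fun x : E3 => c.psi (t, x) - 1)
      ((contDiff_slice hadm.psi_smooth t).continuous.sub continuous_const)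
      (by simpa using hfall.psi t)
    exact ⟨C, fun x => (hC x).trans_eq (by rw [pow_one])⟩
  chi_falloff := by
    obtain ⟨C, -, hC⟩ := exists_le_wt_pow (n := 1) (f := fun x : E3 => c.chi (t, x) - 1)
      ((contDiff_slice (hadm.lapse_smooth.mul hadm.psi_smooth) t).continuous.sub continuous_const)
      (by simpa using hfall.chi t)
    exact ⟨C, fun x => (hC x).trans_eq (by rw [pow_one])⟩
  shift_falloff := by
    have h1 := fun k => exists_le_wt_pow
      (contDiff_slice (shift_comp_smooth hadm k) t).continuous (hfall.shift t k)
    choose C hC0 hC using h1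
    refine ⟨∑ k, C k, Finset.sum_nonneg fun k _ => hC0 k, fun k x => (hC k x).trans ?_⟩
    exact mul_le_mul_of_nonneg_right
      (Finset.single_le_sum (f := C) (fun k _ => hC0 k) (Finset.mem_univ k))
      (pow_nonneg (wt_nonneg x) 2)
  curv_falloff := by
    have h1 := fun z : Fin 3 × Fin 3 => exists_le_wt_pow
      (contDiff_slice (Khat_smooth hadm z.1 z.2) t).continuous (hfall.Khat t z.1 z.2)
    choose C hC0 hC using h1
    refine ⟨∑ z, C z, Finset.sum_nonneg fun z _ => hC0 z, fun i j x => (hC (i, j) x).trans ?_⟩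
    exact mul_le_mul_of_nonneg_right
      (Finset.single_le_sum (f := C) (fun z _ => hC0 z) (Finset.mem_univ (i, j)))
      (pow_nonneg (wt_nonneg x) 3)

theorem virialDensity_eq (t : ℝ) (x : E3) : c.virialDensity (t, x) = (c.slice t).density x := by
  have h1 := lapse_mul_stressTrace (hadm.lapse_pos (t, x)) (hadm.psi_pos (t, x))
    (hadm.vel_future (t, x))
  have h2 : ∀ i : Fin 3, pd i.succ c.chi (t, x) = sd i (c.slice t).chi x := fun i =>
    pd_succ ((hadm.lapse_smooth.mul hadm.psi_smooth).differentiable two_ne_zero _) i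
  have h3 : ∀ i : Fin 3, pd i.succ c.psi (t, x) = sd i (c.slice t).psi x := fun i =>
    pd_succ (hadm.psi_smooth.differentiable two_ne_zero _) i
  simp only [virialDensity, SliceData.density, h2, h3]
  rw [show (c.slice t).lapse x * (c.slice t).trace x = _ from h1]
  simp only [slice, sqrtGamma]
  ring

end Admissible

end Fields

/-! ### The masses -/

namespace Fields

variable {c : Fields} {t : ℝ} (hadm : c.IsAdmissible) (h : (c.slice t).IsSolution)
include hadm h

theorem isChiMass : c.IsChiMass t (1 / (2 * Real.pi) * ∫ x, lap (c.slice t).chi x) := by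
  have h1 := tendsto_flux_mul_grad h.asympOne_psi h.chi_smooth h.asympOne_chi.grad
    h.integrable_lap_chi
  have h2 : ∀ (x : E3) (i : Fin 3), pd i.succ c.chi (t, x) = sd i (c.slice t).chi x := fun x i =>
    pd_succ ((hadm.lapse_smooth.mul hadm.psi_smooth).differentiable two_ne_zero _) i
  simp only [IsChiMass, h2]
  exact h1.const_mul _

theorem isConformalADMMass :
    c.IsConformalADMMass t (-(1 / (2 * Real.pi)) * ∫ x, lap (c.slice t).psi x) := by
  have h1 := tendsto_flux_mul_grad h.asympOne_chi h.psi_smooth h.asympOne_psi.grad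
    h.integrable_lap_psi
  have h3 : ∀ (x : E3) (i : Fin 3), pd i.succ c.psi (t, x) = sd i (c.slice t).psi x := fun x i =>
    pd_succ (hadm.psi_smooth.differentiable two_ne_zero _) i
  simp only [IsConformalADMMass, h3]
  exact h1.const_mul _

theorem isADMMass : c.IsADMMass t (-(1 / (2 * Real.pi)) * ∫ x, lap (c.slice t).psi x) := by
  -- For γ_ij = ψ⁴δ_ij the integrand is (4 - 12)ψ³∂_jψ, so the prefactor is ψ³; `pow 2` denotes the
  -- exponent 2 + 1.
  have h1 := tendsto_flux_mul_grad (h.asympOne_psi.pow 2) h.psi_smooth h.asympOne_psi.grad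
    h.integrable_lap_psi
  have hψ := C1.diff h.psi1
  have h2 : ∀ (x : E3) (i j k : Fin 3), pd i.succ (fun q => c.spatialMetric q j k) (t, x)
      = (if j = k then 1 else 0) * (4 * (c.slice t).psi x ^ 3 * sd i (c.slice t).psi x) := by
    intro x i j k
    have hd : DifferentiableAt ℝ (fun q => c.spatialMetric q j k) (t, x) :=
      (((hadm.psi_smooth.pow 4).mul contDiff_const).differentiable two_ne_zero _)
    rw [pd_succ hd]
    have e1 : (fun y => c.spatialMetric (t, y) j k)
        = fun y => (if j = k then 1 else 0) * (c.slice t).psi y ^ 4 := by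
      funext y
      simp only [spatialMetric, slice]
      ring
    rw [e1, sd_const_mul i _ ((hψ x).fun_pow 4), sd_pow i 4 (hψ x)]
    norm_num
  have h3 : ∀ (x : E3) (j : Fin 3), ∑ k : Fin 3, (pd k.succ (fun q => c.spatialMetric q j k) (t, x)
      - pd j.succ (fun q => c.spatialMetric q k k) (t, x))
      = -8 * ((c.slice t).psi x ^ 3 * sd j (c.slice t).psi x) := by
    intro x j
    simp only [h2, Finset.sum_sub_distrib]
    simp
    ring
  simp only [IsADMMass, h3, flux_const_mul]
  have h4 := h1.const_mul (-(1 / (2 * Real.pi)))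
  refine h4.congr fun r => ?_
  have := Real.pi_ne_zero
  field_simp
  ring

/-- Since α = χ/ψ, ∇α = ψ⁻¹∇χ - αψ⁻¹∇ψ, and both prefactors tend to one. -/
theorem isKomarMass : c.IsKomarMass t (1 / (4 * Real.pi) *
    ((∫ x, lap (c.slice t).chi x) - ∫ x, lap (c.slice t).psi x)) := by
  have hinv := h.asympOne_psi.inv h.psi_pos
  have hm := h.asympOne_lapse.mul hinv
  have h1 := tendsto_flux_mul_grad hinv h.chi_smooth h.asympOne_chi.grad h.integrable_lap_chi
  have h2 := tendsto_flux_mul_grad hm h.psi_smooth h.asympOne_psi.grad h.integrable_lap_psi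
  have h3 : ∀ (x : E3) (j : Fin 3), pd j.succ c.lapse (t, x)
      = ((c.slice t).psi x)⁻¹ * sd j (c.slice t).chi x
        - (c.slice t).lapse x * ((c.slice t).psi x)⁻¹ * sd j (c.slice t).psi x := by
    intro x j
    have e1 : pd j.succ c.lapse (t, x) = sd j (c.slice t).lapse x :=
      pd_succ (hadm.lapse_smooth.differentiable two_ne_zero _) j
    have e2 : sd j (c.slice t).chi x = _ := sd_mul j (C1.diff h.lapse1 x) (C1.diff h.psi1 x)
    have e3 := (h.psi_pos x).ne'
    rw [e1, e2]
    field_simp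
    ring
  simp only [IsKomarMass, h3]
  refine ((h1.sub h2).const_mul _).congr fun r => ?_
  rw [flux_sub]
  · exact continuous_pi fun i => hinv.smooth.continuous.mul (continuous_sd h.chi1 i)
  · exact continuous_pi fun i => hm.smooth.continuous.mul (continuous_sd h.psi1 i)

end Fields

/-! ### The Lie derivative of the metric -/

section SpacetimeCalculus

variable {f g : Spacetime → ℝ} {p : Spacetime} (μ : Fin 4)

theorem pd_add (hf : DifferentiableAt ℝ f p) (hg : DifferentiableAt ℝ g p) :
    pd μ (fun q => f q + g q) p = pd μ f p + pd μ g p := by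
  rw [pd, fderiv_fun_add hf hg]
  rfl

theorem pd_mul (hf : DifferentiableAt ℝ f p) (hg : DifferentiableAt ℝ g p) :
    pd μ (fun q => f q * g q) p = f p * pd μ g p + pd μ f p * g p := by
  rw [pd, fderiv_fun_mul hf hg]
  simp [pd, mul_comm]

theorem pd_neg : pd μ (fun q => -f q) p = -pd μ f p := by
  rw [pd, fderiv_fun_neg]
  rfl

theorem pd_pow (n : ℕ) (hf : DifferentiableAt ℝ f p) :
    pd μ (fun q => f q ^ n) p = n * f p ^ (n - 1) * pd μ f p := by
  rw [pd, fderiv_fun_pow n hf]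
  simp [pd]

theorem pd_sum {F : Fin 3 → Spacetime → ℝ} (hF : ∀ k, DifferentiableAt ℝ (F k) p) :
    pd μ (fun q => ∑ k, F k q) p = ∑ k, pd μ (F k) p := by
  rw [pd, fderiv_fun_sum fun k _ => hF k]
  simp [pd]

theorem pd_mul_const (a : ℝ) (hf : DifferentiableAt ℝ f p) :
    pd μ (fun q => f q * a) p = pd μ f p * a := by
  rw [pd, fderiv_mul_const hf]
  simp [pd, mul_comm]

end SpacetimeCalculus

/-- The derivative along the dilation field `x - b` of the slices. -/
def spacetimeDil (b : Fin 3 → ℝ) (f : Spacetime → ℝ) (p : Spacetime) : ℝ :=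
  ∑ k : Fin 3, (p.2 k - b k) * pd k.succ f p

namespace Fields

variable (c : Fields)

/-- The inverse metric in components. -/
def invMetric (p : Spacetime) : Matrix (Fin 4) (Fin 4) ℝ :=
  fun μ => Fin.cases (motive := fun _ => Fin 4 → ℝ)
    (Fin.cons (-1 / c.lapse p ^ 2) fun j => c.shift p j / c.lapse p ^ 2)
    (fun i => Fin.cons (c.shift p i / c.lapse p ^ 2) fun j =>
      (if i = j then 1 else 0) / c.psi p ^ 4 - c.shift p i * c.shift p j / c.lapse p ^ 2) μ

variable {c}

theorem metric_inv {p : Spacetime} (h : 0 < c.lapse p) (hψ : 0 < c.psi p) :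
    (c.metric p)⁻¹ = c.invMetric p := by
  refine Matrix.inv_eq_right_inv ?_
  ext μ ν
  rw [Matrix.mul_apply, Fin.sum_univ_succ]
  refine Fin.cases ?_ (fun i => ?_) μ <;> refine Fin.cases ?_ (fun j => ?_) ν
  · simp only [metric_zero_zero, metric_zero_succ, invMetric, Fin.cases_zero, Fin.cases_succ,
      Fin.cons_zero, Matrix.one_apply_eq, Fin.sum_univ_three]
    field_simp
    ring
  · rw [Matrix.one_apply_ne (Fin.succ_ne_zero j).symm]
    simp only [metric_zero_zero, metric_zero_succ, invMetric, Fin.cases_zero, Fin.cases_succ,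
      Fin.cons_succ, Fin.sum_univ_three]
    fin_cases j <;> simp <;> field_simp <;> ring
  · rw [Matrix.one_apply_ne (Fin.succ_ne_zero i)]
    simp only [metric_succ_zero, metric_succ_succ, invMetric, Fin.cases_zero, Fin.cases_succ,
      Fin.cons_zero]
    simp
    field_simp
    ring
  · simp only [metric_succ_zero, metric_succ_succ, invMetric, Fin.cases_zero, Fin.cases_succ,
      Fin.cons_succ, Matrix.one_apply, Fin.succ_inj]
    simp
    split_ifs <;> field_simp <;> ring

theorem det_metric (p : Spacetime) :
    (c.metric p).det = -(c.lapse p * c.psi p ^ 6) ^ 2 := by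
  have h1 : c.metric p = Matrix.of ![
      ![-c.lapse p ^ 2 + c.psi p ^ 4 * ∑ i, c.shift p i ^ 2, c.psi p ^ 4 * c.shift p 0,
        c.psi p ^ 4 * c.shift p 1, c.psi p ^ 4 * c.shift p 2],
      ![c.psi p ^ 4 * c.shift p 0, c.psi p ^ 4, 0, 0],
      ![c.psi p ^ 4 * c.shift p 1, 0, c.psi p ^ 4, 0],
      ![c.psi p ^ 4 * c.shift p 2, 0, 0, c.psi p ^ 4]] := by
    ext μ ν
    refine Fin.cases ?_ (fun i => ?_) μ <;> refine Fin.cases ?_ (fun j => ?_) ν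
    · rw [metric_zero_zero]; rfl
    · rw [metric_zero_succ]; fin_cases j <;> rfl
    · rw [metric_succ_zero]; fin_cases i <;> rfl
    · rw [metric_succ_succ]; fin_cases i <;> fin_cases j <;> simp
  rw [h1, Matrix.det_succ_row_zero]
  simp [Fin.sum_univ_succ, Matrix.det_fin_three, Fin.succAbove, Matrix.submatrix]
  ring

theorem sqrtNegDet_eq {p : Spacetime} (h : 0 < c.lapse p) (hψ : 0 < c.psi p) :
    c.sqrtNegDet p = c.lapse p * c.psi p ^ 6 := by
  rw [sqrtNegDet, det_metric, neg_neg, Real.sqrt_sq (by positivity)]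

/-- The contraction of the fluid tensor with a symmetric tensor. -/
theorem sum_stressUp_mul {p : Spacetime} (h : 0 < c.lapse p) (hψ : 0 < c.psi p)
    (L : Fin 4 → Fin 4 → ℝ) (hL : ∀ μ ν, L μ ν = L ν μ) :
    ∑ μ, ∑ ν, c.stressUp p μ ν * L μ ν
      = ((c.energy p + c.pressure p) * c.vel p 0 ^ 2 - c.pressure p / c.lapse p ^ 2) * L 0 0
        + 2 * ∑ i : Fin 3, ((c.energy p + c.pressure p) * c.vel p 0 * c.vel p i.succ
          + c.pressure p * c.shift p i / c.lapse p ^ 2) * L 0 i.succ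
        + ∑ i : Fin 3, ∑ j : Fin 3, ((c.energy p + c.pressure p) * c.vel p i.succ * c.vel p j.succ
          + c.pressure p * ((if i = j then 1 else 0) / c.psi p ^ 4
            - c.shift p i * c.shift p j / c.lapse p ^ 2)) * L i.succ j.succ := by
  have hL0 : ∀ i : Fin 3, L i.succ 0 = L 0 i.succ := fun i => hL _ _
  simp only [stressUp, metric_inv h hψ]
  rw [Fin.sum_univ_succ, Fin.sum_univ_succ]
  simp only [Fin.sum_univ_succ (n := 3), invMetric, Fin.cases_zero, Fin.cases_succ,
    Fin.cons_zero, Fin.cons_succ, hL0]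
  simp only [Fin.sum_univ_three]
  ring

/-- The rate of work of the matter against a dilation `x - b` of the slices. -/
def dilWork (c : Fields) (b : Fin 3 → ℝ) (p : Spacetime) : ℝ :=
  c.psi p ^ 6 * (-(c.rhoH p * spacetimeDil b c.lapse p)
    + (∑ k, c.mom p k * (spacetimeDil b (fun q => c.shift q k) p - c.shift p k))
    + 2 * c.lapse p * c.stressTrace p * spacetimeDil b c.psi p / c.psi p
    + c.lapse p * c.stressTrace p)

/-- The component `√γ j_k (x - b)^k` of the momentum density along the dilation field. -/
def dilMomentum (c : Fields) (b : Fin 3 → ℝ) (p : Spacetime) : ℝ :=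
  c.psi p ^ 6 * ∑ k, c.mom p k * (p.2 k - b k)

theorem lieMetric_symm (ξ : Spacetime → Fin 4 → ℝ) (p : Spacetime) (μ ν : Fin 4) :
    c.lieMetric ξ p μ ν = c.lieMetric ξ p ν μ := by
  have h : ∀ q μ ν, c.metric q μ ν = c.metric q ν μ := fun q μ ν => by
    refine Fin.cases ?_ (fun i => ?_) μ <;> refine Fin.cases ?_ (fun j => ?_) ν
    · rfl
    · rw [metric_zero_succ, metric_succ_zero]
    · rw [metric_zero_succ, metric_succ_zero]
    · rw [metric_succ_succ, metric_succ_succ]; simp only [eq_comm]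
  refine Finset.sum_congr rfl fun l _ => ?_
  simp only [h _ μ ν, h p l ν, h p μ l]
  ring

section DilationField

variable (hadm : c.IsAdmissible) {ξ : Spacetime → Fin 4 → ℝ} {p : Spacetime} {b : Fin 3 → ℝ}
  {θ θ' : ℝ} (h0 : ξ p 0 = 0) (hs : ∀ i : Fin 3, ξ p i.succ = θ * (p.2 i - b i))
  (d0 : ∀ μ, pd μ (fun q => ξ q 0) p = 0)
  (dt : ∀ i : Fin 3, pd 0 (fun q => ξ q i.succ) p = θ' * (p.2 i - b i))
  (ds : ∀ i k : Fin 3, pd k.succ (fun q => ξ q i.succ) p = if i = k then θ else 0)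

-- The hypotheses of this section fix ξ only to first order at the single point p, where it agrees
-- with θ(t)(x - b). A field equal to this one merely near p therefore qualifies.
include h0 hs in
theorem sum_field_mul_pd (f : Spacetime → ℝ) :
    ∑ l, ξ p l * pd l f p = θ * spacetimeDil b f p := by
  rw [Fin.sum_univ_succ, h0, zero_mul, zero_add, spacetimeDil, Finset.mul_sum]
  exact Finset.sum_congr rfl fun k _ => by rw [hs]; ring

include hadm h0 hs d0 dt in
theorem lieMetric_zero_zero : c.lieMetric ξ p 0 0
    = θ * (-(2 * c.lapse p * spacetimeDil b c.lapse p)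
      + 4 * c.psi p ^ 3 * spacetimeDil b c.psi p * (∑ i, c.shift p i ^ 2)
      + c.psi p ^ 4 * (2 * ∑ i, c.shift p i * spacetimeDil b (fun q => c.shift q i) p))
      + 2 * θ' * c.psi p ^ 4 * ∑ i, c.shift p i * (p.2 i - b i) := by
  have da := hadm.lapse_smooth.differentiable two_ne_zero p
  have dp := hadm.psi_smooth.differentiable two_ne_zero p
  have db := fun i => (shift_comp_smooth hadm i).differentiable two_ne_zero p
  have e1 : ∀ l, pd l (fun q => c.metric q 0 0) p = -(2 * c.lapse p * pd l c.lapse p)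
      + (c.psi p ^ 4 * (∑ i, 2 * c.shift p i * pd l (fun q => c.shift q i) p)
        + 4 * c.psi p ^ 3 * pd l c.psi p * ∑ i, c.shift p i ^ 2) := fun l => by
    simp only [metric_zero_zero]
    rw [pd_add l (da.fun_pow 2).fun_neg
      ((dp.fun_pow 4).fun_mul (DifferentiableAt.fun_sum fun i _ => (db i).fun_pow 2)), pd_neg,
      pd_mul l (dp.fun_pow 4) (DifferentiableAt.fun_sum fun i _ => (db i).fun_pow 2),
      pd_pow l 2 da, pd_pow l 4 dp, pd_sum l fun i => (db i).fun_pow 2]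
    simp only [pd_pow l 2 (db _)]
    norm_num
  have e2 : spacetimeDil b (fun q => c.metric q 0 0) p
      = -(2 * c.lapse p * spacetimeDil b c.lapse p)
      + 4 * c.psi p ^ 3 * spacetimeDil b c.psi p * (∑ i, c.shift p i ^ 2)
      + c.psi p ^ 4 * (2 * ∑ i, c.shift p i * spacetimeDil b (fun q => c.shift q i) p) := by
    simp only [spacetimeDil, e1, Fin.sum_univ_three]
    ring
  simp only [lieMetric, Finset.sum_add_distrib, sum_field_mul_pd h0 hs, e2]
  simp only [Fin.sum_univ_succ (n := 3)]
  simp only [d0, dt, metric_zero_succ, metric_succ_zero, Fin.sum_univ_three]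
  ring

include hadm h0 hs d0 dt ds in
theorem lieMetric_zero_succ (i : Fin 3) : c.lieMetric ξ p 0 i.succ
    = θ * (4 * c.psi p ^ 3 * spacetimeDil b c.psi p * c.shift p i
      + c.psi p ^ 4 * spacetimeDil b (fun q => c.shift q i) p + c.psi p ^ 4 * c.shift p i)
      + θ' * c.psi p ^ 4 * (p.2 i - b i) := by
  have dp := hadm.psi_smooth.differentiable two_ne_zero p
  have db := fun i => (shift_comp_smooth hadm i).differentiable two_ne_zero p
  have e1 : ∀ l, pd l (fun q => c.metric q 0 i.succ) p
      = c.psi p ^ 4 * pd l (fun q => c.shift q i) p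
        + 4 * c.psi p ^ 3 * pd l c.psi p * c.shift p i := fun l => by
    simp only [metric_zero_succ]
    rw [pd_mul l (dp.fun_pow 4) (db i), pd_pow l 4 dp]
    norm_num
  have e2 : spacetimeDil b (fun q => c.metric q 0 i.succ) p
      = 4 * c.psi p ^ 3 * spacetimeDil b c.psi p * c.shift p i
      + c.psi p ^ 4 * spacetimeDil b (fun q => c.shift q i) p := by
    simp only [spacetimeDil, e1, Fin.sum_univ_three]
    ring
  simp only [lieMetric, Finset.sum_add_distrib, sum_field_mul_pd h0 hs, e2]
  simp only [Fin.sum_univ_succ (n := 3)]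
  simp only [d0, dt, ds, metric_zero_succ, metric_succ_succ]
  simp
  ring

include hadm h0 hs d0 ds in
theorem lieMetric_succ_succ (i j : Fin 3) : c.lieMetric ξ p i.succ j.succ
    = θ * (4 * c.psi p ^ 3 * spacetimeDil b c.psi p + 2 * c.psi p ^ 4)
      * (if i = j then 1 else 0) := by
  have dp := hadm.psi_smooth.differentiable two_ne_zero p
  have e1 : ∀ l, pd l (fun q => c.metric q i.succ j.succ) p
      = 4 * c.psi p ^ 3 * pd l c.psi p * (if i = j then 1 else 0) := fun l => by
    simp only [metric_succ_succ]
    rw [pd_mul_const l _ (dp.fun_pow 4), pd_pow l 4 dp]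
    norm_num
  have e2 : spacetimeDil b (fun q => c.metric q i.succ j.succ) p
      = 4 * c.psi p ^ 3 * spacetimeDil b c.psi p * (if i = j then 1 else 0) := by
    simp only [spacetimeDil, e1, Fin.sum_univ_three]
    ring
  simp only [lieMetric, Finset.sum_add_distrib, sum_field_mul_pd h0 hs, e2]
  simp only [Fin.sum_univ_succ (n := 3)]
  simp only [d0, ds, metric_succ_succ]
  by_cases hij : i = j
  · subst hij
    simp
    ring
  · simp [hij]

include hadm h0 hs d0 dt ds in
/-- The integrand of the weak Euler equation for a time-dependent multiple of the dilation. -/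
theorem euler_integrand :
    1 / 2 * (∑ μ, ∑ ν, c.stressUp p μ ν * c.lieMetric ξ p μ ν) * c.sqrtNegDet p
      = θ * c.dilWork b p + θ' * c.dilMomentum b p := by
  have ha := hadm.lapse_pos p
  have hψ := hadm.psi_pos p
  rw [sum_stressUp_mul ha hψ _ (c.lieMetric_symm ξ p), sqrtNegDet_eq ha hψ, dilWork, dilMomentum,
    lieMetric_zero_zero hadm h0 hs d0 dt, rhoH_eq ha, stressTrace_eq hψ]
  simp only [lieMetric_zero_succ hadm h0 hs d0 dt ds, lieMetric_succ_succ hadm h0 hs d0 ds,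
    mom_eq ha, velLow]
  simp only [Fin.sum_univ_three]
  simp
  field_simp
  ring

end DilationField

end Fields

/-! ### Helical symmetry -/

/-- The point of the rotation axis in the plane `x³ = 0`. -/
def axisPoint (b : ℝ) : Fin 3 → ℝ := ![b, 0, 0]

/-- The rotation about the third axis, with components `R_ij`. -/
def rot (a : ℝ) : Fin 3 → Fin 3 → ℝ :=
  ![![Real.cos a, -Real.sin a, 0], ![Real.sin a, Real.cos a, 0], ![0, 0, 1]]

theorem rot_inner (a : ℝ) (u v : Fin 3 → ℝ) :
    ∑ i, (∑ j, rot a i j * u j) * (∑ j, rot a i j * v j) = ∑ i, u i * v i := by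
  have := Real.sin_sq_add_cos_sq a
  simp only [rot, Fin.sum_univ_three, Matrix.cons_val]
  linear_combination (u 0 * v 0 + u 1 * v 1) * this

theorem rot_transpose_inner (a : ℝ) (u v : Fin 3 → ℝ) :
    ∑ i, (∑ j, rot a j i * u j) * (∑ j, rot a j i * v j) = ∑ i, u i * v i := by
  have := Real.sin_sq_add_cos_sq a
  simp only [rot, Fin.sum_univ_three, Matrix.cons_val]
  linear_combination (u 0 * v 0 + u 1 * v 1) * this

/-- The rotation about the third axis as a linear isometry. -/
def rotE (a : ℝ) : E3 ≃ₗᵢ[ℝ] E3 where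
  toFun x := WithLp.toLp 2 fun i => ∑ j, rot a i j * x j
  invFun x := WithLp.toLp 2 fun i => ∑ j, rot a j i * x j
  map_add' x y := by
    ext i
    simp [mul_add, Finset.sum_add_distrib]
  map_smul' r x := by
    ext i
    simp [Finset.mul_sum, mul_left_comm]
  left_inv x := by
    have := Real.sin_sq_add_cos_sq a
    ext i
    simp only [rot, Fin.sum_univ_three]
    fin_cases i
    · simp
      linear_combination x 0 * this
    · simp
      linear_combination x 1 * this
    · simp
  right_inv x := by
    have := Real.sin_sq_add_cos_sq a
    ext i
    simp only [rot, Fin.sum_univ_three]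
    fin_cases i
    · simp
      linear_combination x 0 * this
    · simp
      linear_combination x 1 * this
    · simp
  norm_map' x := by
    rw [EuclideanSpace.norm_eq, EuclideanSpace.norm_eq]
    congr 1
    simpa [pow_two] using rot_inner a x x

theorem helicalFlow_snd_sub (Ω b s : ℝ) (p : Spacetime) (i : Fin 3) :
    (helicalFlow Ω b s p).2 i - axisPoint b i
      = ∑ j, rot (Ω * s) i j * (p.2 j - axisPoint b j) := by
  simp only [helicalFlow, axisPoint, rot, Fin.sum_univ_three]
  fin_cases i <;> simp
  ring

theorem helicalFlow_snd (Ω b s : ℝ) (p : Spacetime) : (helicalFlow Ω b s p).2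
    = rotE (Ω * s) (p.2 - WithLp.toLp 2 (axisPoint b)) + WithLp.toLp 2 (axisPoint b) := by
  ext i
  have := helicalFlow_snd_sub Ω b s p i
  rw [sub_eq_iff_eq_add] at this
  rw [this]
  rfl

theorem integral_comp_helicalFlow (Ω b s t : ℝ) (F : E3 → ℝ) :
    ∫ x, F (helicalFlow Ω b s (t, x)).2 = ∫ x, F x := by
  simp only [helicalFlow_snd]
  rw [integral_sub_right_eq_self
      (fun x => F (rotE (Ω * s) x + WithLp.toLp 2 (axisPoint b))) (WithLp.toLp 2 (axisPoint b)),
    (rotE (Ω * s)).measurePreserving.integral_comp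
      (rotE (Ω * s)).toHomeomorph.measurableEmbedding
      (fun x => F (x + WithLp.toLp 2 (axisPoint b))),
    integral_add_right_eq_self]

theorem norm_helicalFlow_snd (Ω b s : ℝ) (p : Spacetime) :
    ‖p.2‖ - 2 * ‖(WithLp.toLp 2 (axisPoint b) : E3)‖ ≤ ‖(helicalFlow Ω b s p).2‖ := by
  set e : E3 := WithLp.toLp 2 (axisPoint b)
  have h1 : ‖(helicalFlow Ω b s p).2 - e‖ = ‖p.2 - e‖ := by
    rw [helicalFlow_snd, add_sub_cancel_right, LinearIsometryEquiv.norm_map]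
  have h2 := norm_sub_norm_le p.2 e
  have h3 := norm_sub_le (helicalFlow Ω b s p).2 e
  linarith

theorem pd_affine (a : ℝ) (w : Fin 3 → ℝ) (p : Spacetime) (j : Fin 3) :
    pd j.succ (fun q => a + ∑ k, w k * (q.2 k - axisPoint 0 k)) p = w j := by
  -- `axisPoint 0` is the zero vector, so the function is affine with linear part w.
  have h1 : DifferentiableAt ℝ (fun q : Spacetime => a + ∑ k, w k * (q.2 k - axisPoint 0 k)) p := by
    fun_prop
  have h2 := pd_succ (t := p.1) (x := p.2) h1 j
  refine h2.trans ?_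
  have h3 : ∀ k, DifferentiableAt ℝ (fun y : E3 => w k * (y k - axisPoint 0 k)) p.2 := fun k => by
    fun_prop
  rw [sd_add j (differentiableAt_const _) (DifferentiableAt.fun_sum fun k _ => h3 k),
    sd_sum j h3]
  have h4 : ∀ k, sd j (fun y : E3 => w k * (y k - axisPoint 0 k)) p.2
      = w k * if k = j then 1 else 0 := fun k => by
    rw [sd_const_mul j _ (C1.diff (coordSub_smooth _ k) _), sd_sub_const, sd_coord]
  simp only [h4]
  simp [sd]

theorem flowJacobian_succ_succ (Ω b s : ℝ) (p : Spacetime) (i j : Fin 3) :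
    flowJacobian Ω b s p i.succ j.succ = rot (Ω * s) i j := by
  have h : (fun q => coord (helicalFlow Ω b s q) i.succ) = fun q =>
      (axisPoint b i - ∑ k, rot (Ω * s) i k * axisPoint b k)
        + ∑ k, rot (Ω * s) i k * (q.2 k - axisPoint 0 k) := by
    funext q
    have := helicalFlow_snd_sub Ω b s q i
    simp only [coord, Fin.cons_succ, axisPoint, Fin.sum_univ_three, Matrix.cons_val] at this ⊢
    linear_combination this
  rw [flowJacobian, h, pd_affine]

theorem flowJacobian_zero_zero (Ω b s : ℝ) (p : Spacetime) : flowJacobian Ω b s p 0 0 = 1 := by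
  have h : HasFDerivAt (fun q : Spacetime => q.1 + s) (ContinuousLinearMap.fst ℝ ℝ E3) p :=
    hasFDerivAt_fst.add_const s
  rw [flowJacobian, pd, show (fun q => coord (helicalFlow Ω b s q) 0)
    = fun q : Spacetime => q.1 + s from rfl, h.fderiv]
  simp [coordVec]

theorem flowJacobian_zero_succ (Ω b s : ℝ) (p : Spacetime) (j : Fin 3) :
    flowJacobian Ω b s p 0 j.succ = 0 := by
  have h : HasFDerivAt (fun q : Spacetime => q.1 + s) (ContinuousLinearMap.fst ℝ ℝ E3) p :=
    hasFDerivAt_fst.add_const s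
  rw [flowJacobian, pd, show (fun q => coord (helicalFlow Ω b s q) 0)
    = fun q : Spacetime => q.1 + s from rfl, h.fderiv]
  simp [coordVec]

theorem flowJacobian_succ_zero (Ω b s : ℝ) (p : Spacetime) (i : Fin 3) :
    flowJacobian Ω b s p i.succ 0 = 0 := by
  have h : (fun q => coord (helicalFlow Ω b s q) i.succ)
      = (fun x => (helicalFlow Ω b s (0, x)).2 i) ∘ Prod.snd := rfl
  have hd : Differentiable ℝ fun x : E3 => (helicalFlow Ω b s (0, x)).2 i := by
    simp only [helicalFlow]
    fin_cases i <;> simp <;> fun_prop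
  rw [flowJacobian, pd, h,
    fderiv_comp p (hd p.2) differentiableAt_snd, fderiv_snd]
  simp [coordVec]

namespace Fields

variable {c : Fields} {Ω b : ℝ} (hadm : c.IsAdmissible) (hsym : c.IsHelicallySymmetric Ω b)
include hadm hsym

/-- The third axis is fixed by the rotation, so the 33 component of the metric gives the invariance
of ψ⁴. -/
theorem psi_flow (s : ℝ) (p : Spacetime) : c.psi (helicalFlow Ω b s p) = c.psi p := by
  have h := hsym.metric s p (Fin.succ 2) (Fin.succ 2)
  simp only [Fin.sum_univ_succ (n := 3), flowJacobian_succ_succ, flowJacobian_zero_succ,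
    metric_succ_succ] at h
  simp [rot, Fin.sum_univ_three] at h
  exact (pow_left_inj₀ (hadm.psi_pos _).le (hadm.psi_pos _).le (by norm_num)).1 h

theorem shift_flow (s : ℝ) (p : Spacetime) (i : Fin 3) :
    c.shift p i = ∑ k, rot (Ω * s) k i * c.shift (helicalFlow Ω b s p) k := by
  have h := hsym.metric s p 0 i.succ
  have h0 := pow_pos (hadm.psi_pos p) 4
  simp only [Fin.sum_univ_succ (n := 3), flowJacobian_succ_succ, flowJacobian_zero_succ,
    flowJacobian_zero_zero, flowJacobian_succ_zero, metric_zero_succ,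
    psi_flow hadm hsym] at h
  refine mul_left_cancel₀ h0.ne' (h.symm.trans ?_)
  simp only [Fin.sum_univ_three]
  ring

/-- In the component g_00 the square of the shift is already invariant, being rotated isometrically,
which isolates α². -/
theorem lapse_flow (s : ℝ) (p : Spacetime) : c.lapse (helicalFlow Ω b s p) = c.lapse p := by
  have h := hsym.metric s p 0 0
  have h1 := rot_transpose_inner (Ω * s) (c.shift (helicalFlow Ω b s p))
    (c.shift (helicalFlow Ω b s p))
  simp only [← shift_flow hadm hsym] at h1
  simp only [Fin.sum_univ_succ (n := 3), flowJacobian_zero_zero, flowJacobian_succ_zero,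
    metric_zero_zero, psi_flow hadm hsym, mul_zero, Finset.sum_const_zero, add_zero,
    mul_one, pow_two] at h
  refine (pow_left_inj₀ (hadm.lapse_pos _).le (hadm.lapse_pos _).le two_ne_zero).1 ?_
  rw [h1] at h
  nlinarith

/-- Centring the dilation on the rotation axis makes x - b rotate along with the velocity and the
shift; the density depends only on scalars and on inner products of these vectors. -/
theorem dilMomentum_flow (s : ℝ) (p : Spacetime) :
    c.dilMomentum (axisPoint b) (helicalFlow Ω b s p) = c.dilMomentum (axisPoint b) p := by
  have hv0 : c.vel (helicalFlow Ω b s p) 0 = c.vel p 0 := by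
    rw [hsym.vel, Fin.sum_univ_succ]
    simp [flowJacobian_zero_zero, flowJacobian_zero_succ]
  have hv : ∀ i : Fin 3, c.vel (helicalFlow Ω b s p) i.succ
      = ∑ j, rot (Ω * s) i j * c.vel p (Fin.succ j) := fun i => by
    rw [hsym.vel, Fin.sum_univ_succ]
    simp [flowJacobian_succ_zero, flowJacobian_succ_succ]
  have h1 := rot_inner (Ω * s) (fun j => c.vel p (Fin.succ j)) fun j => p.2 j - axisPoint b j
  simp only [← hv, ← helicalFlow_snd_sub] at h1
  have h2 : ∑ i, c.shift (helicalFlow Ω b s p) i * ((helicalFlow Ω b s p).2 i - axisPoint b i)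
      = ∑ i, c.shift p i * (p.2 i - axisPoint b i) := by
    simp only [shift_flow hadm hsym s p, helicalFlow_snd_sub, Fin.sum_univ_three]
    ring
  have h3 : ∀ q, c.dilMomentum (axisPoint b) q = c.psi q ^ 6 * ((c.energy q + c.pressure q)
      * (c.lapse q * c.vel q 0) * (c.psi q ^ 4 * (c.vel q 0 *
        (∑ i, c.shift q i * (q.2 i - axisPoint b i))
        + ∑ i : Fin 3, c.vel q i.succ * (q.2 i - axisPoint b i)))) := fun q => by
    simp only [dilMomentum, mom_eq (hadm.lapse_pos q), velLow, Fin.sum_univ_three]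
    ring
  rw [h3, h3, h1, h2, hsym.energy, hsym.pressure, psi_flow hadm hsym, lapse_flow hadm hsym, hv0]

-- Each event is carried by the flow to the slice t = 0 at fixed distance from the axis point, so
-- one radius serves all times.
omit hadm in
theorem exists_matter_bound (hmatter : c.HasBoundedMatter) :
    ∃ R, ∀ p : Spacetime, R < ‖p.2‖ → c.energy p = 0 ∧ c.pressure p = 0 := by
  obtain ⟨R, hR⟩ := hmatter 0
  refine ⟨R + 2 * ‖(WithLp.toLp 2 (axisPoint b) : E3)‖, fun p hp => ?_⟩
  have h1 := norm_helicalFlow_snd Ω b (-p.1) p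
  have h2 := hR (helicalFlow Ω b (-p.1) p).2 (by linarith)
  have h3 : ((0 : ℝ), (helicalFlow Ω b (-p.1) p).2) = helicalFlow Ω b (-p.1) p :=
    Prod.ext (by simp [helicalFlow]) rfl
  rw [h3, hsym.energy, hsym.pressure] at h2
  exact h2

theorem integral_dilMomentum (t : ℝ) : ∫ x, c.dilMomentum (axisPoint b) (t, x)
    = ∫ x, c.dilMomentum (axisPoint b) (0, x) := by
  rw [← integral_comp_helicalFlow Ω b t 0]
  refine integral_congr_ae (Eventually.of_forall fun x => ?_)
  have : (t, (helicalFlow Ω b t (0, x)).2) = helicalFlow Ω b t (0, x) :=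
    Prod.ext (by simp [helicalFlow]) rfl
  simp only [this]
  exact dilMomentum_flow hadm hsym t (0, x)

end Fields

/-! ### The Euler equation on a slice -/

theorem continuous_pd {f : Spacetime → ℝ} (hf : ContDiff ℝ 1 f) (μ : Fin 4) :
    Continuous (pd μ f) := (hf.continuous_fderiv one_ne_zero).clm_apply continuous_const

theorem continuous_spacetimeDil {f : Spacetime → ℝ} (hf : ContDiff ℝ 1 f) (b : Fin 3 → ℝ) :
    Continuous (spacetimeDil b f) :=
  continuous_finsetSum _ fun k _ => Continuous.mul (by fun_prop) (continuous_pd hf _)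

theorem continuous_slice_integral {F : Spacetime → ℝ} (hF : Continuous F) {R : ℝ}
    (hR : ∀ p : Spacetime, R < ‖p.2‖ → F p = 0) : Continuous fun t => ∫ x : E3, F (t, x) := by
  have h1 := continuous_parametric_integral_of_continuous (μ := (volume : Measure E3))
    (s := Metric.closedBall (0 : E3) R) (f := fun (t : ℝ) (x : E3) => F (t, x)) hF
    (isCompact_closedBall _ _)
  refine h1.congr fun t => setIntegral_eq_integral_of_forall_compl_eq_zero fun x hx => hR _ ?_
  simpa using hx

/-- A time-dependent multiple of the dilation field, cut off in space. -/
def dilField (b : Fin 3 → ℝ) (θ : ℝ → ℝ) (η : E3 → ℝ) (p : Spacetime) : Fin 4 → ℝ :=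
  Fin.cons 0 fun i => θ p.1 * η p.2 * (p.2 i - b i)

theorem dilField_smooth (b : Fin 3 → ℝ) {θ : ℝ → ℝ} {η : E3 → ℝ} (hθ : ContDiff ℝ ∞ θ)
    (hη : ContDiff ℝ ∞ η) : ContDiff ℝ ∞ (dilField b θ η) := by
  refine contDiff_pi.2 fun μ => ?_
  refine Fin.cases ?_ (fun i => ?_) μ
  · exact contDiff_const
  · exact ((hθ.comp contDiff_fst).mul (hη.comp contDiff_snd)).mul
      ((coordSub_smooth _ i).comp contDiff_snd)

theorem hasCompactSupport_dilField (b : Fin 3 → ℝ) {θ : ℝ → ℝ} {η : E3 → ℝ}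
    (hθ : HasCompactSupport θ) (hη : HasCompactSupport η) :
    HasCompactSupport (dilField b θ η) := by
  refine HasCompactSupport.of_support_subset_isCompact (hθ.isCompact.prod hη.isCompact)
    fun p hp => ?_
  by_contra hn
  refine hp (funext fun μ => ?_)
  have h0 : θ p.1 * η p.2 = 0 := by
    rw [Set.mem_prod, not_and_or] at hn
    rcases hn with hn | hn
    · rw [image_eq_zero_of_notMem_tsupport hn, zero_mul]
    · rw [image_eq_zero_of_notMem_tsupport hn, mul_zero]
  refine Fin.cases rfl (fun i => ?_) μ
  simp [dilField, h0]

namespace Fields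

variable {c : Fields} (hadm : c.IsAdmissible)
include hadm

theorem continuous_dilWork (b : Fin 3 → ℝ) : Continuous (c.dilWork b) := by
  have c1 := hadm.psi_smooth.continuous
  have c2 := continuous_rhoH hadm
  have c3 := continuous_stressTrace hadm
  have c4 := hadm.lapse_smooth.continuous
  have c5 := continuous_spacetimeDil (hadm.lapse_smooth.of_le one_le_two) b
  have c6 := continuous_spacetimeDil (hadm.psi_smooth.of_le one_le_two) b
  have c7 : Continuous fun p =>
      ∑ k, c.mom p k * (spacetimeDil b (fun q => c.shift q k) p - c.shift p k) :=
    continuous_finsetSum _ fun k _ => (continuous_mom hadm k).mul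
      ((continuous_spacetimeDil ((shift_comp_smooth hadm k).of_le one_le_two) b).sub
        (shift_comp_smooth hadm k).continuous)
  have c8 : Continuous fun p =>
      2 * c.lapse p * c.stressTrace p * spacetimeDil b c.psi p / c.psi p :=
    (((continuous_const.mul c4).mul c3).mul c6).div c1 fun p => (hadm.psi_pos p).ne'
  exact (c1.pow 6).mul ((((c2.mul c5).neg.add c7).add c8).add (c4.mul c3))

theorem continuous_dilMomentum (b : Fin 3 → ℝ) : Continuous (c.dilMomentum b) :=
  (hadm.psi_smooth.continuous.pow 6).mul (continuous_finsetSum _ fun k _ =>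
    (continuous_mom hadm k).mul (by fun_prop))

theorem dilWork_slice (b : Fin 3 → ℝ) (t : ℝ) (x : E3) :
    c.dilWork b (t, x) = (c.slice t).dilWork b x := by
  have h : ∀ {f : Spacetime → ℝ}, ContDiff ℝ 2 f →
      spacetimeDil b f (t, x) = dil b (fun y => f (t, y)) x := fun hf => by
    refine Finset.sum_congr rfl fun k _ => ?_
    rw [pd_succ (hf.differentiable two_ne_zero _)]
  rw [dilWork, h hadm.lapse_smooth, h hadm.psi_smooth]
  simp only [h (shift_comp_smooth hadm _)]
  rfl

/-- Outside the matter both sides vanish; at points with ‖x‖ ≤ R the cutoff equals 1 in a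
neighbourhood, so its derivatives do not appear. -/
theorem euler_integrand_dilField {b : Fin 3 → ℝ} {θ : ℝ → ℝ} {η : E3 → ℝ} {R : ℝ}
    (hθ : ContDiff ℝ ∞ θ) (hη : ∀ x, ‖x‖ < R + 1 → η x = 1)
    (hR : ∀ p : Spacetime, R < ‖p.2‖ → c.energy p = 0 ∧ c.pressure p = 0) (p : Spacetime) :
    1 / 2 * (∑ μ, ∑ ν, c.stressUp p μ ν * c.lieMetric (dilField b θ η) p μ ν) * c.sqrtNegDet p
      = θ p.1 * c.dilWork b p + deriv θ p.1 * c.dilMomentum b p := by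
  rcases lt_or_ge R ‖p.2‖ with hp | hp
  · obtain ⟨h1, h2⟩ := hR p hp
    obtain ⟨h3, h4, h5⟩ := matter_eq_zero hadm (hR p hp)
    simp [stressUp, dilWork, dilMomentum, h1, h2, h3, h4, h5]
  · have hnear : ∀ᶠ q : Spacetime in 𝓝 p, ‖q.2‖ < R + 1 :=
      (continuous_snd.norm.continuousAt (x := p)).eventually_lt continuousAt_const (by linarith)
    have hsucc : ∀ i : Fin 3, (fun q => dilField b θ η q i.succ)
        =ᶠ[𝓝 p] fun q => θ q.1 * (q.2 i - b i) := fun i => by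
      filter_upwards [hnear] with q hq
      simp [dilField, hη _ hq]
    have hd : ∀ i : Fin 3, HasFDerivAt (fun q : Spacetime => θ q.1 * (q.2 i - b i))
        (θ p.1 • ((EuclideanSpace.proj i : E3 →L[ℝ] ℝ).comp (ContinuousLinearMap.snd ℝ ℝ E3))
          + (p.2 i - b i) • (deriv θ p.1 • ContinuousLinearMap.fst ℝ ℝ E3)) p := fun i => by
      have h1 := ((hθ.differentiable (by simp) p.1).hasDerivAt.comp_hasFDerivAt p
        (hasFDerivAt_fst (𝕜 := ℝ) (p := p)))
      have h2 := (((EuclideanSpace.proj i : E3 →L[ℝ] ℝ).comp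
        (ContinuousLinearMap.snd ℝ ℝ E3)).hasFDerivAt (x := p)).sub_const (b i)
      exact h1.mul h2
    refine euler_integrand hadm (ξ := dilField b θ η) rfl (fun i => (hsucc i).eq_of_nhds)
      (fun μ => ?_) (fun i => ?_) fun i k => ?_
    · simp [pd, dilField]
    · rw [pd, (hsucc i).fderiv_eq, (hd i).fderiv]
      simp [coordVec]
      ring
    · rw [pd, (hsucc i).fderiv_eq, (hd i).fderiv]
      simp [coordVec]

/-- Helical symmetry and the Euler equation make the work of the matter vanish on every slice. -/
theorem integral_dilWork_eq_zero {Ω b : ℝ} (hmatter : c.HasBoundedMatter)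
    (hsym : c.IsHelicallySymmetric Ω b) (heuler : c.SolvesEuler) (t : ℝ) :
    ∫ x, c.dilWork (axisPoint b) (t, x) = 0 := by
  obtain ⟨R, hR⟩ := exists_matter_bound hsym hmatter
  have hE := continuous_dilWork hadm (axisPoint b)
  have hJ := continuous_dilMomentum hadm (axisPoint b)
  have hE0 : ∀ p : Spacetime, R < ‖p.2‖ → c.dilWork (axisPoint b) p = 0 := fun p hp => by
    obtain ⟨h3, h4, h5⟩ := matter_eq_zero hadm (hR p hp)
    simp [dilWork, h3, h4, h5]
  have hJ0 : ∀ p : Spacetime, R < ‖p.2‖ → c.dilMomentum (axisPoint b) p = 0 := fun p hp => by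
    obtain ⟨h3, h4, h5⟩ := matter_eq_zero hadm (hR p hp)
    simp [dilMomentum, h5]
  have hI := continuous_slice_integral hE hE0
  obtain ⟨η, -, -, hη, hηs, -, hη1, -⟩ := exists_cutoffs
  have hRn : R ≤ (⌈R⌉₊ : ℝ) := Nat.le_ceil R
  have hprod : ∀ {θ : ℝ → ℝ} {F : Spacetime → ℝ}, Continuous θ → HasCompactSupport θ →
      Continuous F → (∀ p : Spacetime, R < ‖p.2‖ → F p = 0) →
      Integrable (fun p : Spacetime => θ p.1 * F p) ∧
      ∫ p : Spacetime, θ p.1 * F p = ∫ t, θ t * ∫ x, F (t, x) := by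
    intro θ F hθ hθs hF hF0
    have hint : Integrable (fun p : Spacetime => θ p.1 * F p) := by
      refine Continuous.integrable_of_hasCompactSupport ((hθ.comp continuous_fst).mul hF)
        (HasCompactSupport.of_support_subset_isCompact
          (hθs.isCompact.prod (isCompact_closedBall (0 : E3) R)) fun p hp => ⟨?_, ?_⟩)
      · exact subset_tsupport _ (left_ne_zero_of_mul hp)
      · by_contra hn
        refine right_ne_zero_of_mul hp (hF0 p ?_)
        simpa using hn
    refine ⟨hint, ?_⟩
    rw [Measure.volume_eq_prod] at hint ⊢
    rw [integral_prod _ hint]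
    simp only [integral_const_mul]
  have hweak : ∀ θ : ℝ → ℝ, ContDiff ℝ ∞ θ → HasCompactSupport θ →
      ∫ t, θ t • ∫ x, c.dilWork (axisPoint b) (t, x) = 0 := by
    intro θ hθ hθs
    have hθ' : Continuous (deriv θ) := hθ.continuous_deriv (by simp)
    -- The cutoff with index n equals 1 up to radius n + 1, so n = ⌈R⌉ reaches R + 1.
    have h1 := heuler (dilField (axisPoint b) θ (η ⌈R⌉₊)) (dilField_smooth _ hθ (hη _))
      (hasCompactSupport_dilField _ hθs (hηs _)) fun p => rfl
    simp only [euler_integrand_dilField hadm hθ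
      (fun x hx => hη1 ⌈R⌉₊ x (by linarith)) hR] at h1
    obtain ⟨i1, e1⟩ := hprod hθ.continuous hθs hE hE0
    obtain ⟨i2, e2⟩ := hprod hθ' hθs.deriv hJ hJ0
    rw [integral_add i1 i2, e1, e2] at h1
    -- The integrated dilation momentum is constant in time, so its contribution is that constant
    -- times ∫ θ' = 0.
    have h2 : ∫ t, deriv θ t = 0 := integral_eq_zero_of_hasDerivAt_of_integrable
      (fun t => (hθ.differentiable (by simp) t).hasDerivAt)
      (hθ'.integrable_of_hasCompactSupport hθs.deriv)
      (hθ.continuous.integrable_of_hasCompactSupport hθs)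
    simp only [integral_dilMomentum hadm hsym] at h1
    rw [integral_mul_const, h2, zero_mul, add_zero] at h1
    simpa only [smul_eq_mul] using h1
  -- Arbitrary θ gives vanishing for almost every time; continuity in t extends it to every slice.
  have hae := ae_eq_zero_of_integral_contDiff_smul_eq_zero hI.locallyIntegrable hweak
  have := (hI.ae_eq_iff_eq volume continuous_const).1 hae
  exact congrFun this t

end Fields

end IWM

end

/-! ### Assembly of the mass relations and the virial theorem -/

theorem mainTheorem10 (c : IWM.Fields) (hadm : c.IsAdmissible) (hmatter : c.HasBoundedMatter)
    (hfield : c.SolvesFieldEquations) (hfall : c.HasFalloff) (hmom : c.HasZeroMomentum) (t : ℝ) :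
    Integrable (fun x : IWM.E3 => c.virialDensity (t, x)) ∧
    ∃ Mchi MADM MK : ℝ,
      c.IsChiMass t Mchi ∧ c.IsADMMass t MADM ∧ c.IsConformalADMMass t MADM ∧ c.IsKomarMass t MK ∧
      Mchi = -MADM + 2 * MK ∧
      Mchi - MADM = 2 * c.virialIntegral t ∧
      (c.virialIntegral t = 0 ↔ Mchi = MADM) ∧
      (Mchi = MADM ↔ MK = MADM) ∧
      (∀ Ω b : ℝ, c.IsHelicallySymmetric Ω b → c.SolvesEuler →
        c.virialIntegral t = 0 ∧ Mchi = MADM ∧ MK = MADM) := by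
  have h := IWM.Fields.slice_isSolution hadm hmatter hfield hfall t
  have hpi := Real.pi_ne_zero
  have hV : c.virialIntegral t = ∫ x, (c.slice t).density x :=
    integral_congr_ae (Eventually.of_forall fun x => IWM.Fields.virialDensity_eq hadm t x)
  have hsum := h.integral_lap_add_lap
  rw [← hV] at hsum
  have h1 : 1 / (2 * Real.pi) * (∫ x, IWM.lap (c.slice t).chi x)
      = - (-(1 / (2 * Real.pi)) * ∫ x, IWM.lap (c.slice t).psi x)
        + 2 * (1 / (4 * Real.pi) * ((∫ x, IWM.lap (c.slice t).chi x)
          - ∫ x, IWM.lap (c.slice t).psi x)) := by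
    field_simp
    ring
  have h2 : 1 / (2 * Real.pi) * (∫ x, IWM.lap (c.slice t).chi x)
      - -(1 / (2 * Real.pi)) * (∫ x, IWM.lap (c.slice t).psi x) = 2 * c.virialIntegral t := by
    rw [neg_mul, sub_neg_eq_add, ← mul_add, hsum]
    field_simp
    ring
  refine ⟨h.integrable_density.congr (Eventually.of_forall fun x =>
      (IWM.Fields.virialDensity_eq hadm t x).symm), _, _, _, IWM.Fields.isChiMass hadm h,
    IWM.Fields.isADMMass hadm h, IWM.Fields.isConformalADMMass hadm h,
    IWM.Fields.isKomarMass hadm h, h1, h2, ⟨fun hv => by linarith, fun hv => by linarith⟩,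
    ⟨fun hv => by linarith, fun hv => by linarith⟩, fun Ω b hsym heuler => ?_⟩
  -- The virial integral is the dilation work, by the Pohozaev identity centred at the axis point,
  -- and the Euler equation makes that work vanish.
  have hzero : c.virialIntegral t = 0 := by
    rw [hV, ← h.integral_dilWork (IWM.axisPoint b),
      ← IWM.Fields.integral_dilWork_eq_zero hadm hmatter hsym heuler t]
    exact integral_congr_ae (Eventually.of_forall fun x =>
      (IWM.Fields.dilWork_slice hadm (IWM.axisPoint b) t x).symm)
  exact ⟨hzero, by linarith, by linarith⟩
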